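/- Throughout, $\Bbbk$ is a field of characteristic $0$; superspaces are $\mathbb Z_2$-graded $\Bbbk$-vector spaces, $|a|$ is the degree of a homogeneous element $a$, superspace morphisms are degree-preserving linear maps, $\tau(a\otimes b)=(-1)^{|a||b|}b\otimes a$, and sums $\sum_{(a)}$ use Sweedler's notation $\Delta(a)=\sum_{(a)}a'\otimes a''$ with homogeneous terms. Signs are written for homogeneous elements. **Matched pairs.** A pair $(X,A)$ of superbialgebras is matched by superspace morphisms $\alpha:A\otimes X\to X$, $\alpha(a\otimes x)=a\cdot x$, and $\beta:A\otimes X\to A$, $\beta(a\otimes x)=a^x$, if $\alpha$ makes $X$ a left $A$-module, $\beta$ makes $A$ a right $X$-module, both are morphisms of supercoalgebras, and for all $a,b\in A$, $x,y\in X$ $$a\cdot(xy)=\sum(-1)^{|x'||a''|}(a'\cdot x')\big((a'')^{x''}\cdot y\big),\qquad a\cdot 1_X=\epsilon_A(a)1_X,$$ $$(ab)^x=\sum(-1)^{|b''||x'|}\,a^{\,b'\cdot x'}\,(b'')^{x''},\qquad (1_A)^x=\epsilon_X(x)1_A,$$ $$\sum(-1)^{|a''||x'|}(a')^{x'}\otimes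 a''\cdot x''=\sum(-1)^{|a'||a''|+|x'||x''|+|a'||x''|}(a'')^{x''}\otimes a'\cdot x'.$$ **Theorem (QBT).** Let $(H,\mu,\eta,\Delta,\epsilon,S)$ be a finite-dimensional Hopf superalgebra over $\Bbbk$ with invertible antipode $S$. Let $H^*$ be the dual superspace, let $\lambda:H^*\otimes H^*\to(H\otimes H)^*$ be the isomorphism $\lambda(f\otimes g)(a\otimes b)=(-1)^{|g||a|}f(a)g(b)$, let $\chi:\Bbbk\to\Bbbk^*$ be the canonical isomorphism, and let $$X=(H^{op})^*=\big(H^*,\ \Delta^*\circ\lambda,\ \epsilon^*\circ\chi,\ \lambda^{-1}\circ(\mu\circ\tau)^*,\ \chi^{-1}\circ\eta^*,\ (S^{-1})^*\big).$$ Define $\alpha:H\otimes X\to X$ and $\beta:H\otimes X\to H$, for $a,x\in H$ and $f\in X$, by $$(a\cdot f)(x)=\alpha(a\otimes f)(x)=\sum_{(a)}(-1)^{|a||f|+|a'||a''|+|x||a'|}f\big(S^{-1}(a'')\,x\,a'\big),$$ $$a^f=\beta(a\otimes f)=\sum_{(a)}(-1)^{|a||f|+|a'''|(|a''|+|a'|)}f\big(S^{-1}(a''')\,a'\big)\,a'',$$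 where $\sum_{(a)} a'\otimes a''\otimes a'''=(\mathrm{id}\otimes\Delta)\Delta(a)$ in the second formula. Then: 1. $X$ is a Hopf superalgebra; 2. the pair $(X,H)$ is matched by $\alpha$ and $\beta$; 3. the quantum double $D(H)=X\bowtie H$ is well defined, that is, the superspace $X\otimes H$ is a Hopf superalgebra with product $$(f\otimes a)(g\otimes b)=\sum(-1)^{|g'||a''|}f(a'\cdot g')\otimes(a'')^{g''}b,$$ unit $1_X\otimes 1_H$, coproduct $\Delta(f\otimes a)=\sum(-1)^{|a'||f''|}(f'\otimes a')\otimes(f''\otimes a'')$, counit $\epsilon(f\otimes a)=\epsilon_X(f)\epsilon_H(a)$, and antipode $$S(f\otimes a)=\sum(-1)^{|f'||f''|+|a'||a''|+|f'||a''|+|f''||a''|+|f'||a'|}\;S_H(a'')\cdot S_X(f'')\otimes S_H(a')^{S_X(f')},$$ where $\Delta_X(g)=\sum g'\otimes g''$ and $\Delta_X(f)=\sum f'\otimes f''$. -/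

import Mathlib

open scoped TensorProduct

noncomputable section

namespace SuperHopf

/-! ### Superspaces -/

/-- A superspace over `k`: a vector space with a `ℤ/2`-grading `V = V₀ ⊕ V₁`;
`deg i` is the subspace of homogeneous vectors of degree `i`. -/
class Superspace (k V : Type*) [Field k] [AddCommGroup V] [Module k V] where
  deg : ZMod 2 → Submodule k V
  isCompl : IsCompl (deg 0) (deg 1)

theorem zmod2_cases (i : ZMod 2) : i = 0 ∨ i = 1 := by revert i; decide

theorem zmod2_eq_add_one {i j : ZMod 2} (h : ¬ j = i) : i = j + 1 := by revert i j; decide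

/-- The sign `(-1)^(i j)`, for degrees `i`, `j`. -/
def sgn (k : Type*) [Field k] (i j : ZMod 2) : k := (-1) ^ (i.val * j.val)

theorem sgn_comm (k : Type*) [Field k] (i j : ZMod 2) : sgn k i j = sgn k j i := by
  rw [sgn, sgn, mul_comm]

theorem sgn_add_right (k : Type*) [Field k] (i j l : ZMod 2) :
    sgn k i (j + l) = sgn k i j * sgn k i l := by
  have h : ∀ i j l : ZMod 2, (i.val * (j + l).val) % 2 = (i.val * j.val + i.val * l.val) % 2 := by
    decide
  rw [sgn, sgn, sgn, ← pow_add, neg_one_pow_eq_pow_mod_two, h, ← neg_one_pow_eq_pow_mod_two]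

section Superspace

variable {k : Type*} [Field k]
variable {V W : Type*} [AddCommGroup V] [Module k V] [AddCommGroup W] [Module k W]

/-- The subspace `V_i` of homogeneous vectors of degree `i`. -/
def deg (k V : Type*) [Field k] [AddCommGroup V] [Module k V] [Superspace k V] (i : ZMod 2) :
    Submodule k V := Superspace.deg i

theorem isCompl_deg (k V : Type*) [Field k] [AddCommGroup V] [Module k V] [Superspace k V]
    (i : ZMod 2) : IsCompl (deg k V i) (deg k V (i + 1)) := by
  fin_cases i
  · exact Superspace.isCompl
  · exact Superspace.isCompl.symm

/-- The projection of `V = V₀ ⊕ V₁` onto `V_i`. -/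
def proj (k V : Type*) [Field k] [AddCommGroup V] [Module k V] [Superspace k V] (i : ZMod 2) :
    V →ₗ[k] V := (deg k V i).projection (deg k V (i + 1)) (isCompl_deg k V i)

section
variable [Superspace k V] [Superspace k W]

theorem proj_mem (i : ZMod 2) (v : V) : proj k V i v ∈ deg k V i :=
  Submodule.projection_apply_mem _ _

theorem proj_of_mem {i : ZMod 2} {v : V} (hv : v ∈ deg k V i) (j : ZMod 2) :
    proj k V j v = if j = i then v else 0 := by
  split_ifs with h
  · subst h; exact Submodule.projection_apply_of_mem_left _ hv
  · refine (Submodule.projection_apply_eq_zero_iff _).2 ?_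
    exact zmod2_eq_add_one h ▸ hv

theorem proj_add (v : V) : proj k V 0 v + proj k V 1 v = v :=
  Submodule.projection_add_projection_eq_self (isCompl_deg k V 0) v

end

/-- A superspace morphism is a linear map of degree `0`. -/
def IsEven [Superspace k V] [Superspace k W] (f : V →ₗ[k] W) : Prop :=
  ∀ i, ∀ v ∈ deg k V i, f v ∈ deg k W i

/-- The ground field is a superspace concentrated in degree `0`. -/
instance instSuperspaceField : Superspace k k where
  deg i := if i = 0 then ⊤ else ⊥
  isCompl := by simpa using isCompl_top_bot

/-- The dual superspace: `(V*)_i` consists of the functionals that vanish on `V_{i+1}`,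
that is, `(V*)_i = (V_i)*`. -/
instance instSuperspaceDual [Superspace k V] : Superspace k (Module.Dual k V) where
  deg i := (deg k V (i + 1)).dualAnnihilator
  isCompl := by
    constructor
    · rw [Submodule.disjoint_def]
      intro f h0 h1
      rw [Submodule.mem_dualAnnihilator] at h0 h1
      ext v
      rw [← proj_add (k := k) v, map_add, h1 _ (proj_mem (k := k) 0 v),
        h0 _ (proj_mem (k := k) 1 v)]
      simp
    · rw [codisjoint_iff, eq_top_iff]
      intro f _
      have : f = f ∘ₗ proj k V 0 + f ∘ₗ proj k V 1 := by
        ext v; simp [← map_add, proj_add]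
      rw [this]
      refine Submodule.add_mem_sup ?_ ?_ <;> rw [Submodule.mem_dualAnnihilator] <;> intro v hv <;>
        rw [LinearMap.comp_apply, proj_of_mem hv, if_neg (by decide), map_zero]

/-- The tensor product of superspaces: `(V ⊗ W)_n` is spanned by the `v ⊗ w` with `v ∈ V_i`,
`w ∈ W_j` and `i + j = n`. -/
instance instSuperspaceTensor [Superspace k V] [Superspace k W] : Superspace k (V ⊗[k] W) where
  deg n := Submodule.span k
    {t | ∃ i j : ZMod 2, i + j = n ∧ ∃ v ∈ deg k V i, ∃ w ∈ deg k W j, v ⊗ₜ[k] w = t}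
  isCompl := by
    constructor
    · rw [Submodule.disjoint_def]
      intro t h0 h1
      let P : V ⊗[k] W →ₗ[k] V ⊗[k] W :=
        TensorProduct.map (proj k V 0) (proj k W 0) + TensorProduct.map (proj k V 1) (proj k W 1)
      have e0 : P t = t := by
        refine Submodule.span_induction (p := fun t _ ↦ P t = t) ?_ (map_zero P)
          (fun x y _ _ hx hy ↦ by rw [map_add, hx, hy]) (fun c x _ hx ↦ by rw [map_smul, hx]) h0
        rintro _ ⟨i, j, hij, v, hv, w, hw, rfl⟩
        rcases zmod2_cases i with rfl | rfl <;> rcases zmod2_cases j with rfl | rfl <;>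
          first
          | exact absurd hij (by decide)
          | simp [P, proj_of_mem hv, proj_of_mem hw]
      have e1 : P t = 0 := by
        refine Submodule.span_induction (p := fun t _ ↦ P t = 0) ?_ (map_zero P)
          (fun x y _ _ hx hy ↦ by rw [map_add, hx, hy, add_zero])
          (fun c x _ hx ↦ by rw [map_smul, hx, smul_zero]) h1
        rintro _ ⟨i, j, hij, v, hv, w, hw, rfl⟩
        rcases zmod2_cases i with rfl | rfl <;> rcases zmod2_cases j with rfl | rfl <;>
          first
          | exact absurd hij (by decide)
          | simp [P, proj_of_mem hv, proj_of_mem hw]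
      rw [← e0, e1]
    · rw [codisjoint_iff, eq_top_iff]
      intro t _
      induction t with
      | zero => exact Submodule.zero_mem _
      | add x y hx hy => exact Submodule.add_mem _ (hx trivial) (hy trivial)
      | tmul v w =>
        rw [← proj_add (k := k) v, ← proj_add (k := k) w, TensorProduct.add_tmul,
          TensorProduct.tmul_add, TensorProduct.tmul_add]
        refine Submodule.add_mem _ (Submodule.add_mem _ ?_ ?_) (Submodule.add_mem _ ?_ ?_)
        · exact Submodule.mem_sup_left (Submodule.subset_span
            ⟨0, 0, by decide, _, proj_mem 0 v, _, proj_mem 0 w, rfl⟩)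
        · exact Submodule.mem_sup_right (Submodule.subset_span
            ⟨0, 1, by decide, _, proj_mem 0 v, _, proj_mem 1 w, rfl⟩)
        · exact Submodule.mem_sup_right (Submodule.subset_span
            ⟨1, 0, by decide, _, proj_mem 1 v, _, proj_mem 0 w, rfl⟩)
        · exact Submodule.mem_sup_left (Submodule.subset_span
            ⟨1, 1, by decide, _, proj_mem 1 v, _, proj_mem 1 w, rfl⟩)

theorem tmul_mem [Superspace k V] [Superspace k W] {i j : ZMod 2} {v : V} {w : W}
    (hv : v ∈ deg k V i) (hw : w ∈ deg k W j) : v ⊗ₜ[k] w ∈ deg k (V ⊗[k] W) (i + j) :=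
  Submodule.subset_span ⟨i, j, rfl, v, hv, w, hw, rfl⟩

theorem mem_deg_dual [Superspace k V] {i : ZMod 2} {f : Module.Dual k V} :
    f ∈ deg k (Module.Dual k V) i ↔ ∀ v ∈ deg k V (i + 1), f v = 0 :=
  Submodule.mem_dualAnnihilator f

/-- The linear map `v ⊗ w ↦ (-1)^(|v||w|) v ⊗ w`. -/
def signTwist (k V W : Type*) [Field k] [AddCommGroup V] [Module k V] [AddCommGroup W]
    [Module k W] [Superspace k V] [Superspace k W] : V ⊗[k] W →ₗ[k] V ⊗[k] W :=
  ∑ i : ZMod 2, ∑ j : ZMod 2, sgn k i j • TensorProduct.map (proj k V i) (proj k W j)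

theorem signTwist_tmul [Superspace k V] [Superspace k W] {i j : ZMod 2} {v : V} {w : W}
    (hv : v ∈ deg k V i) (hw : w ∈ deg k W j) :
    signTwist k V W (v ⊗ₜ w) = sgn k i j • v ⊗ₜ[k] w := by
  rw [signTwist, LinearMap.sum_apply, Finset.sum_eq_single i, LinearMap.sum_apply,
    Finset.sum_eq_single j]
  · simp [proj_of_mem hv, proj_of_mem hw]
  · intro l _ hl; simp [proj_of_mem hw, hl]
  · simp
  · intro l _ hl; simp [proj_of_mem hv, hl]
  · simp

/-- The super flip `τ(v ⊗ w) = (-1)^(|v||w|) w ⊗ v`. -/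
def tau (k V W : Type*) [Field k] [AddCommGroup V] [Module k V] [AddCommGroup W]
    [Module k W] [Superspace k V] [Superspace k W] : V ⊗[k] W →ₗ[k] W ⊗[k] V :=
  (TensorProduct.comm k V W).toLinearMap ∘ₗ signTwist k V W

theorem tau_tmul [Superspace k V] [Superspace k W] {i j : ZMod 2} {v : V} {w : W}
    (hv : v ∈ deg k V i) (hw : w ∈ deg k W j) :
    tau k V W (v ⊗ₜ w) = sgn k i j • w ⊗ₜ[k] v := by
  simp [tau, signTwist_tmul hv hw]

/-- The map `id ⊗ τ ⊗ id`:
`(a ⊗ b) ⊗ (c ⊗ d) ↦ (-1)^(|b||c|) (a ⊗ c) ⊗ (b ⊗ d)`. -/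
def middleSwap (k A B C D : Type*) [Field k] [AddCommGroup A] [Module k A]
    [AddCommGroup B] [Module k B] [AddCommGroup C] [Module k C] [AddCommGroup D] [Module k D]
    [Superspace k B] [Superspace k C] :
    (A ⊗[k] B) ⊗[k] (C ⊗[k] D) →ₗ[k] (A ⊗[k] C) ⊗[k] (B ⊗[k] D) :=
  (TensorProduct.assoc k A C (B ⊗[k] D)).symm.toLinearMap ∘ₗ
    LinearMap.lTensor A ((TensorProduct.assoc k C B D).toLinearMap ∘ₗ
      LinearMap.rTensor D (tau k B C) ∘ₗ (TensorProduct.assoc k B C D).symm.toLinearMap) ∘ₗ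
    (TensorProduct.assoc k A B (C ⊗[k] D)).toLinearMap

theorem middleSwap_tmul {A B C D : Type*} [AddCommGroup A] [Module k A]
    [AddCommGroup B] [Module k B] [AddCommGroup C] [Module k C] [AddCommGroup D] [Module k D]
    [Superspace k B] [Superspace k C] {i j : ZMod 2} (a : A) {b : B} {c : C} (d : D)
    (hb : b ∈ deg k B i) (hc : c ∈ deg k C j) :
    middleSwap k A B C D ((a ⊗ₜ b) ⊗ₜ (c ⊗ₜ d)) = sgn k i j • (a ⊗ₜ c) ⊗ₜ[k] (b ⊗ₜ[k] d) := by
  simp [middleSwap, tau_tmul hb hc, TensorProduct.smul_tmul']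

theorem signTwist_involutive [Superspace k V] [Superspace k W] :
    signTwist k V W ∘ₗ signTwist k V W = LinearMap.id := by
  have hs : ∀ i j : ZMod 2, sgn k i j * sgn k i j = 1 := by
    intro i j; rw [sgn, ← pow_add, ← two_mul, pow_mul]; simp
  have key : ∀ (i j : ZMod 2) (v : V) (w : W), v ∈ deg k V i → w ∈ deg k W j →
      signTwist k V W (signTwist k V W (v ⊗ₜ w)) = v ⊗ₜ w := by
    intro i j v w hv hw
    rw [signTwist_tmul hv hw, map_smul, signTwist_tmul hv hw, smul_smul, hs, one_smul]
  refine TensorProduct.ext' fun v w ↦ ?_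
  rw [LinearMap.comp_apply, LinearMap.id_apply, ← proj_add (k := k) v, ← proj_add (k := k) w]
  simp only [TensorProduct.add_tmul, TensorProduct.tmul_add, map_add]
  rw [key 0 0 _ _ (proj_mem _ _) (proj_mem _ _), key 0 1 _ _ (proj_mem _ _) (proj_mem _ _),
    key 1 0 _ _ (proj_mem _ _) (proj_mem _ _), key 1 1 _ _ (proj_mem _ _) (proj_mem _ _)]

/-- The isomorphism `λ : V* ⊗ W* ≃ (V ⊗ W)*`, `λ(f ⊗ g)(v ⊗ w) = (-1)^(|g||v|) f(v) g(w)`, for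
finite-dimensional superspaces; `f(v) = 0` unless `|f| = |v|`, so that the sign may be read as
`(-1)^(|f||g|)`. -/
def lam (k V W : Type*) [Field k] [AddCommGroup V] [Module k V] [AddCommGroup W]
    [Module k W] [Superspace k V] [Superspace k W] [FiniteDimensional k V]
    [FiniteDimensional k W] :
    Module.Dual k V ⊗[k] Module.Dual k W ≃ₗ[k] Module.Dual k (V ⊗[k] W) :=
  LinearEquiv.ofLinearMap (signTwist k (Module.Dual k V) (Module.Dual k W))
    (signTwist k (Module.Dual k V) (Module.Dual k W)) signTwist_involutive signTwist_involutive
    ≪≫ₗ TensorProduct.dualDistribEquiv k V W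

theorem lam_tmul_apply [Superspace k V] [Superspace k W] [FiniteDimensional k V]
    [FiniteDimensional k W] {i j : ZMod 2} (f : Module.Dual k V) {g : Module.Dual k W} {v : V}
    (w : W) (hv : v ∈ deg k V i) (hg : g ∈ deg k (Module.Dual k W) j) :
    lam k V W (f ⊗ₜ g) (v ⊗ₜ w) = sgn k j i * (f v * g w) := by
  have hc := sgn_comm k j i
  have key : ∀ l, lam k V W (proj k (Module.Dual k V) l f ⊗ₜ g) (v ⊗ₜ w) =
      sgn k j i * (proj k (Module.Dual k V) l f v * g w) := by
    intro l
    have : lam k V W (proj k (Module.Dual k V) l f ⊗ₜ g) (v ⊗ₜ w) =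
        sgn k l j * (proj k (Module.Dual k V) l f v * g w) := by
      simp [lam, signTwist_tmul (proj_mem l f) hg]
    rw [this]
    by_cases h : l = i
    · rw [h, hc]
    · have h' : i = l + 1 := zmod2_eq_add_one h
      rw [mem_deg_dual.1 (proj_mem l f) v (h' ▸ hv)]; simp
  rw [← proj_add (k := k) f, TensorProduct.add_tmul, map_add, LinearMap.add_apply, key, key,
    LinearMap.add_apply]
  ring

end Superspace

/-! ### Superbialgebras and Hopf superalgebras -/

/-- The operations `(μ, η, Δ, ε)` of a superbialgebra, without its axioms. -/
structure BialgOps (k V : Type*) [Field k] [AddCommGroup V] [Module k V] where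
  mul : V ⊗[k] V →ₗ[k] V
  unit : k →ₗ[k] V
  comul : V →ₗ[k] V ⊗[k] V
  counit : V →ₗ[k] k

/-- The operations `(μ, η, Δ, ε, S)` of a Hopf superalgebra, without its axioms. -/
structure HopfOps (k V : Type*) [Field k] [AddCommGroup V] [Module k V] extends
    BialgOps k V where
  antipode : V →ₗ[k] V

section Hopf

variable {k : Type*} [Field k]
variable {V W : Type*} [AddCommGroup V] [Module k V] [AddCommGroup W] [Module k W]
variable [Superspace k V] [Superspace k W]

/-- The comultiplication `(id ⊗ τ ⊗ id) ∘ (Δ ⊗ Δ)` of the tensor product of two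
supercoalgebras. -/
def tensorComul (A : BialgOps k V) (B : BialgOps k W) :
    V ⊗[k] W →ₗ[k] (V ⊗[k] W) ⊗[k] (V ⊗[k] W) :=
  middleSwap k V V W W ∘ₗ TensorProduct.map A.comul B.comul

/-- The counit `v ⊗ w ↦ ε(v) ε(w)` of the tensor product of two supercoalgebras. -/
def tensorCounit (A : BialgOps k V) (B : BialgOps k W) : V ⊗[k] W →ₗ[k] k :=
  LinearMap.mul' k k ∘ₗ TensorProduct.map A.counit B.counit

/-- The axioms of a superbialgebra: `(V, μ, η)` is a superalgebra, `(V, Δ, ε)` is a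
supercoalgebra, and `Δ`, `ε` are morphisms of superalgebras. -/
structure IsSuperbialgebra (A : BialgOps k V) : Prop where
  even_mul : IsEven A.mul
  even_unit : IsEven A.unit
  even_comul : IsEven A.comul
  even_counit : IsEven A.counit
  mul_assoc : ∀ a b c : V, A.mul (A.mul (a ⊗ₜ b) ⊗ₜ c) = A.mul (a ⊗ₜ A.mul (b ⊗ₜ c))
  one_mul : ∀ a : V, A.mul (A.unit 1 ⊗ₜ a) = a
  mul_one : ∀ a : V, A.mul (a ⊗ₜ A.unit 1) = a
  coassoc : (TensorProduct.assoc k V V V).toLinearMap ∘ₗ LinearMap.rTensor V A.comul ∘ₗ A.comul =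
    LinearMap.lTensor V A.comul ∘ₗ A.comul
  counit_comul : ∀ a : V,
    TensorProduct.lid k V (LinearMap.rTensor V A.counit (A.comul a)) = a
  comul_counit : ∀ a : V,
    TensorProduct.rid k V (LinearMap.lTensor V A.counit (A.comul a)) = a
  comul_mul : A.comul ∘ₗ A.mul = TensorProduct.map A.mul A.mul ∘ₗ tensorComul A A
  comul_one : A.comul (A.unit 1) = A.unit 1 ⊗ₜ A.unit 1
  counit_mul : ∀ a b : V, A.counit (A.mul (a ⊗ₜ b)) = A.counit a * A.counit b
  counit_one : A.counit (A.unit 1) = 1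

/-- The axioms of a Hopf superalgebra. -/
structure IsHopfSuperalgebra (A : HopfOps k V) : Prop extends
    IsSuperbialgebra A.toBialgOps where
  even_antipode : IsEven A.antipode
  antipode_left : A.mul ∘ₗ TensorProduct.map A.antipode LinearMap.id ∘ₗ A.comul =
    A.unit ∘ₗ A.counit
  antipode_right : A.mul ∘ₗ TensorProduct.map LinearMap.id A.antipode ∘ₗ A.comul =
    A.unit ∘ₗ A.counit

/-! ### Matched pairs and bicrossed products -/

/-- `(X, A)` is a matched pair of superbialgebras with respect to `α(a ⊗ x) = a · x` and
`β(a ⊗ x) = a ^ x`. Here `V` is the underlying superspace of `A` and `W` that of `X`. -/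
structure IsMatchedPair (X : BialgOps k W) (A : BialgOps k V)
    (α : V ⊗[k] W →ₗ[k] W) (β : V ⊗[k] W →ₗ[k] V) : Prop where
  left_bialgebra : IsSuperbialgebra X
  right_bialgebra : IsSuperbialgebra A
  even_left : IsEven α
  even_right : IsEven β
  /-- `α` makes `X` a left `A`-module. -/
  mul_act : ∀ (a b : V) (x : W), α (A.mul (a ⊗ₜ b) ⊗ₜ x) = α (a ⊗ₜ α (b ⊗ₜ x))
  one_act : ∀ x : W, α (A.unit 1 ⊗ₜ x) = x
  /-- `α` is a morphism of supercoalgebras. -/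
  comul_left : X.comul ∘ₗ α = TensorProduct.map α α ∘ₗ tensorComul A X
  counit_left : X.counit ∘ₗ α = tensorCounit A X
  /-- `β` makes `A` a right `X`-module. -/
  act_mul : ∀ (a : V) (x y : W), β (a ⊗ₜ X.mul (x ⊗ₜ y)) = β (β (a ⊗ₜ x) ⊗ₜ y)
  act_one : ∀ a : V, β (a ⊗ₜ X.unit 1) = a
  /-- `β` is a morphism of supercoalgebras. -/
  comul_right : A.comul ∘ₗ β = TensorProduct.map β β ∘ₗ tensorComul A X
  counit_right : A.counit ∘ₗ β = tensorCounit A X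
  /-- `a · (xy) = ∑ (-1)^(|x'||a''|) (a' · x') ((a'' ^ x'') · y)` -/
  left_mul : ∀ (a : V) (x y : W), α (a ⊗ₜ X.mul (x ⊗ₜ y)) =
    X.mul (TensorProduct.map α
      (α ∘ₗ LinearMap.rTensor W β ∘ₗ (TensorProduct.mk k (V ⊗[k] W) W).flip y)
      (tensorComul A X (a ⊗ₜ x)))
  /-- `a · 1 = ε(a) 1` -/
  left_one : ∀ a : V, α (a ⊗ₜ X.unit 1) = A.counit a • X.unit 1
  /-- `(ab) ^ x = ∑ (-1)^(|b''||x'|) (a ^ (b' · x')) (b'' ^ x'')` -/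
  right_mul : ∀ (a b : V) (x : W), β (A.mul (a ⊗ₜ b) ⊗ₜ x) =
    A.mul (TensorProduct.map (β ∘ₗ LinearMap.lTensor V α ∘ₗ TensorProduct.mk k V (V ⊗[k] W) a) β
      (tensorComul A X (b ⊗ₜ x)))
  /-- `1 ^ x = ε(x) 1` -/
  right_one : ∀ x : W, β (A.unit 1 ⊗ₜ x) = X.counit x • A.unit 1
  /-- `∑ (-1)^(|a''||x'|) a' ^ x' ⊗ a'' · x'' =
  ∑ (-1)^(|a'||a''| + |x'||x''| + |a'||x''|) a'' ^ x'' ⊗ a' · x'` -/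
  exchange : TensorProduct.map β α ∘ₗ tensorComul A X =
    TensorProduct.map β α ∘ₗ middleSwap k V V W W ∘ₗ
      TensorProduct.map (tau k V V) (tau k W W) ∘ₗ TensorProduct.map A.comul X.comul

/-- The bicrossed product `X ⋈ A` on the superspace `X ⊗ A`:
`(x ⊗ a)(y ⊗ b) = ∑ (-1)^(|y'||a''|) x (a' · y') ⊗ (a'' ^ y'') b`, with unit `1 ⊗ 1`, the
comultiplication and counit of the tensor product of supercoalgebras, and antipode
`S(x ⊗ a) = ∑ (-1)^(|x'||x''| + |a'||a''| + |x'||a''| + |x''||a''| + |x'||a'|)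
S(a'') · S(x'') ⊗ S(a') ^ S(x')`. -/
def bicrossed (X : HopfOps k W) (A : HopfOps k V)
    (α : V ⊗[k] W →ₗ[k] W) (β : V ⊗[k] W →ₗ[k] V) : HopfOps k (W ⊗[k] V) where
  mul := TensorProduct.map X.mul A.mul ∘ₗ
    -- `x ⊗ ((a' · y' ⊗ a'' ^ y'') ⊗ b) ↦ (x ⊗ a' · y') ⊗ (a'' ^ y'' ⊗ b)`
    (TensorProduct.assoc k W W (V ⊗[k] V)).symm.toLinearMap ∘ₗ
    LinearMap.lTensor W ((TensorProduct.assoc k W V V).toLinearMap ∘ₗ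
      LinearMap.rTensor V
        (TensorProduct.map α β ∘ₗ tensorComul A.toBialgOps X.toBialgOps) ∘ₗ
      (TensorProduct.assoc k V W V).symm.toLinearMap) ∘ₗ
    -- `(x ⊗ a) ⊗ (y ⊗ b) ↦ x ⊗ (a ⊗ (y ⊗ b))`
    (TensorProduct.assoc k W V (W ⊗[k] V)).toLinearMap
  unit := LinearMap.toSpanSingleton k (W ⊗[k] V) (X.unit 1 ⊗ₜ A.unit 1)
  comul := tensorComul X.toBialgOps A.toBialgOps
  counit := tensorCounit X.toBialgOps A.toBialgOps
  antipode := TensorProduct.map α β ∘ₗ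
    TensorProduct.map (TensorProduct.map A.antipode X.antipode)
      (TensorProduct.map A.antipode X.antipode) ∘ₗ
    -- `(x' ⊗ x'') ⊗ (a' ⊗ a'') ↦ (x'' ⊗ x') ⊗ (a'' ⊗ a') ↦ (a'' ⊗ a') ⊗ (x'' ⊗ x')
    -- ↦ (a'' ⊗ x'') ⊗ (a' ⊗ x')`, with the signs of the super flips
    middleSwap k V V W W ∘ₗ tau k (W ⊗[k] W) (V ⊗[k] V) ∘ₗ
    TensorProduct.map (tau k W W) (tau k V V) ∘ₗ
    TensorProduct.map X.comul A.comul

/-! ### The dual of the opposite Hopf superalgebra and the coadjoint-type actions -/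

/-- The Hopf superalgebra
`(H^op)^* = (H^*, Δ^* ∘ λ, ε^* ∘ χ, λ⁻¹ ∘ (μ ∘ τ)^*, χ⁻¹ ∘ η^*, (S⁻¹)^*)`,
where `χ : k ≃ k^*` is the canonical isomorphism and `Sinv` stands for `S⁻¹`. -/
def opDual [FiniteDimensional k V] (H : HopfOps k V) (Sinv : V →ₗ[k] V) :
    HopfOps k (Module.Dual k V) where
  mul := Module.Dual.transpose H.comul ∘ₗ (lam k V V).toLinearMap
  unit := Module.Dual.transpose H.counit ∘ₗ LinearMap.mul k k
  comul := (lam k V V).symm.toLinearMap ∘ₗ Module.Dual.transpose (H.mul ∘ₗ tau k V V)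
  counit := Module.Dual.eval k k 1 ∘ₗ Module.Dual.transpose H.unit
  antipode := Module.Dual.transpose Sinv

/-- The left action `α : H ⊗ H^* → H^*`, which for homogeneous `a`, `f`, `x` is
`(a · f)(x) = ∑ (-1)^(|a||f| + |a'||a''| + |x||a'|) f(S⁻¹(a'') x a')`. -/
def coadjLeft (H : HopfOps k V) (Sinv : V →ₗ[k] V) :
    V ⊗[k] Module.Dual k V →ₗ[k] Module.Dual k V :=
  TensorProduct.curry (
    -- `(f ⊗ a) ⊗ x ↦ f(S⁻¹(a'') x a')`
    contractLeft k V ∘ₗ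
    LinearMap.lTensor (Module.Dual k V) (
      -- `(a'' ⊗ x) ⊗ a' ↦ (S⁻¹(a'') x) a'`
      H.mul ∘ₗ LinearMap.rTensor V (H.mul ∘ₗ LinearMap.rTensor V Sinv) ∘ₗ
      -- `a' ⊗ (a'' ⊗ x) ↦ (-1)^(|a'|(|a''| + |x|)) (a'' ⊗ x) ⊗ a'`
      tau k V (V ⊗[k] V) ∘ₗ
      (TensorProduct.assoc k V V V).toLinearMap ∘ₗ LinearMap.rTensor V H.comul) ∘ₗ
    (TensorProduct.assoc k (Module.Dual k V) V V).toLinearMap ∘ₗ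
    LinearMap.rTensor V (tau k V (Module.Dual k V)))

/-- The right action `β : H ⊗ H^* → H`, which for homogeneous `a` and `f` is
`a ^ f = ∑ (-1)^(|a||f| + |a'''|(|a''| + |a'|)) f(S⁻¹(a''') a') a''`. -/
def coadjRight (H : HopfOps k V) (Sinv : V →ₗ[k] V) :
    V ⊗[k] Module.Dual k V →ₗ[k] V :=
  (TensorProduct.lid k V).toLinearMap ∘ₗ LinearMap.rTensor V (contractLeft k V) ∘ₗ
    (TensorProduct.assoc k (Module.Dual k V) V V).symm.toLinearMap ∘ₗ
    LinearMap.lTensor (Module.Dual k V) (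
      -- `a''' ⊗ (a' ⊗ a'') ↦ S⁻¹(a''') a' ⊗ a''`
      LinearMap.rTensor V (H.mul ∘ₗ LinearMap.rTensor V Sinv) ∘ₗ
      (TensorProduct.assoc k V V V).symm.toLinearMap ∘ₗ
      -- `(a' ⊗ a'') ⊗ a''' ↦ (-1)^(|a'''|(|a'| + |a''|)) a''' ⊗ (a' ⊗ a'')`
      tau k (V ⊗[k] V) V ∘ₗ
      (TensorProduct.assoc k V V V).symm.toLinearMap ∘ₗ
      LinearMap.lTensor V H.comul ∘ₗ H.comul) ∘ₗ
    tau k V (Module.Dual k V)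

/-- `coadjLeft` is given by the displayed formula. -/
theorem coadjLeft_tmul_apply (H : HopfOps k V) (Sinv : V →ₗ[k] V) {ι : Type*} (s : Finset ι)
    {a x : V} {f : Module.Dual k V} {i j l : ZMod 2} (a₁ a₂ : ι → V) (p q : ι → ZMod 2)
    (ha : a ∈ deg k V i) (hf : f ∈ deg k (Module.Dual k V) j) (hx : x ∈ deg k V l)
    (h₁ : ∀ m ∈ s, a₁ m ∈ deg k V (p m)) (h₂ : ∀ m ∈ s, a₂ m ∈ deg k V (q m))
    (hs : H.comul a = ∑ m ∈ s, a₁ m ⊗ₜ a₂ m) :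
    coadjLeft H Sinv (a ⊗ₜ f) x = ∑ m ∈ s, sgn k i j * sgn k (p m) (q m) * sgn k l (p m) *
      f (H.mul (H.mul (Sinv (a₂ m) ⊗ₜ x) ⊗ₜ a₁ m)) := by
  simp only [coadjLeft, TensorProduct.curry_apply, LinearMap.comp_apply, LinearMap.rTensor_tmul,
    tau_tmul ha hf, LinearEquiv.coe_coe, TensorProduct.assoc_tmul,
    LinearMap.lTensor_tmul, hs, TensorProduct.sum_tmul, map_sum, TensorProduct.smul_tmul',
    TensorProduct.tmul_sum, contractLeft_apply]
  refine Finset.sum_congr rfl fun m hm ↦ ?_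
  rw [tau_tmul (h₁ m hm) (tmul_mem (h₂ m hm) hx), sgn_add_right, sgn_comm k (p m) l]
  simp only [map_smul, LinearMap.rTensor_tmul, LinearMap.comp_apply, smul_eq_mul,
    LinearMap.smul_apply]
  ring

/-- `coadjRight` is given by the displayed formula. -/
theorem coadjRight_tmul (H : HopfOps k V) (Sinv : V →ₗ[k] V) {ι : Type*} (s : Finset ι)
    {a : V} {f : Module.Dual k V} {i j : ZMod 2} (a₁ a₂ a₃ : ι → V) (p q r : ι → ZMod 2)
    (ha : a ∈ deg k V i) (hf : f ∈ deg k (Module.Dual k V) j)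
    (h₁ : ∀ m ∈ s, a₁ m ∈ deg k V (p m)) (h₂ : ∀ m ∈ s, a₂ m ∈ deg k V (q m))
    (h₃ : ∀ m ∈ s, a₃ m ∈ deg k V (r m))
    (hs : LinearMap.lTensor V H.comul (H.comul a) = ∑ m ∈ s, a₁ m ⊗ₜ (a₂ m ⊗ₜ a₃ m)) :
    coadjRight H Sinv (a ⊗ₜ f) = ∑ m ∈ s, (sgn k i j * sgn k (r m) (q m + p m) *
      f (H.mul (Sinv (a₃ m) ⊗ₜ a₁ m))) • a₂ m := by
  simp only [coadjRight, LinearMap.comp_apply, tau_tmul ha hf, map_smul, LinearEquiv.coe_coe,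
    LinearMap.lTensor_tmul, hs, map_sum, TensorProduct.tmul_sum, Finset.smul_sum,
    TensorProduct.assoc_symm_tmul]
  refine Finset.sum_congr rfl fun m hm ↦ ?_
  rw [tau_tmul (tmul_mem (h₁ m hm) (h₂ m hm)) (h₃ m hm), sgn_comm k _ (r m), add_comm (p m)]
  simp only [map_smul, TensorProduct.assoc_symm_tmul, LinearMap.rTensor_tmul,
    LinearMap.comp_apply, TensorProduct.tmul_smul, contractLeft_apply, TensorProduct.lid_tmul,
    smul_smul, mul_assoc]

/-- The quantum double `D(H) = (H^op)^* ⋈ H`. -/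
def quantumDouble [FiniteDimensional k V] (H : HopfOps k V) (Sinv : V →ₗ[k] V) :
    HopfOps k (Module.Dual k V ⊗[k] V) :=
  bicrossed (opDual H Sinv) H (coadjLeft H Sinv) (coadjRight H Sinv)

end Hopf

end SuperHopf

end

open scoped TensorProduct
noncomputable section
namespace SuperHopf

/-! ### Signs, even maps, and naturality of the super flip and of the middle swap. -/

section Linear

variable {k : Type*} [Field k]
variable {A B C D E F M : Type*} [AddCommGroup A] [Module k A] [AddCommGroup B] [Module k B]
  [AddCommGroup C] [Module k C] [AddCommGroup D] [Module k D]
  [AddCommGroup E] [Module k E] [AddCommGroup F] [Module k F]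
  [AddCommGroup M] [Module k M]

/-! The evaluation pairing `s(a ⊗ f) = (-1)^(|a||f|) f(a)` between `H` and `X = (H^op)^*` is a skew
pairing: it turns products in `X` into products of values, and products in `H` into products of
values in the reverse order, because the coproduct of `X` is dual to the opposite product. It is
invertible for convolution on the supercoalgebra `H ⊗ X`, with inverse `t = s ∘ (S⁻¹ ⊗ id)`
(`isSkewPairing_evalPairing`).

Conjugate the super flip by this functional: `R = s * τ * t : H ⊗ X → X ⊗ H` (`exchangeMap`). The
flip is a morphism of supercoalgebras, and so is `R`, since the inner factors `t * s` cancel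
(`star_conj`). The two multiplicativity rules of `s` make `R` compatible with both products
(`exchangeMap_mul_left`, `exchangeMap_mul_right`). Thus `R` is a commutation rule for moving `H`
past `X`. Its components `(id ⊗ ε) R` and `(ε ⊗ id) R` are the given actions `α` and `β`; the
explicit signs are compared there (`coadjLeft_eq_conj`, `coadjRight_eq_conj`).

A supercoalgebra morphism into a tensor product is recovered from its components, so `R = (α ⊗ β) ∘
Δ` (`map_comp_tensorComul`). The matched pair axioms other than the exchange condition then follow
from the rules for `R` by applying a counit to one leg. The exchange condition holds because
conjugation commutes with forming `∑ f(a') ⊗ g(a'')` (`star_snd_fst_exchangeMap`). The product of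
the double is `(μ ⊗ μ)(id ⊗ R ⊗ id)`: it is a composite of supercoalgebra morphisms, and it is
associative by the rules for `R`. The identity of `X ⊗ H` is a convolution product of two embedded
projections, and the antipode is the product of their inverses in reverse order.

That `X` is a Hopf superalgebra is shown in two steps: `H^op` has antipode `S⁻¹`, and the dual of a
finite-dimensional Hopf superalgebra is one, as `λ` respects associativity and the middle swap. The
arguments use maps rather than elements, so signs are computed only in a few coherence lemmas and in
the final comparison. -/

theorem sgn_mul_self (i j : ZMod 2) : sgn k i j * sgn k i j = 1 := by
  rw [sgn, ← pow_add, ← two_mul, pow_mul]; simp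

theorem sgn_add_left (i j l : ZMod 2) : sgn k (i + j) l = sgn k i l * sgn k j l := by
  rw [sgn_comm, sgn_add_right, sgn_comm k l i, sgn_comm k l j]

@[simp] theorem sgn_zero_left (i : ZMod 2) : sgn k 0 i = 1 := by simp [sgn]

@[simp] theorem sgn_zero_right (i : ZMod 2) : sgn k i 0 = 1 := by simp [sgn]

/-- Homogeneous vectors span. This and its tensor versions reduce each sign identity to homogeneous
pure tensors. -/
theorem linear_ext_homog [Superspace k A] {f g : A →ₗ[k] M}
    (h : ∀ i, ∀ a ∈ deg k A i, f a = g a) : f = g := by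
  ext a
  rw [← proj_add (k := k) a, map_add, map_add, h 0 _ (proj_mem _ _), h 1 _ (proj_mem _ _)]

theorem tensor_ext_homog [Superspace k A] [Superspace k B] {f g : A ⊗[k] B →ₗ[k] M}
    (h : ∀ i j, ∀ a ∈ deg k A i, ∀ b ∈ deg k B j, f (a ⊗ₜ b) = g (a ⊗ₜ b)) : f = g :=
  TensorProduct.ext (linear_ext_homog fun i a ha ↦ linear_ext_homog fun j b hb ↦ h i j a ha b hb)

theorem tensor_ext_homog_left [Superspace k A] [Superspace k B] [Superspace k C]
    {f g : (A ⊗[k] B) ⊗[k] C →ₗ[k] M}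
    (h : ∀ i j l, ∀ a ∈ deg k A i, ∀ b ∈ deg k B j, ∀ c ∈ deg k C l,
      f ((a ⊗ₜ b) ⊗ₜ c) = g ((a ⊗ₜ b) ⊗ₜ c)) : f = g :=
  TensorProduct.ext (tensor_ext_homog fun i j a ha b hb ↦
    linear_ext_homog fun l c hc ↦ h i j l a ha b hb c hc)

theorem tensor_ext_homog_right [Superspace k A] [Superspace k B] [Superspace k C]
    {f g : A ⊗[k] (B ⊗[k] C) →ₗ[k] M}
    (h : ∀ i j l, ∀ a ∈ deg k A i, ∀ b ∈ deg k B j, ∀ c ∈ deg k C l,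
      f (a ⊗ₜ (b ⊗ₜ c)) = g (a ⊗ₜ (b ⊗ₜ c))) : f = g :=
  TensorProduct.ext (linear_ext_homog fun i a ha ↦
    tensor_ext_homog fun j l b hb c hc ↦ h i j l a ha b hb c hc)

theorem tensor_ext_homog_four [Superspace k A] [Superspace k B] [Superspace k C] [Superspace k D]
    {f g : (A ⊗[k] B) ⊗[k] (C ⊗[k] D) →ₗ[k] M}
    (h : ∀ i j l m, ∀ a ∈ deg k A i, ∀ b ∈ deg k B j, ∀ c ∈ deg k C l, ∀ d ∈ deg k D m,
      f ((a ⊗ₜ b) ⊗ₜ (c ⊗ₜ d)) = g ((a ⊗ₜ b) ⊗ₜ (c ⊗ₜ d))) : f = g :=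
  TensorProduct.ext (tensor_ext_homog fun i j a ha b hb ↦
    tensor_ext_homog fun l m c hc d hd ↦ h i j l m a ha b hb c hc d hd)

section Even

variable [Superspace k A] [Superspace k B] [Superspace k C] [Superspace k D]

theorem IsEven.id : IsEven (LinearMap.id : A →ₗ[k] A) := fun _ _ h ↦ h

theorem IsEven.comp {g : B →ₗ[k] C} {f : A →ₗ[k] B} (hg : IsEven g) (hf : IsEven f) :
    IsEven (g ∘ₗ f) := fun i v hv ↦ hg i _ (hf i v hv)

theorem isEven_tensor {f : A ⊗[k] B →ₗ[k] C}
    (h : ∀ i j, ∀ a ∈ deg k A i, ∀ b ∈ deg k B j, f (a ⊗ₜ b) ∈ deg k C (i + j)) :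
    IsEven f := by
  intro n v hv
  refine Submodule.span_induction (p := fun t _ ↦ f t ∈ deg k C n) ?_ ?_ ?_ ?_ hv
  · rintro _ ⟨i, j, rfl, a, ha, b, hb, rfl⟩
    exact h i j a ha b hb
  · rw [map_zero]; exact Submodule.zero_mem _
  · intro x y _ _ hx hy; rw [map_add]; exact Submodule.add_mem _ hx hy
  · intro c x _ hx; rw [map_smul]; exact Submodule.smul_mem _ _ hx

theorem IsEven.map {f : A →ₗ[k] C} {g : B →ₗ[k] D} (hf : IsEven f) (hg : IsEven g) :
    IsEven (TensorProduct.map f g) :=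
  isEven_tensor fun _ _ _ ha _ hb ↦ tmul_mem (hf _ _ ha) (hg _ _ hb)

theorem isEven_of_curry {f : A ⊗[k] (B ⊗[k] C) →ₗ[k] D}
    (h : ∀ i j l, ∀ a ∈ deg k A i, ∀ b ∈ deg k B j, ∀ c ∈ deg k C l,
      f (a ⊗ₜ (b ⊗ₜ c)) ∈ deg k D (i + (j + l))) : IsEven f := by
  refine isEven_tensor fun i n a ha t ht ↦ ?_
  refine Submodule.span_induction (p := fun t _ ↦ f (a ⊗ₜ t) ∈ deg k D (i + n)) ?_ ?_ ?_ ?_ ht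
  · rintro _ ⟨j, l, rfl, b, hb, c, hc, rfl⟩
    exact h i j l a ha b hb c hc
  · rw [TensorProduct.tmul_zero, map_zero]; exact Submodule.zero_mem _
  · intro x y _ _ hx hy
    rw [TensorProduct.tmul_add, map_add]; exact Submodule.add_mem _ hx hy
  · intro c x _ hx
    rw [TensorProduct.tmul_smul, map_smul]; exact Submodule.smul_mem _ _ hx

theorem isEven_of_curry_left {f : (A ⊗[k] B) ⊗[k] C →ₗ[k] D}
    (h : ∀ i j l, ∀ a ∈ deg k A i, ∀ b ∈ deg k B j, ∀ c ∈ deg k C l,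
      f ((a ⊗ₜ b) ⊗ₜ c) ∈ deg k D (i + j + l)) : IsEven f := by
  refine isEven_tensor fun n l t ht c hc ↦ ?_
  refine Submodule.span_induction (p := fun t _ ↦ f (t ⊗ₜ c) ∈ deg k D (n + l)) ?_ ?_ ?_ ?_ ht
  · rintro _ ⟨i, j, rfl, a, ha, b, hb, rfl⟩
    exact h i j l a ha b hb c hc
  · rw [TensorProduct.zero_tmul, map_zero]; exact Submodule.zero_mem _
  · intro x y _ _ hx hy
    rw [TensorProduct.add_tmul, map_add]; exact Submodule.add_mem _ hx hy
  · intro r x _ hx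
    rw [← TensorProduct.smul_tmul', map_smul]; exact Submodule.smul_mem _ _ hx

theorem isEven_assoc : IsEven (TensorProduct.assoc k A B C).toLinearMap :=
  isEven_of_curry_left fun i j l a ha b hb c hc ↦ by
    simpa [add_assoc] using tmul_mem ha (tmul_mem hb hc)

theorem isEven_assoc_symm : IsEven (TensorProduct.assoc k A B C).symm.toLinearMap :=
  isEven_of_curry fun i j l a ha b hb c hc ↦ by
    simpa [add_assoc] using tmul_mem (tmul_mem ha hb) hc

theorem isEven_tau : IsEven (tau k A B) :=
  isEven_tensor fun i j _ ha _ hb ↦ by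
    rw [tau_tmul ha hb, add_comm]; exact Submodule.smul_mem _ _ (tmul_mem hb ha)

theorem mem_deg_field_zero (c : k) : c ∈ deg k k 0 := by
  change c ∈ (if (0 : ZMod 2) = 0 then (⊤ : Submodule k k) else ⊥); simp

theorem eq_zero_of_mem_deg_field_one {c : k} (h : c ∈ deg k k 1) : c = 0 := by
  change c ∈ (if (1 : ZMod 2) = 0 then (⊤ : Submodule k k) else ⊥) at h; simpa using h

theorem isEven_field_iff {f : A →ₗ[k] k} : IsEven f ↔ ∀ a ∈ deg k A 1, f a = 0 := by
  constructor
  · intro h a ha; exact eq_zero_of_mem_deg_field_one (h 1 a ha)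
  · intro h i a ha
    rcases zmod2_cases i with rfl | rfl
    · exact mem_deg_field_zero _
    · rw [h a ha]; exact Submodule.zero_mem _

theorem isEven_of_apply_one {u : k →ₗ[k] A} (h : u 1 ∈ deg k A 0) : IsEven u := by
  intro i c hc
  rcases zmod2_cases i with rfl | rfl
  · have : u c = c • u 1 := by rw [← map_smul, smul_eq_mul, mul_one]
    rw [this]
    exact Submodule.smul_mem _ _ h
  · rw [eq_zero_of_mem_deg_field_one hc, map_zero]
    exact Submodule.zero_mem _

theorem isEven_lid : IsEven (TensorProduct.lid k A).toLinearMap :=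
  isEven_tensor fun i j c hc a ha ↦ by
    rcases zmod2_cases i with rfl | rfl
    · simpa using Submodule.smul_mem _ c ha
    · simp [eq_zero_of_mem_deg_field_one hc]

theorem isEven_rid : IsEven (TensorProduct.rid k A).toLinearMap :=
  isEven_tensor fun i j a ha c hc ↦ by
    rcases zmod2_cases j with rfl | rfl
    · simpa using Submodule.smul_mem _ c ha
    · simp [eq_zero_of_mem_deg_field_one hc]

/-- The inverse of a bijective superspace morphism is a superspace morphism. -/
theorem IsEven.symm {e : A ≃ₗ[k] B} (h : IsEven e.toLinearMap) : IsEven e.symm.toLinearMap := by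
  -- The image of the component of wrong degree lies in both homogeneous parts of `B`: in one by
  -- evenness, in the other as a difference of vectors of degree `i`. Hence it is zero.
  have key : ∀ i, ∀ b ∈ deg k B i, proj k A (i + 1) (e.symm b) = 0 := by
    intro i b hb
    have hs : proj k A i (e.symm b) + proj k A (i + 1) (e.symm b) = e.symm b := by
      rcases zmod2_cases i with rfl | rfl
      · exact proj_add _
      · rw [add_comm]; exact proj_add _
    have h1 := h (i + 1) _ (proj_mem (i + 1) (e.symm b))
    have h0 := h i _ (proj_mem i (e.symm b))
    have h2 : e (proj k A (i + 1) (e.symm b)) = b - e (proj k A i (e.symm b)) := by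
      rw [eq_sub_iff_add_eq, ← map_add, add_comm, hs, LinearEquiv.apply_symm_apply]
    have h3 : e (proj k A (i + 1) (e.symm b)) ∈ deg k B i := by
      rw [h2]; exact Submodule.sub_mem _ hb h0
    have := Submodule.disjoint_def.1 (isCompl_deg k B i).disjoint _ h3 h1
    exact (LinearEquiv.map_eq_zero_iff e).1 this
  intro i b hb
  have hs : proj k A i (e.symm b) + proj k A (i + 1) (e.symm b) = e.symm b := by
    rcases zmod2_cases i with rfl | rfl
    · exact proj_add _
    · rw [add_comm]; exact proj_add _
  rw [key i b hb, add_zero] at hs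
  change e.symm b ∈ _
  rw [← hs]
  exact proj_mem _ _

theorem IsEven.transpose {f : A →ₗ[k] B} (hf : IsEven f) :
    IsEven (Module.Dual.transpose (R := k) f) := by
  intro i g hg
  rw [mem_deg_dual] at hg ⊢
  intro v hv
  exact hg _ (hf _ _ hv)

theorem isEven_middleSwap :
    IsEven (middleSwap k A B C D) := by
  refine (isEven_assoc_symm).comp (((IsEven.id).map ((isEven_assoc).comp
    (((isEven_tau).map IsEven.id).comp isEven_assoc_symm))).comp isEven_assoc)

end Even

section Naturality

variable {A' B' C' D' : Type*} [AddCommGroup A'] [Module k A'] [AddCommGroup B'] [Module k B']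
  [AddCommGroup C'] [Module k C'] [AddCommGroup D'] [Module k D']
variable [Superspace k A] [Superspace k B] [Superspace k C] [Superspace k D]
variable [Superspace k A'] [Superspace k B'] [Superspace k C'] [Superspace k D']

theorem tau_map {f : A →ₗ[k] A'} {g : B →ₗ[k] B'} (hf : IsEven f) (hg : IsEven g) :
    tau k A' B' ∘ₗ TensorProduct.map f g = TensorProduct.map g f ∘ₗ tau k A B :=
  tensor_ext_homog fun i j a ha b hb ↦ by
    simp [tau_tmul ha hb, tau_tmul (hf _ _ ha) (hg _ _ hb)]

theorem tau_tau : tau k B A ∘ₗ tau k A B = LinearMap.id :=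
  tensor_ext_homog fun i j a ha b hb ↦ by
    simp [tau_tmul ha hb, tau_tmul hb ha, smul_smul, sgn_comm k j i, sgn_mul_self]

-- Only the two inner factors are crossed, so only the maps on them have to be even.
omit [Superspace k A'] [Superspace k D'] in
theorem middleSwap_map {p : A →ₗ[k] A'} {f : B →ₗ[k] B'} {g : C →ₗ[k] C'} {q : D →ₗ[k] D'}
    (hf : IsEven f) (hg : IsEven g) :
    middleSwap k A' B' C' D' ∘ₗ TensorProduct.map (TensorProduct.map p f) (TensorProduct.map g q)
      = TensorProduct.map (TensorProduct.map p g) (TensorProduct.map f q) ∘ₗ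
        middleSwap k A B C D :=
  tensor_ext_homog_four fun i j l m a ha b hb c hc d hd ↦ by
    simp [middleSwap_tmul _ _ hb hc, middleSwap_tmul _ _ (hf _ _ hb) (hg _ _ hc)]

theorem middleSwap_tau :
    middleSwap k C D A B ∘ₗ tau k (A ⊗[k] B) (C ⊗[k] D) =
      TensorProduct.map (tau k A C) (tau k B D) ∘ₗ middleSwap k A B C D :=
  tensor_ext_homog_four fun i j l m a ha b hb c hc d hd ↦ by
    simp only [LinearMap.comp_apply, tau_tmul (tmul_mem ha hb) (tmul_mem hc hd),
      middleSwap_tmul _ _ hb hc, middleSwap_tmul _ _ hd ha, map_smul, TensorProduct.map_tmul,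
      tau_tmul ha hc, tau_tmul hb hd, sgn_add_left, sgn_add_right, smul_smul,
      ← TensorProduct.smul_tmul', TensorProduct.tmul_smul]
    congr 1
    rw [sgn_comm k m i]
    -- The sign of the pair `(a, d)` occurs twice on the left, once in each crossing, and cancels.
    linear_combination (sgn k j l * sgn k i l * sgn k j m) * sgn_mul_self (k := k) i m

/-- Both sides cross the same three pairs, `(b, a')`, `(c, a')` and `(c, b')`, in different orders.
This is the coherence behind coassociativity of a tensor product of supercoalgebras. -/
theorem middleSwap_assoc :
    (TensorProduct.assoc k (A ⊗[k] A') (B ⊗[k] B') (C ⊗[k] C')).toLinearMap ∘ₗ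
      TensorProduct.map (middleSwap k A B A' B') LinearMap.id ∘ₗ
      middleSwap k (A ⊗[k] B) C (A' ⊗[k] B') C' =
    TensorProduct.map LinearMap.id (middleSwap k B C B' C') ∘ₗ
      middleSwap k A (B ⊗[k] C) A' (B' ⊗[k] C') ∘ₗ
      TensorProduct.map (TensorProduct.assoc k A B C).toLinearMap
        (TensorProduct.assoc k A' B' C').toLinearMap := by
  refine TensorProduct.ext (tensor_ext_homog_left fun i j l a ha b hb c hc ↦
    tensor_ext_homog_left fun i' j' l' a' ha' b' hb' c' hc' ↦ ?_)
  simp only [LinearMap.compr₂ₛₗ_apply, TensorProduct.mk_apply, LinearMap.comp_apply,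
    middleSwap_tmul _ _ hc (tmul_mem ha' hb'), map_smul, TensorProduct.map_tmul,
    LinearMap.id_apply, middleSwap_tmul _ _ hb ha', LinearEquiv.coe_coe, TensorProduct.assoc_tmul,
    middleSwap_tmul _ _ (tmul_mem hb hc) ha', middleSwap_tmul _ _ hc hb', sgn_add_left,
    sgn_add_right, smul_smul, ← TensorProduct.smul_tmul', TensorProduct.tmul_smul]
  congr 1
  ring

end Naturality

end Linear

/-! ### Supercoalgebras: convolution, conjugation by functionals, tensor products. -/

/-- A supercoalgebra structure on a superspace. -/
structure Supercoalgebra (k V : Type*) [Field k] [AddCommGroup V] [Module k V]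
    [Superspace k V] where
  comul : V →ₗ[k] V ⊗[k] V
  counit : V →ₗ[k] k
  even_comul : IsEven comul
  even_counit : IsEven counit
  coassoc : (TensorProduct.assoc k V V V).toLinearMap ∘ₗ LinearMap.rTensor V comul ∘ₗ comul =
    LinearMap.lTensor V comul ∘ₗ comul
  counit_comul : ∀ a : V, TensorProduct.lid k V (LinearMap.rTensor V counit (comul a)) = a
  comul_counit : ∀ a : V, TensorProduct.rid k V (LinearMap.lTensor V counit (comul a)) = a

namespace Supercoalgebra

variable {k : Type*} [Field k]
variable {V W U : Type*} [AddCommGroup V] [Module k V] [AddCommGroup W] [Module k W]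
  [AddCommGroup U] [Module k U]
variable [Superspace k V] [Superspace k W] [Superspace k U]
variable {L M N L' M' N' : Type*} [AddCommGroup L] [Module k L] [AddCommGroup M] [Module k M]
  [AddCommGroup N] [Module k N] [AddCommGroup L'] [Module k L'] [AddCommGroup M'] [Module k M']
  [AddCommGroup N'] [Module k N']

/-- The map `a ↦ ∑ f(a') ⊗ g(a'')`. -/
def star (C : Supercoalgebra k V) (f : V →ₗ[k] M) (g : V →ₗ[k] N) : V →ₗ[k] M ⊗[k] N :=
  TensorProduct.map f g ∘ₗ C.comul

/-- Morphisms of supercoalgebras. -/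
structure IsHom (C : Supercoalgebra k V) (D : Supercoalgebra k W) (f : V →ₗ[k] W) : Prop where
  even : IsEven f
  comul : D.comul ∘ₗ f = TensorProduct.map f f ∘ₗ C.comul
  counit : D.counit ∘ₗ f = C.counit

variable (C : Supercoalgebra k V) (D : Supercoalgebra k W) (E : Supercoalgebra k U)

/-- Coassociativity, stated for arbitrary maps out of the supercoalgebra; in this form it replaces
Sweedler computations. -/
theorem star_assoc (f : V →ₗ[k] L) (g : V →ₗ[k] M) (h : V →ₗ[k] N) :
    (TensorProduct.assoc k L M N).toLinearMap ∘ₗ C.star (C.star f g) h =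
      C.star f (C.star g h) := by
  have e1 : C.star (C.star f g) h = TensorProduct.map (TensorProduct.map f g) h ∘ₗ
      LinearMap.rTensor V C.comul ∘ₗ C.comul := by
    rw [LinearMap.rTensor, ← LinearMap.comp_assoc, ← TensorProduct.map_comp, LinearMap.comp_id]
    rfl
  have e2 : C.star f (C.star g h) = TensorProduct.map f (TensorProduct.map g h) ∘ₗ
      LinearMap.lTensor V C.comul ∘ₗ C.comul := by
    rw [LinearMap.lTensor, ← LinearMap.comp_assoc, ← TensorProduct.map_comp, LinearMap.comp_id]
    rfl
  have e3 : (TensorProduct.assoc k L M N).toLinearMap ∘ₗ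
      TensorProduct.map (TensorProduct.map f g) h =
      TensorProduct.map f (TensorProduct.map g h) ∘ₗ (TensorProduct.assoc k V V V).toLinearMap :=
    TensorProduct.ext_threefold fun a b c ↦ rfl
  rw [e1, e2, ← C.coassoc, ← LinearMap.comp_assoc, e3]
  rfl

theorem map_star (p : M →ₗ[k] M') (q : N →ₗ[k] N') (f : V →ₗ[k] M) (g : V →ₗ[k] N) :
    TensorProduct.map p q ∘ₗ C.star f g = C.star (p ∘ₗ f) (q ∘ₗ g) := by
  rw [star, star, ← LinearMap.comp_assoc, ← TensorProduct.map_comp]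

theorem star_id : C.star LinearMap.id LinearMap.id = C.comul := by
  rw [star, TensorProduct.map_id, LinearMap.id_comp]

theorem lid_star_counit (f : V →ₗ[k] M) :
    (TensorProduct.lid k M).toLinearMap ∘ₗ C.star C.counit f = f := by
  have e : (TensorProduct.lid k M).toLinearMap ∘ₗ TensorProduct.map C.counit f =
      f ∘ₗ (TensorProduct.lid k V).toLinearMap ∘ₗ LinearMap.rTensor V C.counit :=
    TensorProduct.ext' fun a b ↦ by simp
  rw [star, ← LinearMap.comp_assoc, e]
  ext a
  simp [C.counit_comul]

theorem rid_star_counit (f : V →ₗ[k] M) :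
    (TensorProduct.rid k M).toLinearMap ∘ₗ C.star f C.counit = f := by
  have e : (TensorProduct.rid k M).toLinearMap ∘ₗ TensorProduct.map f C.counit =
      f ∘ₗ (TensorProduct.rid k V).toLinearMap ∘ₗ LinearMap.lTensor V C.counit :=
    TensorProduct.ext' fun a b ↦ by simp
  rw [star, ← LinearMap.comp_assoc, e]
  ext a
  simp [C.comul_counit]

variable {C D E}

theorem IsHom.star {φ : V →ₗ[k] W} (hφ : IsHom C D φ) (f : W →ₗ[k] M) (g : W →ₗ[k] N) :
    D.star f g ∘ₗ φ = C.star (f ∘ₗ φ) (g ∘ₗ φ) := by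
  rw [Supercoalgebra.star, LinearMap.comp_assoc, hφ.comul, ← LinearMap.comp_assoc,
    ← TensorProduct.map_comp]
  rfl

theorem IsHom.id : IsHom C C LinearMap.id :=
  ⟨IsEven.id, by rw [TensorProduct.map_id]; rfl, rfl⟩

theorem IsHom.comp {φ : V →ₗ[k] W} {ψ : W →ₗ[k] U} (hψ : IsHom D E ψ) (hφ : IsHom C D φ) :
    IsHom C E (ψ ∘ₗ φ) := by
  refine ⟨hψ.even.comp hφ.even, ?_, ?_⟩
  · rw [← LinearMap.comp_assoc, hψ.comul, LinearMap.comp_assoc, hφ.comul,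
      ← LinearMap.comp_assoc, ← TensorProduct.map_comp]
  · rw [← LinearMap.comp_assoc, hψ.counit, hφ.counit]

theorem IsHom.symm {e : V ≃ₗ[k] W} (h : IsHom C D e.toLinearMap) :
    IsHom D C e.symm.toLinearMap := by
  refine ⟨h.even.symm, ?_, ?_⟩
  · have := h.comul
    have h2 : TensorProduct.map e.symm.toLinearMap e.symm.toLinearMap ∘ₗ
        (D.comul ∘ₗ e.toLinearMap) = C.comul := by
      rw [this, ← LinearMap.comp_assoc, ← TensorProduct.map_comp, LinearEquiv.symm_comp,
        TensorProduct.map_id, LinearMap.id_comp]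
    rw [← h2, LinearMap.comp_assoc, LinearMap.comp_assoc, LinearEquiv.comp_symm, LinearMap.comp_id]
  · rw [← h.counit, LinearMap.comp_assoc, LinearEquiv.comp_symm, LinearMap.comp_id]

theorem _root_.SuperHopf.IsEven.star {f : V →ₗ[k] W} {g : V →ₗ[k] U} (hf : IsEven f)
    (hg : IsEven g) : IsEven (C.star f g) :=
  (hf.map hg).comp C.even_comul

variable (C)

/-- The left action of a functional on linear maps, `a ↦ ∑ s(a') f(a'')`. -/
def actL (s : V →ₗ[k] k) (f : V →ₗ[k] M) : V →ₗ[k] M :=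
  (TensorProduct.lid k M).toLinearMap ∘ₗ C.star s f

/-- The right action of a functional on linear maps, `a ↦ ∑ t(a'') f(a')`. -/
def actR (f : V →ₗ[k] M) (t : V →ₗ[k] k) : V →ₗ[k] M :=
  (TensorProduct.rid k M).toLinearMap ∘ₗ C.star f t

/-- The map `a ↦ ∑ s(a') f(a'') t(a''')`. -/
def conj (s t : V →ₗ[k] k) (f : V →ₗ[k] M) : V →ₗ[k] M := C.actL s (C.actR f t)

/-- On functionals both actions are the same convolution product, so `actL s t` serves as the
product of the dual algebra. No sign enters. -/
theorem actR_eq_actL (s t : V →ₗ[k] k) : C.actR s t = C.actL s t := by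
  rw [actL, actR]; congr 1; ext; simp

theorem comp_actL (p : M →ₗ[k] N) (s : V →ₗ[k] k) (f : V →ₗ[k] M) :
    p ∘ₗ C.actL s f = C.actL s (p ∘ₗ f) := by
  rw [actL, actL, star, star, ← LinearMap.comp_assoc, ← LinearMap.comp_assoc,
    ← LinearMap.comp_assoc]
  congr 1; exact TensorProduct.ext' fun a b ↦ by simp

theorem comp_actR (p : M →ₗ[k] N) (f : V →ₗ[k] M) (t : V →ₗ[k] k) :
    p ∘ₗ C.actR f t = C.actR (p ∘ₗ f) t := by
  rw [actR, actR, star, star, ← LinearMap.comp_assoc, ← LinearMap.comp_assoc,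
    ← LinearMap.comp_assoc]
  congr 1; exact TensorProduct.ext' fun a b ↦ by simp

theorem comp_conj (p : M →ₗ[k] N) (s t : V →ₗ[k] k) (f : V →ₗ[k] M) :
    p ∘ₗ C.conj s t f = C.conj s t (p ∘ₗ f) := by
  rw [conj, comp_actL, comp_actR, conj]

theorem counit_actL (f : V →ₗ[k] M) : C.actL C.counit f = f := C.lid_star_counit f

theorem actR_counit (f : V →ₗ[k] M) : C.actR f C.counit = f := C.rid_star_counit f

theorem actL_star (s : V →ₗ[k] k) (f : V →ₗ[k] M) (g : V →ₗ[k] N) :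
    C.star (C.actL s f) g = C.actL s (C.star f g) := by
  rw [actL, actL, ← C.star_assoc, ← LinearMap.comp_assoc]
  rw [← LinearMap.id_comp g, ← C.map_star, LinearMap.id_comp]
  congr 1; exact TensorProduct.ext_threefold fun a b c ↦ by simp [TensorProduct.smul_tmul']

theorem star_actR (f : V →ₗ[k] M) (g : V →ₗ[k] N) (t : V →ₗ[k] k) :
    C.star f (C.actR g t) = C.actR (C.star f g) t := by
  rw [actR, actR]
  rw [← LinearMap.id_comp f, ← C.map_star, LinearMap.id_comp, ← C.star_assoc,
    ← LinearMap.comp_assoc]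
  congr 1; exact TensorProduct.ext_threefold fun a b c ↦ by simp

/-- The middle Sweedler factor may be absorbed by either neighbour. This makes `star` balanced over
the dual algebra and is what lets inner scalars cancel. -/
theorem star_actL (f : V →ₗ[k] M) (t : V →ₗ[k] k) (g : V →ₗ[k] N) :
    C.star f (C.actL t g) = C.star (C.actR f t) g := by
  rw [actR, actL]
  rw [← LinearMap.id_comp f, ← C.map_star, LinearMap.id_comp, ← C.star_assoc,
    ← LinearMap.id_comp g, ← C.map_star, LinearMap.id_comp, ← LinearMap.comp_assoc]
  congr 1; exact TensorProduct.ext_threefold fun a b c ↦ by simp [TensorProduct.smul_tmul]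

theorem actL_actL (s t : V →ₗ[k] k) (f : V →ₗ[k] M) :
    C.actL s (C.actL t f) = C.actL (C.actL s t) f := by
  rw [actL, star_actL, actR_eq_actL, ← actL]

theorem actR_actR (f : V →ₗ[k] M) (s t : V →ₗ[k] k) :
    C.actR (C.actR f s) t = C.actR f (C.actL s t) := by
  rw [actR, ← star_actL, ← actR]

theorem actR_actL (s : V →ₗ[k] k) (f : V →ₗ[k] M) (t : V →ₗ[k] k) :
    C.actR (C.actL s f) t = C.actL s (C.actR f t) := by
  rw [actR, actL_star, comp_actL, ← actR]

/-- The left and right actions commute and are associative, so the functionals multiply outwards on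
both sides. -/
theorem conj_conj (s t s' t' : V →ₗ[k] k) (f : V →ₗ[k] M) :
    C.conj s t (C.conj s' t' f) = C.conj (C.actL s s') (C.actL t' t) f := by
  rw [conj, conj, actR_actL, actL_actL, actR_actR, conj]

theorem conj_functional (s t u : V →ₗ[k] k) : C.conj s t u = C.actL s (C.actL u t) := by
  rw [conj, actR_eq_actL]

theorem conj_counit (s t : V →ₗ[k] k) : C.conj s t C.counit = C.actL s t := by
  rw [conj, actR_eq_actL, counit_actL]

theorem counit_conj (f : V →ₗ[k] M) : C.conj C.counit C.counit f = f := by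
  rw [conj, counit_actL, actR_counit]

/-- Two functionals are inverse to each other in the dual algebra. -/
structure IsInv (s t : V →ₗ[k] k) : Prop where
  right : C.actL s t = C.counit
  left : C.actL t s = C.counit

/-- In `(s * f * t) ⋆ (s * g * t)` the inner `t` and `s` meet and cancel; only the relation `t * s =
ε` is used. -/
theorem star_conj {s t : V →ₗ[k] k} (h : C.IsInv s t) (f : V →ₗ[k] M) (g : V →ₗ[k] N) :
    C.star (C.conj s t f) (C.conj s t g) = C.conj s t (C.star f g) := by
  rw [conj, conj, actL_star, star_actL, actR_actR, h.left, actR_counit, star_actR, conj]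

variable {C}

theorem IsInv.unique {s t t' : V →ₗ[k] k} (h : C.IsInv s t) (h' : C.IsInv s t') : t = t' := by
  rw [← C.counit_actL t', ← h.left, ← actL_actL, h'.right, ← actR_eq_actL, actR_counit]

theorem IsHom.actL {φ : V →ₗ[k] W} (hφ : IsHom C D φ) (s : W →ₗ[k] k) (f : W →ₗ[k] M) :
    D.actL s f ∘ₗ φ = C.actL (s ∘ₗ φ) (f ∘ₗ φ) := by
  rw [Supercoalgebra.actL, LinearMap.comp_assoc, hφ.star]; rfl

theorem IsHom.actR {φ : V →ₗ[k] W} (hφ : IsHom C D φ) (f : W →ₗ[k] M) (s : W →ₗ[k] k) :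
    D.actR f s ∘ₗ φ = C.actR (f ∘ₗ φ) (s ∘ₗ φ) := by
  rw [Supercoalgebra.actR, LinearMap.comp_assoc, hφ.star]; rfl

theorem IsHom.conj {φ : V →ₗ[k] W} (hφ : IsHom C D φ) (s t : W →ₗ[k] k) (f : W →ₗ[k] M) :
    D.conj s t f ∘ₗ φ = C.conj (s ∘ₗ φ) (t ∘ₗ φ) (f ∘ₗ φ) := by
  rw [Supercoalgebra.conj, hφ.actL, hφ.actR]; rfl

theorem IsInv.comp {φ : V →ₗ[k] W} (hφ : IsHom C D φ) {s t : W →ₗ[k] k} (h : D.IsInv s t) :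
    C.IsInv (s ∘ₗ φ) (t ∘ₗ φ) := by
  constructor
  · rw [← hφ.actL, h.right, hφ.counit]
  · rw [← hφ.actL, h.left, hφ.counit]

theorem IsInv.mul {s t s' t' : V →ₗ[k] k} (h : C.IsInv s t) (h' : C.IsInv s' t') :
    C.IsInv (C.actL s s') (C.actL t' t) := by
  constructor
  · rw [← actL_actL, C.actL_actL s', h'.right, counit_actL, h.right]
  · rw [← actL_actL, C.actL_actL t, h.left, counit_actL, h'.left]

theorem isEven_actL {s : V →ₗ[k] k} {f : V →ₗ[k] W} (hs : IsEven s) (hf : IsEven f) :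
    IsEven (C.actL s f) := isEven_lid.comp (hs.star hf)

theorem isEven_actR {s : V →ₗ[k] k} {f : V →ₗ[k] W} (hs : IsEven s) (hf : IsEven f) :
    IsEven (C.actR f s) := isEven_rid.comp (hf.star hs)

/-- Conjugating a morphism of supercoalgebras by an invertible even functional gives a morphism
of supercoalgebras. -/
theorem IsHom.conj_isHom {f : V →ₗ[k] W} (hf : IsHom C D f) {s t : V →ₗ[k] k}
    (h : C.IsInv s t) (hs : IsEven s) (ht : IsEven t) : IsHom C D (C.conj s t f) := by
  refine ⟨isEven_actL hs (isEven_actR ht hf.even), ?_, ?_⟩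
  · rw [comp_conj, hf.comul]
    exact (C.star_conj h f f).symm
  · rw [comp_conj, hf.counit, conj_counit, h.right]

/-- A conjugated map composed with a conjugated morphism of supercoalgebras. -/
theorem conj_comp_conj {φ : V →ₗ[k] W} {s t : V →ₗ[k] k} (h : C.IsInv s t)
    (hφ : IsHom C D (C.conj s t φ)) (p q : W →ₗ[k] k) (f : W →ₗ[k] M) :
    D.conj p q f ∘ₗ C.conj s t φ =
      C.conj (C.actL s (p ∘ₗ φ)) (C.actL (q ∘ₗ φ) t) (f ∘ₗ φ) := by
  -- Pulled back along the morphism, `p`, `f` and `q` each become `s * (-) * t`. In the product of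
  -- the three, both inner `t * s` disappear, and `(s * pφ) * fφ * (qφ * t)` remains.
  rw [hφ.conj, comp_conj, comp_conj, comp_conj, conj_conj, conj_functional, conj_functional,
    ← actL_actL, ← actL_actL C (p ∘ₗ φ), h.left, ← actR_eq_actL C _ C.counit, actR_counit,
    actL_actL, actL_actL, h.left, counit_actL]

/-! ### Tensor products of supercoalgebras -/

/-- The tensor product of two supercoalgebras. -/
def tensor (C : Supercoalgebra k V) (D : Supercoalgebra k W) : Supercoalgebra k (V ⊗[k] W) where
  comul := middleSwap k V V W W ∘ₗ TensorProduct.map C.comul D.comul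
  counit := LinearMap.mul' k k ∘ₗ TensorProduct.map C.counit D.counit
  even_comul := isEven_middleSwap.comp (C.even_comul.map D.even_comul)
  even_counit := by
    have : LinearMap.mul' k k = (TensorProduct.lid k k).toLinearMap := by ext; simp
    rw [this]
    exact isEven_lid.comp (C.even_counit.map D.even_counit)
  coassoc := by
    have h1 : LinearMap.rTensor (V ⊗[k] W)
          (middleSwap k V V W W ∘ₗ TensorProduct.map C.comul D.comul) ∘ₗ middleSwap k V V W W =
        TensorProduct.map (middleSwap k V V W W) LinearMap.id ∘ₗ
          middleSwap k (V ⊗[k] V) V (W ⊗[k] W) W ∘ₗ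
          TensorProduct.map (LinearMap.rTensor V C.comul) (LinearMap.rTensor W D.comul) := by
      rw [LinearMap.rTensor, LinearMap.rTensor, LinearMap.rTensor,
        middleSwap_map IsEven.id D.even_comul, ← LinearMap.comp_assoc, ← TensorProduct.map_comp,
        TensorProduct.map_id, LinearMap.comp_id]
    have h2 : LinearMap.lTensor (V ⊗[k] W)
          (middleSwap k V V W W ∘ₗ TensorProduct.map C.comul D.comul) ∘ₗ middleSwap k V V W W =
        TensorProduct.map LinearMap.id (middleSwap k V V W W) ∘ₗ
          middleSwap k V (V ⊗[k] V) W (W ⊗[k] W) ∘ₗ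
          TensorProduct.map (LinearMap.lTensor V C.comul) (LinearMap.lTensor W D.comul) := by
      rw [LinearMap.lTensor, LinearMap.lTensor, LinearMap.lTensor,
        middleSwap_map C.even_comul IsEven.id, ← LinearMap.comp_assoc, ← TensorProduct.map_comp,
        TensorProduct.map_id, LinearMap.id_comp]
    -- The coherence of the middle swap is evaluated on the two iterated coproducts, so that
    -- coassociativity can be applied in each factor separately.
    have h3 := congrArg (· ∘ₗ TensorProduct.map (LinearMap.rTensor V C.comul ∘ₗ C.comul)
      (LinearMap.rTensor W D.comul ∘ₗ D.comul)) (middleSwap_assoc (k := k) (A := V) (B := V)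
        (C := V) (A' := W) (B' := W) (C' := W))
    simp only [LinearMap.comp_assoc, ← TensorProduct.map_comp, C.coassoc, D.coassoc] at h3
    calc _ = (TensorProduct.assoc k (V ⊗[k] W) (V ⊗[k] W) (V ⊗[k] W)).toLinearMap ∘ₗ
          (LinearMap.rTensor (V ⊗[k] W)
          (middleSwap k V V W W ∘ₗ TensorProduct.map C.comul D.comul) ∘ₗ middleSwap k V V W W) ∘ₗ
          TensorProduct.map C.comul D.comul := rfl
      _ = _ := by
        rw [h1]
        simp only [LinearMap.comp_assoc, ← TensorProduct.map_comp]
        rw [h3]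
        simp only [TensorProduct.map_comp, ← LinearMap.comp_assoc]
        rw [LinearMap.comp_assoc _ _ (TensorProduct.map LinearMap.id _), ← h2]
  counit_comul := by
    have key : (TensorProduct.lid k (V ⊗[k] W)).toLinearMap ∘ₗ LinearMap.rTensor (V ⊗[k] W)
          (LinearMap.mul' k k ∘ₗ TensorProduct.map C.counit D.counit) ∘ₗ middleSwap k V V W W =
        TensorProduct.map ((TensorProduct.lid k V).toLinearMap ∘ₗ LinearMap.rTensor V C.counit)
          ((TensorProduct.lid k W).toLinearMap ∘ₗ LinearMap.rTensor W D.counit) := by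
      refine tensor_ext_homog_four fun i j l m a ha b hb c hc d hd ↦ ?_
      -- The crossing sign is harmless: it is `1` if `c` is even, and the counit kills `c` if it is
      -- odd.
      rcases zmod2_cases l with rfl | rfl
      · simp [middleSwap_tmul _ _ hb hc, TensorProduct.smul_tmul, smul_smul, mul_comm]
      · simp [middleSwap_tmul _ _ hb hc, isEven_field_iff.1 D.even_counit c hc]
    refine fun t ↦ ?_
    refine (LinearMap.congr_fun key (TensorProduct.map C.comul D.comul t)).trans ?_
    rw [← LinearMap.comp_apply, ← TensorProduct.map_comp]
    conv_rhs => rw [← LinearMap.id_apply (R := k) t, ← TensorProduct.map_id]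
    congr 2
    · ext a; exact C.counit_comul a
    · ext a; exact D.counit_comul a
  comul_counit := by
    have key : (TensorProduct.rid k (V ⊗[k] W)).toLinearMap ∘ₗ LinearMap.lTensor (V ⊗[k] W)
          (LinearMap.mul' k k ∘ₗ TensorProduct.map C.counit D.counit) ∘ₗ middleSwap k V V W W =
        TensorProduct.map ((TensorProduct.rid k V).toLinearMap ∘ₗ LinearMap.lTensor V C.counit)
          ((TensorProduct.rid k W).toLinearMap ∘ₗ LinearMap.lTensor W D.counit) := by
      refine tensor_ext_homog_four fun i j l m a ha b hb c hc d hd ↦ ?_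
      rcases zmod2_cases j with rfl | rfl
      · simp [middleSwap_tmul _ _ hb hc, TensorProduct.smul_tmul, smul_smul, mul_comm]
      · simp [middleSwap_tmul _ _ hb hc, isEven_field_iff.1 C.even_counit b hb]
    refine fun t ↦ ?_
    refine (LinearMap.congr_fun key (TensorProduct.map C.comul D.comul t)).trans ?_
    rw [← LinearMap.comp_apply, ← TensorProduct.map_comp]
    conv_rhs => rw [← LinearMap.id_apply (R := k) t, ← TensorProduct.map_id]
    congr 2
    · ext a; exact C.comul_counit a
    · ext a; exact D.comul_counit a

end Supercoalgebra

/-! ### Projections and morphisms of tensor products, and conjugation in one tensor factor. -/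

namespace Supercoalgebra

variable {k : Type*} [Field k]
variable {V W U V' W' : Type*} [AddCommGroup V] [Module k V] [AddCommGroup W] [Module k W]
  [AddCommGroup U] [Module k U] [AddCommGroup V'] [Module k V'] [AddCommGroup W'] [Module k W']
variable [Superspace k V] [Superspace k W] [Superspace k U] [Superspace k V'] [Superspace k W']
variable {M N M' N' : Type*} [AddCommGroup M] [Module k M] [AddCommGroup N] [Module k N]
  [AddCommGroup M'] [Module k M'] [AddCommGroup N'] [Module k N']
variable [Superspace k M] [Superspace k N] [Superspace k M'] [Superspace k N']
variable (C : Supercoalgebra k V) (D : Supercoalgebra k W) (E : Supercoalgebra k U)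

-- The Sweedler legs of `V ⊗ W` are those of `V` and `W` interleaved. Only `g` and `f'` are carried
-- through the crossing, hence the evenness assumptions.
omit [Superspace k M] [Superspace k N'] in
theorem tensor_star (f : V →ₗ[k] M) {g : V →ₗ[k] N} {f' : W →ₗ[k] M'} (g' : W →ₗ[k] N')
    (hg : IsEven g) (hf' : IsEven f') :
    (C.tensor D).star (TensorProduct.map f f') (TensorProduct.map g g') =
      middleSwap k M N M' N' ∘ₗ TensorProduct.map (C.star f g) (D.star f' g') := by
  rw [star, star, star, TensorProduct.map_comp, ← LinearMap.comp_assoc, middleSwap_map hg hf']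
  rfl

/-- The projection `v ⊗ w ↦ ε(w) v`. -/
def fst (V : Type*) [AddCommGroup V] [Module k V] (D : Supercoalgebra k W) : V ⊗[k] W →ₗ[k] V :=
  (TensorProduct.rid k V).toLinearMap ∘ₗ LinearMap.lTensor V D.counit

/-- The projection `v ⊗ w ↦ ε(v) w`. -/
def snd (C : Supercoalgebra k V) (W : Type*) [AddCommGroup W] [Module k W] : V ⊗[k] W →ₗ[k] W :=
  (TensorProduct.lid k W).toLinearMap ∘ₗ LinearMap.rTensor W C.counit

omit [Superspace k V] in
@[simp] theorem fst_tmul (v : V) (w : W) : fst V D (v ⊗ₜ w) = D.counit w • v := by simp [fst]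

omit [Superspace k W] in
@[simp] theorem snd_tmul (v : V) (w : W) : snd C W (v ⊗ₜ w) = C.counit v • w := by simp [snd]

@[simp] theorem tensor_counit_tmul (v : V) (w : W) :
    (C.tensor D).counit (v ⊗ₜ w) = C.counit v * D.counit w := by simp [tensor]

variable {C D E} in
theorem IsHom.map {C' : Supercoalgebra k V'} {D' : Supercoalgebra k W'} {f : V →ₗ[k] V'}
    {g : W →ₗ[k] W'} (hf : IsHom C C' f) (hg : IsHom D D' g) :
    IsHom (C.tensor D) (C'.tensor D') (TensorProduct.map f g) := by
  refine ⟨hf.even.map hg.even, ?_, ?_⟩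
  · change _ = (C.tensor D).star (TensorProduct.map f g) (TensorProduct.map f g)
    rw [tensor_star _ _ _ _ hf.even hg.even]
    change (middleSwap k V' V' W' W' ∘ₗ TensorProduct.map C'.comul D'.comul) ∘ₗ _ = _
    rw [LinearMap.comp_assoc, ← TensorProduct.map_comp, hf.comul, hg.comul]
    rfl
  · refine TensorProduct.ext' fun v w ↦ ?_
    simpa using congrArg₂ (· * ·) (LinearMap.congr_fun hf.counit v)
      (LinearMap.congr_fun hg.counit w)

/-- Naturality of the flip together with `middleSwap_tau`. Unlike in the noncommutative graded
setting without signs, the flip here is the symmetry of superspaces; it is the morphism that is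
conjugated later. -/
theorem isHom_tau : IsHom (C.tensor D) (D.tensor C) (tau k V W) := by
  refine ⟨isEven_tau, ?_, ?_⟩
  · change (middleSwap k W W V V ∘ₗ TensorProduct.map D.comul C.comul) ∘ₗ _ =
      TensorProduct.map _ _ ∘ₗ middleSwap k V V W W ∘ₗ TensorProduct.map C.comul D.comul
    rw [LinearMap.comp_assoc, ← tau_map C.even_comul D.even_comul, ← LinearMap.comp_assoc,
      middleSwap_tau]
    rfl
  · refine tensor_ext_homog fun i j a ha b hb ↦ ?_
    rcases zmod2_cases i with rfl | rfl
    · simp [tau_tmul ha hb, mul_comm]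
    · simp [tau_tmul ha hb, isEven_field_iff.1 C.even_counit a ha]

theorem isHom_assoc : IsHom ((C.tensor D).tensor E) (C.tensor (D.tensor E))
    (TensorProduct.assoc k V W U).toLinearMap := by
  refine ⟨isEven_assoc, ?_, ?_⟩
  · have e1 : ((C.tensor D).tensor E).comul =
        middleSwap k (V ⊗[k] W) (V ⊗[k] W) U U ∘ₗ
          TensorProduct.map (middleSwap k V V W W) LinearMap.id ∘ₗ
          TensorProduct.map (TensorProduct.map C.comul D.comul) E.comul := by
      rw [← TensorProduct.map_comp]; rfl
    have e2 : (C.tensor (D.tensor E)).comul =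
        middleSwap k V V (W ⊗[k] U) (W ⊗[k] U) ∘ₗ
          TensorProduct.map LinearMap.id (middleSwap k W W U U) ∘ₗ
          TensorProduct.map C.comul (TensorProduct.map D.comul E.comul) := by
      rw [← TensorProduct.map_comp]; rfl
    have e3 : TensorProduct.map C.comul (TensorProduct.map D.comul E.comul) ∘ₗ
        (TensorProduct.assoc k V W U).toLinearMap = (TensorProduct.assoc k _ _ _).toLinearMap ∘ₗ
        TensorProduct.map (TensorProduct.map C.comul D.comul) E.comul :=
      TensorProduct.ext_threefold fun _ _ _ ↦ rfl
    have key : middleSwap k V V (W ⊗[k] U) (W ⊗[k] U) ∘ₗ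
          TensorProduct.map LinearMap.id (middleSwap k W W U U) ∘ₗ
          (TensorProduct.assoc k _ _ _).toLinearMap =
        TensorProduct.map (TensorProduct.assoc k V W U).toLinearMap
          (TensorProduct.assoc k V W U).toLinearMap ∘ₗ
        middleSwap k (V ⊗[k] W) (V ⊗[k] W) U U ∘ₗ
          TensorProduct.map (middleSwap k V V W W) LinearMap.id := by
      refine TensorProduct.ext (tensor_ext_homog_four fun i j i' j' a ha b hb a' ha' b' hb' ↦
        tensor_ext_homog fun i'' j'' a'' ha'' b'' hb'' ↦ ?_)
      simp only [LinearMap.compr₂ₛₗ_apply, TensorProduct.mk_apply, LinearMap.comp_apply,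
        LinearEquiv.coe_coe, TensorProduct.assoc_tmul, TensorProduct.map_tmul, LinearMap.id_apply,
        middleSwap_tmul _ _ hb ha', middleSwap_tmul _ _ hb' ha'', map_smul,
        middleSwap_tmul _ _ hb (tmul_mem ha' ha''), middleSwap_tmul _ _ (tmul_mem hb hb') ha'',
        TensorProduct.tmul_smul, ← TensorProduct.smul_tmul', smul_smul, sgn_add_left,
        sgn_add_right]
      congr 1
      ring
    rw [e1, e2, LinearMap.comp_assoc, LinearMap.comp_assoc, e3, ← LinearMap.comp_assoc,
      ← LinearMap.comp_assoc, LinearMap.comp_assoc _ _ (middleSwap k V V _ _), key]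
    rfl
  · exact TensorProduct.ext_threefold fun a b c ↦ by simp [mul_assoc]

theorem isHom_fst : IsHom (C.tensor D) C (fst V D) := by
  refine ⟨?_, ?_, ?_⟩
  · exact isEven_rid.comp (IsEven.id.map D.even_counit)
  · change _ = (C.tensor D).star _ _
    have e : (C.tensor D).star (fst V D) (fst V D) = TensorProduct.map
        (TensorProduct.rid k V).toLinearMap (TensorProduct.rid k V).toLinearMap ∘ₗ
        (C.tensor D).star (TensorProduct.map LinearMap.id D.counit)
          (TensorProduct.map LinearMap.id D.counit) := by rw [map_star]; rfl
    have e' : D.star D.counit D.counit = (TensorProduct.lid k k).symm.toLinearMap ∘ₗ D.counit := by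
      rw [LinearEquiv.eq_toLinearMap_symm_comp, lid_star_counit]
    rw [e, tensor_star _ _ _ _ IsEven.id D.even_counit, e', star_id]
    have : TensorProduct.map
        (TensorProduct.rid k V).toLinearMap (TensorProduct.rid k V).toLinearMap ∘ₗ
        middleSwap k V V k k ∘ₗ
        TensorProduct.map LinearMap.id (TensorProduct.lid k k).symm.toLinearMap =
        (TensorProduct.rid k (V ⊗[k] V)).toLinearMap := by
      refine TensorProduct.ext (tensor_ext_homog fun i j a ha b hb ↦ LinearMap.ext fun c ↦ ?_)
      simp [middleSwap_tmul _ _ hb (mem_deg_field_zero (1 : k))]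
    refine TensorProduct.ext' fun v w ↦ ?_
    have := LinearMap.congr_fun this (C.comul v ⊗ₜ D.counit w)
    simp only [LinearMap.comp_apply, LinearEquiv.coe_coe, TensorProduct.map_tmul,
      LinearMap.id_apply, fst_tmul, map_smul] at this ⊢
    rw [this]; simp
  · exact TensorProduct.ext' fun a b ↦ by simp [mul_comm]

/-- The sign of the flip is lost because the counit vanishes on odd vectors. -/
theorem fst_comp_tau : fst W C ∘ₗ tau k V W = snd C W := by
  refine tensor_ext_homog fun i j a ha b hb ↦ ?_
  rcases zmod2_cases i with rfl | rfl
  · simp [tau_tmul ha hb]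
  · simp [tau_tmul ha hb, isEven_field_iff.1 C.even_counit a ha]

theorem snd_comp_tau : snd D V ∘ₗ tau k V W = fst V D := by
  refine tensor_ext_homog fun i j a ha b hb ↦ ?_
  rcases zmod2_cases j with rfl | rfl
  · simp [tau_tmul ha hb]
  · simp [tau_tmul ha hb, isEven_field_iff.1 D.even_counit b hb]

theorem isHom_snd : IsHom (C.tensor D) D (snd C W) := by
  rw [← fst_comp_tau]
  exact (isHom_fst D C).comp (isHom_tau C D)

/-- By the counit axioms in both factors, `∑ (id ⊗ ε) ⊗ (ε ⊗ id)` along the coproduct is the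
identity. Composed with a morphism into `V ⊗ W`, it recovers that morphism from its two components.
-/
theorem star_fst_snd : (C.tensor D).star (fst V D) (snd C W) = LinearMap.id := by
  have e : (C.tensor D).star (fst V D) (snd C W) = TensorProduct.map
      (TensorProduct.rid k V).toLinearMap (TensorProduct.lid k W).toLinearMap ∘ₗ
      (C.tensor D).star (TensorProduct.map LinearMap.id D.counit)
        (TensorProduct.map C.counit LinearMap.id) := by rw [map_star]; rfl
  have e1 : C.star LinearMap.id C.counit = (TensorProduct.rid k V).symm.toLinearMap := by
    rw [← LinearMap.comp_id (TensorProduct.rid k V).symm.toLinearMap,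
      LinearEquiv.eq_toLinearMap_symm_comp, rid_star_counit]
  have e2 : D.star D.counit LinearMap.id = (TensorProduct.lid k W).symm.toLinearMap := by
    rw [← LinearMap.comp_id (TensorProduct.lid k W).symm.toLinearMap,
      LinearEquiv.eq_toLinearMap_symm_comp, lid_star_counit]
  rw [e, tensor_star _ _ _ _ C.even_counit D.even_counit, e1, e2]
  refine TensorProduct.ext' fun v w ↦ ?_
  simp [middleSwap_tmul _ _ (mem_deg_field_zero (1 : k)) (mem_deg_field_zero (1 : k))]

/-- The same statement for `W ⊗ V`, pulled back along the flip. Taking the components in the wrong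
order produces `τ`; this is the source of all order reversals below. -/
theorem star_snd_fst : (C.tensor D).star (snd C W) (fst V D) = tau k V W := by
  have := (isHom_tau C D).star (fst W C) (snd D V)
  rwa [fst_comp_tau, snd_comp_tau, star_fst_snd, LinearMap.id_comp, eq_comm] at this

theorem lid_middleSwap :
    (TensorProduct.lid k (V ⊗[k] W)).toLinearMap ∘ₗ TensorProduct.map
      (LinearMap.mul' k k) LinearMap.id ∘ₗ middleSwap k k V k W =
    TensorProduct.map (TensorProduct.lid k V).toLinearMap (TensorProduct.lid k W).toLinearMap := by
  refine tensor_ext_homog_four fun i j l m a ha b hb c hc d hd ↦ ?_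
  rw [LinearMap.comp_apply, LinearMap.comp_apply, middleSwap_tmul _ _ hb (mem_deg_field_zero c)]
  simp [TensorProduct.smul_tmul, smul_smul, mul_comm]

theorem rid_middleSwap :
    (TensorProduct.rid k (V ⊗[k] W)).toLinearMap ∘ₗ TensorProduct.map
      LinearMap.id (LinearMap.mul' k k) ∘ₗ middleSwap k V k W k =
    TensorProduct.map (TensorProduct.rid k V).toLinearMap (TensorProduct.rid k W).toLinearMap := by
  refine tensor_ext_homog_four fun i j l m a ha b hb c hc d hd ↦ ?_
  rw [LinearMap.comp_apply, LinearMap.comp_apply, middleSwap_tmul _ _ (mem_deg_field_zero b) hc]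
  simp [TensorProduct.smul_tmul, smul_smul, mul_comm]

theorem map_actL {s : V →ₗ[k] k} {f : V →ₗ[k] M} {s' : W →ₗ[k] k} {f' : W →ₗ[k] N}
    (hf : IsEven f) (hs' : IsEven s') :
    TensorProduct.map (C.actL s f) (D.actL s' f') =
      (C.tensor D).actL (LinearMap.mul' k k ∘ₗ TensorProduct.map s s') (TensorProduct.map f f') := by
  rw [actL, actL, actL, TensorProduct.map_comp, ← lid_middleSwap]
  rw [← LinearMap.id_comp (TensorProduct.map f f'), ← map_star, tensor_star _ _ _ _ hf hs']
  rfl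

theorem map_actR {s : V →ₗ[k] k} {f : V →ₗ[k] M} {s' : W →ₗ[k] k} {f' : W →ₗ[k] N}
    (hs : IsEven s) (hf' : IsEven f') :
    TensorProduct.map (C.actR f s) (D.actR f' s') =
      (C.tensor D).actR (TensorProduct.map f f') (LinearMap.mul' k k ∘ₗ TensorProduct.map s s') := by
  rw [actR, actR, actR, TensorProduct.map_comp, ← rid_middleSwap]
  rw [← LinearMap.id_comp (TensorProduct.map f f'), ← map_star, tensor_star _ _ _ _ hs hf']
  rfl

-- The identity is itself conjugated by the counit, so both factors can be acted on at once, by `ε ⊗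
-- s` and `ε ⊗ t`. Evenness prevents crossing signs.
variable {C} in
theorem map_id_conj {s t : V →ₗ[k] k} {f : V →ₗ[k] M} (hs : IsEven s) (ht : IsEven t)
    (hf : IsEven f) :
    TensorProduct.map LinearMap.id (C.conj s t f) = (E.tensor C).conj (s ∘ₗ snd E V)
      (t ∘ₗ snd E V) (TensorProduct.map LinearMap.id f) := by
  have e : ∀ s : V →ₗ[k] k, s ∘ₗ snd E V = LinearMap.mul' k k ∘ₗ TensorProduct.map E.counit s :=
    fun s ↦ TensorProduct.ext' fun a b ↦ by simp
  have h := isEven_actR (C := C) ht hf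
  rw [conj, conj, e, e]
  conv_lhs => rw [← E.counit_actL LinearMap.id]
  rw [map_actL _ _ IsEven.id hs]
  conv_lhs => rw [← E.actR_counit LinearMap.id]
  rw [map_actR _ _ E.even_counit hf]

variable {C} in
theorem map_conj_id {s t : V →ₗ[k] k} {f : V →ₗ[k] M} (ht : IsEven t)
    (hf : IsEven f) :
    TensorProduct.map (C.conj s t f) LinearMap.id = (C.tensor E).conj (s ∘ₗ fst V E)
      (t ∘ₗ fst V E) (TensorProduct.map f LinearMap.id) := by
  have e : ∀ s : V →ₗ[k] k, s ∘ₗ fst V E = LinearMap.mul' k k ∘ₗ TensorProduct.map s E.counit :=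
    fun s ↦ TensorProduct.ext' fun a b ↦ by simp [mul_comm]
  have h := isEven_actR (C := C) ht hf
  rw [conj, conj, e, e]
  conv_lhs => rw [← E.counit_actL LinearMap.id]
  rw [map_actL _ _ h E.even_counit]
  conv_lhs => rw [← E.actR_counit LinearMap.id]
  rw [map_actR _ _ ht IsEven.id]

end Supercoalgebra

open Supercoalgebra

/-! ### Skew pairings and the conjugated flip. -/

section SkewPairing

variable {k : Type*} [Field k]
variable {V W : Type*} [AddCommGroup V] [Module k V] [AddCommGroup W] [Module k W]
variable [Superspace k V] [Superspace k W]

/-- The underlying supercoalgebra of a superbialgebra. -/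
@[simps]
def IsSuperbialgebra.coalg {A : BialgOps k V} (hA : IsSuperbialgebra A) : Supercoalgebra k V where
  comul := A.comul
  counit := A.counit
  even_comul := hA.even_comul
  even_counit := hA.even_counit
  coassoc := hA.coassoc
  counit_comul := hA.counit_comul
  comul_counit := hA.comul_counit

/-- The bialgebra axioms read as a statement on `μ`; functionals and conjugates can then be pulled
back along the product. -/
theorem IsSuperbialgebra.isHom_mul {A : BialgOps k V} (hA : IsSuperbialgebra A) :
    IsHom (hA.coalg.tensor hA.coalg) hA.coalg A.mul :=
  ⟨hA.even_mul, hA.comul_mul, TensorProduct.ext' fun a b ↦ by simp [hA.counit_mul]⟩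

/-- The unit is even and grouplike, so inserting it respects coproducts. This allows restricting
`s`, `t` and the exchange map to `1 ⊗ X`. -/
theorem IsSuperbialgebra.isHom_unit_tmul {A : BialgOps k V} {X : BialgOps k W}
    (hA : IsSuperbialgebra A) (hX : IsSuperbialgebra X) :
    IsHom hX.coalg (hA.coalg.tensor hX.coalg) (TensorProduct.mk k V W (A.unit 1)) := by
  refine ⟨fun i x hx ↦ ?_, ?_, ?_⟩
  · simpa using tmul_mem (hA.even_unit 0 1 (mem_deg_field_zero _)) hx
  · refine LinearMap.ext fun x ↦ ?_
    have : ∀ r : W ⊗[k] W, middleSwap k V V W W ((A.unit 1 ⊗ₜ A.unit 1) ⊗ₜ r) =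
        TensorProduct.map (TensorProduct.mk k V W (A.unit 1))
          (TensorProduct.mk k V W (A.unit 1)) r := by
      refine LinearMap.congr_fun (f := middleSwap k V V W W ∘ₗ
        TensorProduct.mk k _ _ (A.unit 1 ⊗ₜ A.unit 1)) (tensor_ext_homog fun i j y hy z hz ↦ ?_)
      simp [middleSwap_tmul _ _ (hA.even_unit 0 1 (mem_deg_field_zero _)) hy]
    simp [tensor, hA.comul_one, this]
  · ext x; simp [hA.counit_one]

theorem IsSuperbialgebra.isHom_tmul_unit {A : BialgOps k V} {X : BialgOps k W}
    (hA : IsSuperbialgebra A) (hX : IsSuperbialgebra X) :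
    IsHom hA.coalg (hA.coalg.tensor hX.coalg) ((TensorProduct.mk k V W).flip (X.unit 1)) := by
  refine ⟨fun i a ha ↦ ?_, ?_, ?_⟩
  · simpa using tmul_mem ha (hX.even_unit 0 1 (mem_deg_field_zero _))
  · refine LinearMap.ext fun x ↦ ?_
    have : ∀ r : V ⊗[k] V, middleSwap k V V W W (r ⊗ₜ (X.unit 1 ⊗ₜ X.unit 1)) =
        TensorProduct.map ((TensorProduct.mk k V W).flip (X.unit 1))
          ((TensorProduct.mk k V W).flip (X.unit 1)) r := by
      refine LinearMap.congr_fun (f := middleSwap k V V W W ∘ₗ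
        (TensorProduct.mk k _ _).flip (X.unit 1 ⊗ₜ X.unit 1))
        (tensor_ext_homog fun i j y hy z hz ↦ ?_)
      simp [middleSwap_tmul _ _ hz (hX.even_unit 0 1 (mem_deg_field_zero _))]
    simp [tensor, hX.comul_one, this]
  · ext x; simp [hX.counit_one]

/-- A convolution-invertible skew pairing `s` of superbialgebras, with inverse `t`. -/
structure IsSkewPairing {A : BialgOps k V} {X : BialgOps k W} (hA : IsSuperbialgebra A)
    (hX : IsSuperbialgebra X) (s t : V ⊗[k] W →ₗ[k] k) : Prop where
  even : IsEven s
  even_inv : IsEven t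
  isInv : (hA.coalg.tensor hX.coalg).IsInv s t
  mul_left : s ∘ₗ TensorProduct.map A.mul LinearMap.id =
    LinearMap.mul' k k ∘ₗ TensorProduct.map s s ∘ₗ middleSwap k V V W W ∘ₗ
      TensorProduct.map (tau k V V) X.comul
  mul_right : s ∘ₗ TensorProduct.map LinearMap.id X.mul =
    LinearMap.mul' k k ∘ₗ TensorProduct.map s s ∘ₗ middleSwap k V V W W ∘ₗ
      TensorProduct.map A.comul LinearMap.id
  one_left : ∀ x : W, s (A.unit 1 ⊗ₜ x) = X.counit x
  one_right : ∀ a : V, s (a ⊗ₜ X.unit 1) = A.counit a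

variable {A : BialgOps k V} {X : BialgOps k W} {hA : IsSuperbialgebra A}
  {hX : IsSuperbialgebra X} {s t : V ⊗[k] W →ₗ[k] k}

/-- The exchange map `a ⊗ x ↦ ∑ s(a', x') (x'' ⊗ a'') t(a''', x''')`, up to sign. -/
def exchangeMap (hA : IsSuperbialgebra A) (hX : IsSuperbialgebra X) (s t : V ⊗[k] W →ₗ[k] k) :
    V ⊗[k] W →ₗ[k] W ⊗[k] V := (hA.coalg.tensor hX.coalg).conj s t (tau k V W)

namespace IsSkewPairing

theorem isHom_exchangeMap (h : IsSkewPairing hA hX s t) :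
    IsHom (hA.coalg.tensor hX.coalg) (hX.coalg.tensor hA.coalg) (exchangeMap hA hX s t) :=
  (isHom_tau _ _).conj_isHom h.isInv h.even h.even_inv

theorem mul'_comp_map_eq_actL {M : Type*} [AddCommGroup M] [Module k M] [Superspace k M]
    (C : Supercoalgebra k M) (s t : M →ₗ[k] k) :
    C.actL s t = LinearMap.mul' k k ∘ₗ C.star s t := by
  rw [actL]; congr 1

/-- The flip in the axiom `mul_left` is `snd ⋆ fst`, so `s(ab, -)` is a convolution product with the
factor for `b` first. This is the skewness, and it matches the order in which `x` is moved past
`ab`. -/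
theorem comp_mul_left (h : IsSkewPairing hA hX s t) :
    s ∘ₗ TensorProduct.map A.mul LinearMap.id =
      ((hA.coalg.tensor hA.coalg).tensor hX.coalg).actL
        (s ∘ₗ TensorProduct.map (snd hA.coalg V) LinearMap.id)
        (s ∘ₗ TensorProduct.map (fst V hA.coalg) LinearMap.id) := by
  rw [mul'_comp_map_eq_actL, ← Supercoalgebra.map_star, tensor_star, star_snd_fst, star_id, h.mul_left]
  · rfl
  · exact (isHom_fst hA.coalg _).even
  · exact IsEven.id

theorem comp_mul_right (h : IsSkewPairing hA hX s t) :
    s ∘ₗ TensorProduct.map LinearMap.id X.mul =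
      (hA.coalg.tensor (hX.coalg.tensor hX.coalg)).actL
        (s ∘ₗ TensorProduct.map LinearMap.id (fst W hX.coalg))
        (s ∘ₗ TensorProduct.map LinearMap.id (snd hX.coalg W)) := by
  rw [mul'_comp_map_eq_actL, ← Supercoalgebra.map_star, tensor_star, star_fst_snd, star_id, h.mul_right]
  · rfl
  · exact IsEven.id
  · exact (isHom_fst hX.coalg _).even

/-- Moving `x` past a pair `a ⊗ b` is moving it past `b` and then past `a`: the hexagon of `τ`,
followed by `f`. -/
theorem tau_comp_mul_left (f : V ⊗[k] V →ₗ[k] V) (hf : IsEven f) :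
    tau k V W ∘ₗ TensorProduct.map f LinearMap.id =
      TensorProduct.map LinearMap.id f ∘ₗ (TensorProduct.assoc k W V V).toLinearMap ∘ₗ
        TensorProduct.map (tau k V W) LinearMap.id ∘ₗ
        (TensorProduct.assoc k V W V).symm.toLinearMap ∘ₗ
        TensorProduct.map LinearMap.id (tau k V W) ∘ₗ
        (TensorProduct.assoc k V V W).toLinearMap := by
  rw [tau_map hf IsEven.id]
  congr 1
  refine tensor_ext_homog_left fun i j l a ha b hb c hc ↦ ?_
  simp [tau_tmul (tmul_mem ha hb) hc, tau_tmul hb hc, tau_tmul ha hc, sgn_add_left, smul_smul,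
    ← TensorProduct.smul_tmul', mul_comm]

theorem tau_comp_mul_right (f : W ⊗[k] W →ₗ[k] W) (hf : IsEven f) :
    tau k V W ∘ₗ TensorProduct.map LinearMap.id f =
      TensorProduct.map f LinearMap.id ∘ₗ (TensorProduct.assoc k W W V).symm.toLinearMap ∘ₗ
        TensorProduct.map LinearMap.id (tau k V W) ∘ₗ
        (TensorProduct.assoc k W V W).toLinearMap ∘ₗ
        TensorProduct.map (tau k V W) LinearMap.id ∘ₗ
        (TensorProduct.assoc k V W W).symm.toLinearMap := by
  rw [tau_map IsEven.id hf]
  congr 1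
  refine tensor_ext_homog_right fun i j l a ha b hb c hc ↦ ?_
  simp [tau_tmul ha (tmul_mem hb hc), tau_tmul ha hb, tau_tmul ha hc, sgn_add_right, smul_smul,
    ← TensorProduct.smul_tmul']

/-- The exchange map is compatible with the multiplication of `A`. -/
theorem exchangeMap_mul_left (h : IsSkewPairing hA hX s t) :
    exchangeMap hA hX s t ∘ₗ TensorProduct.map A.mul LinearMap.id =
      TensorProduct.map LinearMap.id A.mul ∘ₗ (TensorProduct.assoc k W V V).toLinearMap ∘ₗ
        TensorProduct.map (exchangeMap hA hX s t) LinearMap.id ∘ₗ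
        (TensorProduct.assoc k V W V).symm.toLinearMap ∘ₗ
        TensorProduct.map LinearMap.id (exchangeMap hA hX s t) ∘ₗ
        (TensorProduct.assoc k V V W).toLinearMap := by
  have hμ := hA.isHom_mul.map (IsHom.id (C := hX.coalg))
  have hp := (isHom_fst hA.coalg hA.coalg).map (IsHom.id (C := hX.coalg))
  have hq := (isHom_snd hA.coalg hA.coalg).map (IsHom.id (C := hX.coalg))
  have hs₀ : ∀ s : V ⊗[k] W →ₗ[k] k, (s ∘ₗ snd hA.coalg (V ⊗[k] W)) ∘ₗ
      (TensorProduct.assoc k V V W).toLinearMap =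
      s ∘ₗ TensorProduct.map (snd hA.coalg V) LinearMap.id := fun s ↦
    TensorProduct.ext_threefold fun a b c ↦ by simp [← TensorProduct.smul_tmul']
  have hΦ : (TensorProduct.assoc k V W V).symm.toLinearMap ∘ₗ
        TensorProduct.map LinearMap.id (exchangeMap hA hX s t) ∘ₗ
        (TensorProduct.assoc k V V W).toLinearMap =
      ((hA.coalg.tensor hA.coalg).tensor hX.coalg).conj
        (s ∘ₗ TensorProduct.map (snd hA.coalg V) LinearMap.id)
        (t ∘ₗ TensorProduct.map (snd hA.coalg V) LinearMap.id)
        ((TensorProduct.assoc k V W V).symm.toLinearMap ∘ₗ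
        TensorProduct.map LinearMap.id (tau k V W) ∘ₗ
        (TensorProduct.assoc k V V W).toLinearMap) := by
    rw [exchangeMap, map_id_conj _ h.even h.even_inv isEven_tau,
      (isHom_assoc hA.coalg hA.coalg hX.coalg).conj, comp_conj, hs₀, hs₀]
  have hΦhom : IsHom ((hA.coalg.tensor hA.coalg).tensor hX.coalg)
        ((hA.coalg.tensor hX.coalg).tensor hA.coalg)
        ((TensorProduct.assoc k V W V).symm.toLinearMap ∘ₗ
        TensorProduct.map LinearMap.id (exchangeMap hA hX s t) ∘ₗ
        (TensorProduct.assoc k V V W).toLinearMap) :=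
    (isHom_assoc _ _ _).symm.comp ((IsHom.id.map h.isHom_exchangeMap).comp (isHom_assoc _ _ _))
  -- The functional of the second crossing, pulled back through the unconjugated first crossing,
  -- pairs `a` with `x`.
  have ht₀ : ∀ s : V ⊗[k] W →ₗ[k] k, (s ∘ₗ fst (V ⊗[k] W) hA.coalg) ∘ₗ
      (TensorProduct.assoc k V W V).symm.toLinearMap ∘ₗ
        TensorProduct.map LinearMap.id (tau k V W) ∘ₗ
        (TensorProduct.assoc k V V W).toLinearMap =
      s ∘ₗ TensorProduct.map (fst V hA.coalg) LinearMap.id := by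
    intro s
    refine tensor_ext_homog_left fun i j l a ha b hb c hc ↦ ?_
    rcases zmod2_cases j with rfl | rfl
    · simp [tau_tmul hb hc, ← TensorProduct.smul_tmul']
    · have : A.counit b = 0 := isEven_field_iff.1 hA.even_counit b hb
      simp [tau_tmul hb hc, this]
  have hσ := h.comp_mul_left
  -- The axioms say nothing about `t` on a product. Its value is forced by uniqueness of convolution
  -- inverses.
  have hinv := (h.isInv.comp hq).mul (h.isInv.comp hp)
  rw [← hσ] at hinv
  have ht := (h.isInv.comp hμ).unique hinv
  rw [exchangeMap, hμ.conj, hσ, ht, tau_comp_mul_left _ hA.even_mul, ← exchangeMap, hΦ,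
    exchangeMap, map_conj_id _ h.even_inv isEven_tau]
  rw [hΦ] at hΦhom
  rw [conj_comp_conj (h.isInv.comp hq) hΦhom, ht₀, ht₀, comp_conj, comp_conj]

/-- The exchange map is compatible with the multiplication of `X`. -/
theorem exchangeMap_mul_right (h : IsSkewPairing hA hX s t) :
    exchangeMap hA hX s t ∘ₗ TensorProduct.map LinearMap.id X.mul =
      TensorProduct.map X.mul LinearMap.id ∘ₗ (TensorProduct.assoc k W W V).symm.toLinearMap ∘ₗ
        TensorProduct.map LinearMap.id (exchangeMap hA hX s t) ∘ₗ
        (TensorProduct.assoc k W V W).toLinearMap ∘ₗ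
        TensorProduct.map (exchangeMap hA hX s t) LinearMap.id ∘ₗ
        (TensorProduct.assoc k V W W).symm.toLinearMap := by
  have hμ := (IsHom.id (C := hA.coalg)).map hX.isHom_mul
  have hp := (IsHom.id (C := hA.coalg)).map (isHom_fst hX.coalg hX.coalg)
  have hq := (IsHom.id (C := hA.coalg)).map (isHom_snd hX.coalg hX.coalg)
  have hs₀ : ∀ s : V ⊗[k] W →ₗ[k] k, (s ∘ₗ fst (V ⊗[k] W) hX.coalg) ∘ₗ
      (TensorProduct.assoc k V W W).symm.toLinearMap =
      s ∘ₗ TensorProduct.map LinearMap.id (fst W hX.coalg) := fun s ↦ by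
    refine TensorProduct.ext (LinearMap.ext fun a ↦ TensorProduct.ext' fun b c ↦ ?_)
    simp
  have hΦ : (TensorProduct.assoc k W V W).toLinearMap ∘ₗ
        TensorProduct.map (exchangeMap hA hX s t) LinearMap.id ∘ₗ
        (TensorProduct.assoc k V W W).symm.toLinearMap =
      (hA.coalg.tensor (hX.coalg.tensor hX.coalg)).conj
        (s ∘ₗ TensorProduct.map LinearMap.id (fst W hX.coalg))
        (t ∘ₗ TensorProduct.map LinearMap.id (fst W hX.coalg))
        ((TensorProduct.assoc k W V W).toLinearMap ∘ₗ
        TensorProduct.map (tau k V W) LinearMap.id ∘ₗ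
        (TensorProduct.assoc k V W W).symm.toLinearMap) := by
    rw [exchangeMap, map_conj_id _ h.even_inv isEven_tau,
      (isHom_assoc hA.coalg hX.coalg hX.coalg).symm.conj, comp_conj, hs₀, hs₀]
  have hΦhom : IsHom (hA.coalg.tensor (hX.coalg.tensor hX.coalg))
        (hX.coalg.tensor (hA.coalg.tensor hX.coalg))
        ((TensorProduct.assoc k W V W).toLinearMap ∘ₗ
        TensorProduct.map (exchangeMap hA hX s t) LinearMap.id ∘ₗ
        (TensorProduct.assoc k V W W).symm.toLinearMap) :=
    (isHom_assoc _ _ _).comp ((h.isHom_exchangeMap.map IsHom.id).comp (isHom_assoc _ _ _).symm)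
  have ht₀ : ∀ s : V ⊗[k] W →ₗ[k] k, (s ∘ₗ snd hX.coalg (V ⊗[k] W)) ∘ₗ
      (TensorProduct.assoc k W V W).toLinearMap ∘ₗ
        TensorProduct.map (tau k V W) LinearMap.id ∘ₗ
        (TensorProduct.assoc k V W W).symm.toLinearMap =
      s ∘ₗ TensorProduct.map LinearMap.id (snd hX.coalg W) := by
    intro s
    refine tensor_ext_homog_right fun i j l a ha b hb c hc ↦ ?_
    rcases zmod2_cases j with rfl | rfl
    · simp [tau_tmul ha hb]
    · have : X.counit b = 0 := isEven_field_iff.1 hX.even_counit b hb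
      simp [tau_tmul ha hb, ← TensorProduct.smul_tmul', this]
  -- Here the factors come in the natural order, in accordance with `a` passing the left factor of
  -- the product in `X` first.
  have hσ := h.comp_mul_right
  have hinv := (h.isInv.comp hp).mul (h.isInv.comp hq)
  rw [← hσ] at hinv
  have ht := (h.isInv.comp hμ).unique hinv
  rw [exchangeMap, hμ.conj, hσ, ht, tau_comp_mul_right _ hX.even_mul, ← exchangeMap, hΦ,
    exchangeMap, map_id_conj _ h.even h.even_inv isEven_tau]
  rw [hΦ] at hΦhom
  rw [conj_comp_conj (h.isInv.comp hp) hΦhom, ht₀, ht₀, comp_conj, comp_conj]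

/-- On `1 ⊗ X` the pairing restricts to the counit, hence so does its inverse, and conjugation by
the counit is trivial. Only the flip is left. -/
theorem exchangeMap_one_left (h : IsSkewPairing hA hX s t) (x : W) :
    exchangeMap hA hX s t (A.unit 1 ⊗ₜ x) = x ⊗ₜ A.unit 1 := by
  have hj := hA.isHom_unit_tmul hX
  have e : s ∘ₗ TensorProduct.mk k V W (A.unit 1) = hX.coalg.counit :=
    LinearMap.ext fun x ↦ h.one_left x
  have e' : t ∘ₗ TensorProduct.mk k V W (A.unit 1) = hX.coalg.counit :=
    (h.isInv.comp hj).unique (by rw [e]; exact ⟨counit_actL _ _, counit_actL _ _⟩)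
  have := LinearMap.congr_fun (hj.conj s t (tau k V W)) x
  rw [e, e', counit_conj] at this
  refine this.trans ?_
  change (tau k V W ∘ₗ TensorProduct.mk k V W (A.unit 1)) x = (TensorProduct.mk k W V).flip _ x
  congr 1
  refine linear_ext_homog fun i x hx ↦ ?_
  simp [tau_tmul (hA.even_unit 0 1 (mem_deg_field_zero _)) hx]

theorem exchangeMap_one_right (h : IsSkewPairing hA hX s t) (a : V) :
    exchangeMap hA hX s t (a ⊗ₜ X.unit 1) = X.unit 1 ⊗ₜ a := by
  have hj := hA.isHom_tmul_unit hX
  have e : s ∘ₗ (TensorProduct.mk k V W).flip (X.unit 1) = hA.coalg.counit :=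
    LinearMap.ext fun x ↦ h.one_right x
  have e' : t ∘ₗ (TensorProduct.mk k V W).flip (X.unit 1) = hA.coalg.counit :=
    (h.isInv.comp hj).unique (by rw [e]; exact ⟨counit_actL _ _, counit_actL _ _⟩)
  have := LinearMap.congr_fun (hj.conj s t (tau k V W)) a
  rw [e, e', counit_conj] at this
  refine this.trans ?_
  change (tau k V W ∘ₗ (TensorProduct.mk k V W).flip (X.unit 1)) a = TensorProduct.mk k W V _ a
  congr 1
  refine linear_ext_homog fun i x hx ↦ ?_
  simp [tau_tmul hx (hX.even_unit 0 1 (mem_deg_field_zero _))]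

end IsSkewPairing

end SkewPairing

open Supercoalgebra

/-! ### From exchange maps to matched pairs. -/

section ExchangeMap

variable {k : Type*} [Field k]
variable {V W : Type*} [AddCommGroup V] [Module k V] [AddCommGroup W] [Module k W]
variable [Superspace k V] [Superspace k W]

/-- Reversing both coproducts before the middle swap reverses the coproduct of the tensor product.
It accounts for the right side of the exchange condition. -/
theorem middleSwap_map_tau {B C D E : Type*} [AddCommGroup B] [Module k B] [AddCommGroup C]
    [Module k C] [AddCommGroup D] [Module k D] [AddCommGroup E] [Module k E]
    [Superspace k B] [Superspace k C] [Superspace k D] [Superspace k E] :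
    middleSwap k C B E D ∘ₗ TensorProduct.map (tau k B C) (tau k D E) =
      tau k (B ⊗[k] D) (C ⊗[k] E) ∘ₗ middleSwap k B C D E :=
  tensor_ext_homog_four fun i j l m a ha b hb c hc d hd ↦ by
    simp only [LinearMap.comp_apply, TensorProduct.map_tmul, tau_tmul ha hb, tau_tmul hc hd,
      map_smul, middleSwap_tmul _ _ ha hd, middleSwap_tmul _ _ hb hc,
      tau_tmul (tmul_mem ha hc) (tmul_mem hb hd), TensorProduct.tmul_smul,
      ← TensorProduct.smul_tmul', smul_smul, sgn_add_left, sgn_add_right]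
    congr 1
    rw [sgn_comm k l j]
    linear_combination - (sgn k i j * sgn k i m * sgn k l m) * sgn_mul_self (k := k) j l

variable {A : BialgOps k V} {X : BialgOps k W}

/-- An exchange map `R : A ⊗ X → X ⊗ A`, which makes `X ⊗ A` a twisted tensor product of
superbialgebras. -/
structure IsExchangeMap (hA : IsSuperbialgebra A) (hX : IsSuperbialgebra X)
    (R : V ⊗[k] W →ₗ[k] W ⊗[k] V) : Prop where
  isHom : IsHom (hA.coalg.tensor hX.coalg) (hX.coalg.tensor hA.coalg) R
  mul_left : R ∘ₗ TensorProduct.map A.mul LinearMap.id =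
      TensorProduct.map LinearMap.id A.mul ∘ₗ (TensorProduct.assoc k W V V).toLinearMap ∘ₗ
        TensorProduct.map R LinearMap.id ∘ₗ
        (TensorProduct.assoc k V W V).symm.toLinearMap ∘ₗ
        TensorProduct.map LinearMap.id R ∘ₗ
        (TensorProduct.assoc k V V W).toLinearMap
  mul_right : R ∘ₗ TensorProduct.map LinearMap.id X.mul =
      TensorProduct.map X.mul LinearMap.id ∘ₗ (TensorProduct.assoc k W W V).symm.toLinearMap ∘ₗ
        TensorProduct.map LinearMap.id R ∘ₗ
        (TensorProduct.assoc k W V W).toLinearMap ∘ₗ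
        TensorProduct.map R LinearMap.id ∘ₗ
        (TensorProduct.assoc k V W W).symm.toLinearMap
  one_left : ∀ x, R (A.unit 1 ⊗ₜ x) = x ⊗ₜ A.unit 1
  one_right : ∀ a, R (a ⊗ₜ X.unit 1) = X.unit 1 ⊗ₜ a

theorem IsSkewPairing.isExchangeMap {hA : IsSuperbialgebra A}
    {hX : IsSuperbialgebra X} {s t : V ⊗[k] W →ₗ[k] k} (h : IsSkewPairing hA hX s t) :
    IsExchangeMap hA hX (exchangeMap hA hX s t) :=
  ⟨h.isHom_exchangeMap, h.exchangeMap_mul_left, h.exchangeMap_mul_right, h.exchangeMap_one_left,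
    h.exchangeMap_one_right⟩

/-- Both components are conjugates by the same `s` and `t`, so both sides equal `s * id * t`: on the
left by `star_conj`, on the right because `τ τ = id`. This gives the exchange condition, the one
axiom for which the form of `R` as a conjugate matters beyond the rules in `IsExchangeMap`. -/
theorem IsSkewPairing.star_snd_fst_exchangeMap {hA : IsSuperbialgebra A}
    {hX : IsSuperbialgebra X} {s t : V ⊗[k] W →ₗ[k] k} (h : IsSkewPairing hA hX s t) :
    (hA.coalg.tensor hX.coalg).star (snd hX.coalg V ∘ₗ exchangeMap hA hX s t)
      (fst W hA.coalg ∘ₗ exchangeMap hA hX s t) = tau k W V ∘ₗ exchangeMap hA hX s t := by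
  rw [exchangeMap, comp_conj, comp_conj, comp_conj, snd_comp_tau, fst_comp_tau,
    star_conj _ h.isInv, star_fst_snd, tau_tau]

namespace IsExchangeMap

variable {hA : IsSuperbialgebra A} {hX : IsSuperbialgebra X} {R : V ⊗[k] W →ₗ[k] W ⊗[k] V}

theorem star_fst_snd (h : IsExchangeMap hA hX R) :
    (hA.coalg.tensor hX.coalg).star (fst W hA.coalg ∘ₗ R) (snd hX.coalg V ∘ₗ R) = R := by
  rw [← h.isHom.star, Supercoalgebra.star_fst_snd, LinearMap.id_comp]

/-- `R` is determined by its components. The sum `∑ ± a' · x' ⊗ a'' ^ x''`, which occurs in the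
matched pair axioms and in the product of the double, is therefore `R(a ⊗ x)`. -/
theorem map_comp_tensorComul (h : IsExchangeMap hA hX R) :
    TensorProduct.map (fst W hA.coalg ∘ₗ R) (snd hX.coalg V ∘ₗ R) ∘ₗ tensorComul A X = R :=
  h.star_fst_snd

theorem apply_mul_left (h : IsExchangeMap hA hX R) (a b : V) (x : W) :
    R (A.mul (a ⊗ₜ b) ⊗ₜ x) = TensorProduct.map LinearMap.id A.mul (TensorProduct.assoc k W V V
      (TensorProduct.map R LinearMap.id ((TensorProduct.assoc k V W V).symm (a ⊗ₜ R (b ⊗ₜ x))))) :=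
  LinearMap.congr_fun h.mul_left ((a ⊗ₜ b) ⊗ₜ x)

theorem apply_mul_right (h : IsExchangeMap hA hX R) (a : V) (x y : W) :
    R (a ⊗ₜ X.mul (x ⊗ₜ y)) = TensorProduct.map X.mul LinearMap.id
      ((TensorProduct.assoc k W W V).symm (TensorProduct.map LinearMap.id R
        (TensorProduct.assoc k W V W (R (a ⊗ₜ x) ⊗ₜ y)))) :=
  LinearMap.congr_fun h.mul_right (a ⊗ₜ (x ⊗ₜ y))

/-- Apply `id ⊗ ε` to the rule for `R(ab ⊗ x)`; multiplicativity of `ε` splits off the second leg.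
The next three lemmas come likewise from the other choices of leg and of rule: two are module
axioms, two are product rules. -/
theorem fst_mul_left (h : IsExchangeMap hA hX R) (a b : V) (x : W) :
    fst W hA.coalg (R (A.mul (a ⊗ₜ b) ⊗ₜ x)) =
      fst W hA.coalg (R (a ⊗ₜ fst W hA.coalg (R (b ⊗ₜ x)))) := by
  rw [h.apply_mul_left]
  induction R (b ⊗ₜ x) with
  | zero => simp
  | add u v hu hv => simp only [TensorProduct.tmul_add, map_add, hu, hv]
  | tmul y c =>
    simp only [TensorProduct.assoc_symm_tmul, TensorProduct.map_tmul, LinearMap.id_apply,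
      fst_tmul, TensorProduct.tmul_smul, map_smul]
    induction R (a ⊗ₜ y) with
    | zero => simp
    | add u v hu hv => simp only [TensorProduct.add_tmul, map_add, hu, hv, smul_add]
    | tmul z d => simp [hA.counit_mul, smul_smul, mul_comm]

theorem snd_mul_left (h : IsExchangeMap hA hX R) (a b : V) (x : W) :
    snd hX.coalg V (R (A.mul (a ⊗ₜ b) ⊗ₜ x)) =
      A.mul (TensorProduct.map (snd hX.coalg V ∘ₗ R ∘ₗ TensorProduct.mk k V W a) LinearMap.id
        (R (b ⊗ₜ x))) := by
  rw [h.apply_mul_left]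
  induction R (b ⊗ₜ x) with
  | zero => simp
  | add u v hu hv => simp only [TensorProduct.tmul_add, map_add, hu, hv]
  | tmul y c =>
    simp only [TensorProduct.assoc_symm_tmul, TensorProduct.map_tmul, LinearMap.id_apply,
      LinearMap.comp_apply, TensorProduct.mk_apply]
    induction R (a ⊗ₜ y) with
    | zero => simp
    | add u v hu hv => simp only [TensorProduct.add_tmul, map_add, hu, hv]
    | tmul z d => simp [← TensorProduct.smul_tmul']

theorem snd_mul_right (h : IsExchangeMap hA hX R) (a : V) (x y : W) :
    snd hX.coalg V (R (a ⊗ₜ X.mul (x ⊗ₜ y))) =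
      snd hX.coalg V (R (snd hX.coalg V (R (a ⊗ₜ x)) ⊗ₜ y)) := by
  rw [h.apply_mul_right]
  induction R (a ⊗ₜ x) with
  | zero => simp
  | add u v hu hv => simp only [TensorProduct.add_tmul, map_add, hu, hv]
  | tmul z c =>
    simp only [TensorProduct.assoc_tmul, TensorProduct.map_tmul, LinearMap.id_apply,
      snd_tmul, ← TensorProduct.smul_tmul', map_smul]
    induction R (c ⊗ₜ y) with
    | zero => simp
    | add u v hu hv => simp only [TensorProduct.tmul_add, map_add, hu, hv, smul_add]
    | tmul w d => simp [hX.counit_mul, smul_smul]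

theorem fst_mul_right (h : IsExchangeMap hA hX R) (a : V) (x y : W) :
    fst W hA.coalg (R (a ⊗ₜ X.mul (x ⊗ₜ y))) =
      X.mul (TensorProduct.map LinearMap.id
        (fst W hA.coalg ∘ₗ R ∘ₗ (TensorProduct.mk k V W).flip y) (R (a ⊗ₜ x))) := by
  rw [h.apply_mul_right]
  induction R (a ⊗ₜ x) with
  | zero => simp
  | add u v hu hv => simp only [TensorProduct.add_tmul, map_add, hu, hv]
  | tmul z c =>
    simp only [TensorProduct.assoc_tmul, TensorProduct.map_tmul, LinearMap.id_apply,
      LinearMap.comp_apply, LinearMap.flip_apply, TensorProduct.mk_apply]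
    induction R (c ⊗ₜ y) with
    | zero => simp
    | add u v hu hv => simp only [TensorProduct.tmul_add, map_add, hu, hv]
    | tmul w d => simp

theorem isMatchedPair (h : IsExchangeMap hA hX R)
    (hR : (hA.coalg.tensor hX.coalg).star (snd hX.coalg V ∘ₗ R) (fst W hA.coalg ∘ₗ R) =
      tau k W V ∘ₗ R) :
    IsMatchedPair X A (fst W hA.coalg ∘ₗ R) (snd hX.coalg V ∘ₗ R) := by
  have hα := (isHom_fst hX.coalg hA.coalg).comp h.isHom
  have hβ := (isHom_snd hX.coalg hA.coalg).comp h.isHom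
  exact
  { left_bialgebra := hX
    right_bialgebra := hA
    even_left := hα.even
    even_right := hβ.even
    mul_act := h.fst_mul_left
    one_act := fun x ↦ by simp [h.one_left, hA.counit_one]
    comul_left := hα.comul
    counit_left := hα.counit
    act_mul := h.snd_mul_right
    act_one := fun a ↦ by simp [h.one_right, hX.counit_one]
    comul_right := hβ.comul
    counit_right := hβ.counit
    left_mul := fun a x y ↦ by
      have e := congrArg (TensorProduct.map LinearMap.id
        (fst W hA.coalg ∘ₗ R ∘ₗ (TensorProduct.mk k V W).flip y))
        (LinearMap.congr_fun h.map_comp_tensorComul (a ⊗ₜ x))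
      rw [LinearMap.comp_apply, ← LinearMap.comp_apply, ← TensorProduct.map_comp] at e
      refine (h.fst_mul_right a x y).trans (congrArg X.mul ?_)
      rw [← e]
      rfl
    left_one := fun a ↦ by simp [h.one_right]
    right_mul := fun a b x ↦ by
      have e := congrArg (TensorProduct.map (snd hX.coalg V ∘ₗ R ∘ₗ TensorProduct.mk k V W a)
        LinearMap.id) (LinearMap.congr_fun h.map_comp_tensorComul (b ⊗ₜ x))
      rw [LinearMap.comp_apply, ← LinearMap.comp_apply, ← TensorProduct.map_comp] at e
      refine (h.snd_mul_left a b x).trans (congrArg A.mul ?_)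
      rw [← e]
      rfl
    right_one := fun x ↦ by simp [h.one_left]
    exchange := by
      refine hR.trans ?_
      -- With `R = (α ⊗ β) Δ`, naturality turns `τ R` into `(β ⊗ α) τ Δ`, and `τ Δ` is the middle
      -- swap of the two reversed coproducts.
      conv_lhs => rw [← h.map_comp_tensorComul, ← LinearMap.comp_assoc, tau_map hα.even hβ.even]
      rw [LinearMap.comp_assoc, ← LinearMap.comp_assoc _ _ (middleSwap k V V W W),
        middleSwap_map_tau]
      rfl }

end IsExchangeMap

end ExchangeMap

open Supercoalgebra

/-! ### Convolution algebras, properties of the antipode, and the opposite Hopf superalgebra. -/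

section Antipode

variable {k : Type*} [Field k]
variable {V : Type*} [AddCommGroup V] [Module k V] [Superspace k V]

namespace Supercoalgebra

variable {W L M N : Type*} [AddCommGroup W] [Module k W] [Superspace k W]
  [AddCommGroup M] [Module k M]

/-- The convolution product of linear maps from a supercoalgebra to a space with a bilinear
multiplication `m`. -/
def conv (C : Supercoalgebra k V) (m : M ⊗[k] M →ₗ[k] M) (f g : V →ₗ[k] M) : V →ₗ[k] M :=
  m ∘ₗ C.star f g

theorem conv_assoc (C : Supercoalgebra k V) {m : M ⊗[k] M →ₗ[k] M}
    (hm : ∀ a b c, m (m (a ⊗ₜ b) ⊗ₜ c) = m (a ⊗ₜ m (b ⊗ₜ c))) (f g h : V →ₗ[k] M) :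
    C.conv m (C.conv m f g) h = C.conv m f (C.conv m g h) := by
  have e : m ∘ₗ TensorProduct.map m LinearMap.id =
      (m ∘ₗ TensorProduct.map LinearMap.id m) ∘ₗ (TensorProduct.assoc k M M M).toLinearMap :=
    TensorProduct.ext_threefold fun a b c ↦ hm a b c
  rw [conv, conv, conv, conv, ← LinearMap.id_comp h, ← Supercoalgebra.map_star, ← LinearMap.comp_assoc, e,
    LinearMap.comp_assoc, star_assoc, LinearMap.comp_assoc, map_star, LinearMap.id_comp,
    LinearMap.id_comp]

theorem conv_counit_left (C : Supercoalgebra k V) {m : M ⊗[k] M →ₗ[k] M} {e : M}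
    (he : ∀ a, m (e ⊗ₜ a) = a) (f : V →ₗ[k] M) :
    C.conv m (LinearMap.toSpanSingleton k M e ∘ₗ C.counit) f = f := by
  have h : m ∘ₗ TensorProduct.map (LinearMap.toSpanSingleton k M e) LinearMap.id =
      (TensorProduct.lid k M).toLinearMap := TensorProduct.ext' fun c a ↦ by
    simp [← TensorProduct.smul_tmul', he]
  rw [conv, ← LinearMap.id_comp f, ← Supercoalgebra.map_star, ← LinearMap.comp_assoc, h, lid_star_counit,
    LinearMap.id_comp]

theorem conv_counit_right (C : Supercoalgebra k V) {m : M ⊗[k] M →ₗ[k] M} {e : M}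
    (he : ∀ a, m (a ⊗ₜ e) = a) (f : V →ₗ[k] M) :
    C.conv m f (LinearMap.toSpanSingleton k M e ∘ₗ C.counit) = f := by
  have h : m ∘ₗ TensorProduct.map LinearMap.id (LinearMap.toSpanSingleton k M e) =
      (TensorProduct.rid k M).toLinearMap := TensorProduct.ext' fun a c ↦ by
    simp [he]
  rw [conv, ← LinearMap.id_comp f, ← Supercoalgebra.map_star, ← LinearMap.comp_assoc, h, rid_star_counit,
    LinearMap.id_comp]

theorem IsHom.conv {C : Supercoalgebra k V} {D : Supercoalgebra k W} {φ : V →ₗ[k] W}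
    (hφ : IsHom C D φ) (m : M ⊗[k] M →ₗ[k] M) (f g : W →ₗ[k] M) :
    D.conv m f g ∘ₗ φ = C.conv m (f ∘ₗ φ) (g ∘ₗ φ) := by
  rw [Supercoalgebra.conv, LinearMap.comp_assoc, hφ.star]; rfl

theorem comp_conv (C : Supercoalgebra k V) {N : Type*} [AddCommGroup N] [Module k N]
    {m : M ⊗[k] M →ₗ[k] M} {n : N ⊗[k] N →ₗ[k] N} {p : M →ₗ[k] N}
    (hp : ∀ a b, p (m (a ⊗ₜ b)) = n (p a ⊗ₜ p b)) (f g : V →ₗ[k] M) :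
    p ∘ₗ C.conv m f g = C.conv n (p ∘ₗ f) (p ∘ₗ g) := by
  have : p ∘ₗ m = n ∘ₗ TensorProduct.map p p := TensorProduct.ext' fun a b ↦ by simp [hp]
  rw [conv, conv, ← Supercoalgebra.map_star, ← LinearMap.comp_assoc, this]
  rfl

theorem conv_inverse_unique (C : Supercoalgebra k V) {m : M ⊗[k] M →ₗ[k] M} {e : M}
    (hm : ∀ a b c, m (m (a ⊗ₜ b) ⊗ₜ c) = m (a ⊗ₜ m (b ⊗ₜ c)))
    (hl : ∀ a, m (e ⊗ₜ a) = a) (hr : ∀ a, m (a ⊗ₜ e) = a) {f g h : V →ₗ[k] M}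
    (h₁ : C.conv m f g = LinearMap.toSpanSingleton k M e ∘ₗ C.counit)
    (h₂ : C.conv m g h = LinearMap.toSpanSingleton k M e ∘ₗ C.counit) : f = h := by
  rw [← C.conv_counit_right hr f, ← h₂, ← C.conv_assoc hm, h₁, C.conv_counit_left hl]

end Supercoalgebra

theorem toSpanSingleton_unit {M : Type*} [AddCommGroup M] [Module k M] (u : k →ₗ[k] M) :
    LinearMap.toSpanSingleton k M (u 1) = u := by ext; simp

variable {A : HopfOps k V}

namespace IsHopfSuperalgebra

theorem conv_antipode_left (hA : IsHopfSuperalgebra A) :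
    hA.coalg.conv A.mul A.antipode LinearMap.id =
      LinearMap.toSpanSingleton k V (A.unit 1) ∘ₗ A.counit := by
  rw [toSpanSingleton_unit]; exact hA.antipode_left

theorem conv_antipode_right (hA : IsHopfSuperalgebra A) :
    hA.coalg.conv A.mul LinearMap.id A.antipode =
      LinearMap.toSpanSingleton k V (A.unit 1) ∘ₗ A.counit := by
  rw [toSpanSingleton_unit]; exact hA.antipode_right

section

variable {U M : Type*} [AddCommGroup U] [Module k U] [Superspace k U] [AddCommGroup M] [Module k M]
  {C : Supercoalgebra k U} {p : U →ₗ[k] V} {m : M ⊗[k] M →ₗ[k] M} {i : V →ₗ[k] M}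

/-- The antipode axiom is pulled back along a coalgebra morphism `p` and pushed forward along a
multiplicative map `i`. It provides the inverses of the embedded projections of the double. -/
theorem conv_comp_antipode_left (hA : IsHopfSuperalgebra A) (hp : IsHom C hA.coalg p)
    (hi : ∀ a b, i (A.mul (a ⊗ₜ b)) = m (i a ⊗ₜ i b)) :
    C.conv m ((i ∘ₗ A.antipode) ∘ₗ p) (i ∘ₗ p) =
      LinearMap.toSpanSingleton k M (i (A.unit 1)) ∘ₗ C.counit := by
  have h := hp.conv m (i ∘ₗ A.antipode) (i ∘ₗ LinearMap.id)
  rw [← comp_conv _ hi, hA.conv_antipode_left] at h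
  refine h.symm.trans ?_
  rw [← hp.counit]
  ext a
  simp

theorem conv_comp_antipode_right (hA : IsHopfSuperalgebra A) (hp : IsHom C hA.coalg p)
    (hi : ∀ a b, i (A.mul (a ⊗ₜ b)) = m (i a ⊗ₜ i b)) :
    C.conv m (i ∘ₗ p) ((i ∘ₗ A.antipode) ∘ₗ p) =
      LinearMap.toSpanSingleton k M (i (A.unit 1)) ∘ₗ C.counit := by
  have h := hp.conv m (i ∘ₗ LinearMap.id) (i ∘ₗ A.antipode)
  rw [← comp_conv _ hi, hA.conv_antipode_right] at h
  refine h.symm.trans ?_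
  rw [← hp.counit]
  ext a
  simp

end

/-- The antipode of a Hopf superalgebra is an antimorphism of superalgebras. -/
theorem antipode_mul (hA : IsHopfSuperalgebra A) :
    A.antipode ∘ₗ A.mul = A.mul ∘ₗ TensorProduct.map A.antipode A.antipode ∘ₗ tau k V V := by
  set T := hA.coalg.tensor hA.coalg
  have h1 := isHom_fst hA.coalg hA.coalg
  have h2 := isHom_snd hA.coalg hA.coalg
  have e1 : A.mul = T.conv A.mul (fst V hA.coalg) (snd hA.coalg V) := by
    rw [conv, star_fst_snd, LinearMap.comp_id]
  have e2 : A.mul ∘ₗ TensorProduct.map A.antipode A.antipode ∘ₗ tau k V V =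
      T.conv A.mul (A.antipode ∘ₗ snd hA.coalg V) (A.antipode ∘ₗ fst V hA.coalg) := by
    rw [conv, ← Supercoalgebra.map_star, star_snd_fst]
  -- In the convolution algebra of maps `V ⊗ V → V`, the left side is a left inverse of `μ`. The
  -- right side is a right inverse: `μ` is the product of the two projections, and the right side is
  -- the product of their inverses in reverse order.
  refine T.conv_inverse_unique hA.mul_assoc hA.one_mul hA.mul_one (g := A.mul) ?_ ?_
  · have := hA.isHom_mul.conv A.mul A.antipode LinearMap.id
    rw [LinearMap.id_comp] at this
    rw [← this, hA.conv_antipode_left, LinearMap.comp_assoc]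
    exact congrArg _ hA.isHom_mul.counit
  · have h3 : T.conv A.mul (snd hA.coalg V) (A.antipode ∘ₗ snd hA.coalg V) =
        LinearMap.toSpanSingleton k V (A.unit 1) ∘ₗ T.counit := by
      have := h2.conv A.mul LinearMap.id A.antipode
      rw [LinearMap.id_comp, hA.conv_antipode_right] at this
      rw [← this, ← h2.counit]; rfl
    have h4 : T.conv A.mul (fst V hA.coalg) (A.antipode ∘ₗ fst V hA.coalg) =
        LinearMap.toSpanSingleton k V (A.unit 1) ∘ₗ T.counit := by
      have := h1.conv A.mul LinearMap.id A.antipode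
      rw [LinearMap.id_comp, hA.conv_antipode_right] at this
      rw [← this, ← h1.counit]; rfl
    rw [e2]
    nth_rw 2 [e1]
    rw [conv_assoc _ hA.mul_assoc, ← conv_assoc _ hA.mul_assoc (snd hA.coalg V), h3,
      conv_counit_left _ hA.one_mul, h4]

theorem antipode_one (hA : IsHopfSuperalgebra A) : A.antipode (A.unit 1) = A.unit 1 := by
  have := LinearMap.congr_fun hA.antipode_left (A.unit 1)
  simpa [hA.comul_one, hA.mul_one, hA.counit_one] using this

end IsHopfSuperalgebra

/-! ### The opposite Hopf superalgebra -/

/-- The opposite algebra with the same coalgebra, and with `Sinv` as antipode. -/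
def opOps (H : HopfOps k V) (Sinv : V →ₗ[k] V) : HopfOps k V where
  mul := H.mul ∘ₗ tau k V V
  unit := H.unit
  comul := H.comul
  counit := H.counit
  antipode := Sinv

variable {H : HopfOps k V} {Sinv : V →ₗ[k] V}

theorem opOps_mul_assoc (hH : IsHopfSuperalgebra H) (a b c : V) :
    (opOps H Sinv).mul ((opOps H Sinv).mul (a ⊗ₜ b) ⊗ₜ c) =
      (opOps H Sinv).mul (a ⊗ₜ (opOps H Sinv).mul (b ⊗ₜ c)) := by
  have : (opOps H Sinv).mul ∘ₗ LinearMap.rTensor V (opOps H Sinv).mul =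
      ((opOps H Sinv).mul ∘ₗ LinearMap.lTensor V (opOps H Sinv).mul) ∘ₗ
        (TensorProduct.assoc k V V V).toLinearMap := by
    refine tensor_ext_homog_left fun i j l a ha b hb c hc ↦ ?_
    have h1 := hH.even_mul _ _ (tmul_mem hb ha)
    have h2 := hH.even_mul _ _ (tmul_mem hc hb)
    simp only [opOps, LinearMap.comp_apply, LinearMap.rTensor_tmul, LinearMap.lTensor_tmul,
      LinearEquiv.coe_coe, TensorProduct.assoc_tmul, tau_tmul ha hb, tau_tmul hb hc, map_smul,
      ← TensorProduct.smul_tmul', TensorProduct.tmul_smul, tau_tmul h1 hc, tau_tmul ha h2,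
      hH.mul_assoc, sgn_add_left, sgn_add_right, smul_smul]
    congr 1
    ring
  exact LinearMap.congr_fun this ((a ⊗ₜ b) ⊗ₜ c)

theorem tau_unit_left (hH : IsHopfSuperalgebra H) (a : V) :
    tau k V V (H.unit 1 ⊗ₜ a) = a ⊗ₜ H.unit 1 := by
  change (tau k V V ∘ₗ TensorProduct.mk k V V (H.unit 1)) a = (TensorProduct.mk k V V).flip _ a
  congr 1
  refine linear_ext_homog fun i x hx ↦ ?_
  simp [tau_tmul (hH.even_unit 0 1 (mem_deg_field_zero _)) hx]

theorem tau_unit_right (hH : IsHopfSuperalgebra H) (a : V) :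
    tau k V V (a ⊗ₜ H.unit 1) = H.unit 1 ⊗ₜ a := by
  change (tau k V V ∘ₗ (TensorProduct.mk k V V).flip (H.unit 1)) a = TensorProduct.mk k V V _ a
  congr 1
  refine linear_ext_homog fun i x hx ↦ ?_
  simp [tau_tmul hx (hH.even_unit 0 1 (mem_deg_field_zero _))]

/-- The product `μ τ` is a composite of coalgebra morphisms. For the antipode axioms, apply the
injective map `S`: since `S μ τ = μ (S ⊗ S)`, the left axiom for `S⁻¹` becomes the right axiom for
`S`, and conversely. -/
theorem IsHopfSuperalgebra.op (hH : IsHopfSuperalgebra H)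
    (hS : H.antipode ∘ₗ Sinv = LinearMap.id) (hS' : Sinv ∘ₗ H.antipode = LinearMap.id) :
    IsHopfSuperalgebra (opOps H Sinv) := by
  have hτ := (isHom_tau hH.coalg hH.coalg)
  have hμ := hH.isHom_mul.comp hτ
  have hinj : Function.Injective H.antipode := fun a b hab ↦ by
    rw [← LinearMap.id_apply (R := k) a, ← hS', LinearMap.comp_apply, hab, ← LinearMap.comp_apply,
      hS', LinearMap.id_apply]
  have hcancel : ∀ {f g : V →ₗ[k] V}, H.antipode ∘ₗ f = H.antipode ∘ₗ g → f = g := fun h ↦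
    LinearMap.ext fun a ↦ hinj (LinearMap.congr_fun h a)
  have hSμ : H.antipode ∘ₗ H.mul ∘ₗ tau k V V =
      H.mul ∘ₗ TensorProduct.map H.antipode H.antipode := by
    rw [← LinearMap.comp_assoc, hH.antipode_mul, LinearMap.comp_assoc, LinearMap.comp_assoc,
      tau_tau, LinearMap.comp_id]
  have hSη : H.antipode ∘ₗ H.unit ∘ₗ H.counit = H.unit ∘ₗ H.counit := by
    rw [← LinearMap.comp_assoc]
    congr 1
    ext
    exact hH.antipode_one
  exact
  { even_mul := hμ.even
    even_unit := hH.even_unit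
    even_comul := hH.even_comul
    even_counit := hH.even_counit
    mul_assoc := opOps_mul_assoc hH
    one_mul := fun a ↦ by simp [opOps, tau_unit_left hH, hH.mul_one]
    mul_one := fun a ↦ by simp [opOps, tau_unit_right hH, hH.one_mul]
    coassoc := hH.coassoc
    counit_comul := hH.counit_comul
    comul_counit := hH.comul_counit
    comul_mul := hμ.comul
    comul_one := hH.comul_one
    counit_mul := fun a b ↦ by
      have := LinearMap.congr_fun hμ.counit (a ⊗ₜ b)
      rwa [tensor_counit_tmul] at this
    counit_one := hH.counit_one
    even_antipode := by
      let e : V ≃ₗ[k] V := LinearEquiv.ofLinearMap H.antipode Sinv hS hS'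
      exact IsEven.symm (e := e) hH.even_antipode
    antipode_left := by
      refine hcancel ?_
      change H.antipode ∘ₗ (H.mul ∘ₗ tau k V V) ∘ₗ TensorProduct.map Sinv LinearMap.id ∘ₗ H.comul
        = H.antipode ∘ₗ H.unit ∘ₗ H.counit
      rw [← LinearMap.comp_assoc, hSμ, hSη, LinearMap.comp_assoc,
        ← LinearMap.comp_assoc _ _ (TensorProduct.map _ _), ← TensorProduct.map_comp, hS,
        LinearMap.comp_id, hH.antipode_right]
    antipode_right := by
      refine hcancel ?_
      change H.antipode ∘ₗ (H.mul ∘ₗ tau k V V) ∘ₗ TensorProduct.map LinearMap.id Sinv ∘ₗ H.comul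
        = H.antipode ∘ₗ H.unit ∘ₗ H.counit
      rw [← LinearMap.comp_assoc, hSμ, hSη, LinearMap.comp_assoc,
        ← LinearMap.comp_assoc _ _ (TensorProduct.map _ _), ← TensorProduct.map_comp, hS,
        LinearMap.comp_id, hH.antipode_left] }

end Antipode

open Supercoalgebra

/-! ### Compatibility of `λ` with even maps, the flip, associativity and the middle swap. -/

section Lam

variable {k : Type*} [Field k]
variable {A B C D A' B' : Type*} [AddCommGroup A] [Module k A] [AddCommGroup B] [Module k B]
  [AddCommGroup C] [Module k C] [AddCommGroup D] [Module k D]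
  [AddCommGroup A'] [Module k A'] [AddCommGroup B'] [Module k B']
variable [Superspace k A] [Superspace k B] [Superspace k C] [Superspace k D]
  [Superspace k A'] [Superspace k B']

theorem dual_apply_eq_zero {i j : ZMod 2} {f : Module.Dual k A} {a : A}
    (hf : f ∈ deg k (Module.Dual k A) i) (ha : a ∈ deg k A j) (h : ¬ j = i) : f a = 0 := by
  rw [mem_deg_dual] at hf
  refine hf a ?_
  have : j = i + 1 := zmod2_eq_add_one (i := j) (j := i) (fun h' ↦ h h'.symm)
  exact this ▸ ha

variable [FiniteDimensional k A] [FiniteDimensional k B] [FiniteDimensional k C]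
  [FiniteDimensional k D] [FiniteDimensional k A'] [FiniteDimensional k B']

theorem isEven_lam : IsEven (V := Module.Dual k A ⊗[k] Module.Dual k B)
    (W := Module.Dual k (A ⊗[k] B)) (lam k A B).toLinearMap := by
  refine isEven_tensor fun i j f hf g hg ↦ ?_
  rw [mem_deg_dual]
  intro t ht
  refine Submodule.span_induction (p := fun t _ ↦ lam k A B (f ⊗ₜ g) t = 0) ?_ (map_zero _)
    (fun x y _ _ hx hy ↦ by rw [map_add, hx, hy, add_zero])
    (fun c x _ hx ↦ by rw [map_smul, hx, smul_zero]) ht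
  rintro _ ⟨p, q, hpq, a, ha, b, hb, rfl⟩
  rw [lam_tmul_apply f b ha hg]
  by_cases h1 : p = i
  · by_cases h2 : q = j
    · subst h1 h2; exact absurd hpq (by clear * -; revert p q; decide)
    · rw [dual_apply_eq_zero hg hb h2]; simp
  · rw [dual_apply_eq_zero hf ha h1]; simp

theorem lam_mem {i j : ZMod 2} {f : Module.Dual k A} {g : Module.Dual k B}
    (hf : f ∈ deg k (Module.Dual k A) i) (hg : g ∈ deg k (Module.Dual k B) j) :
    lam k A B (f ⊗ₜ g) ∈ deg k (Module.Dual k (A ⊗[k] B)) (i + j) :=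
  isEven_lam (i + j) _ (tmul_mem hf hg)

theorem lam_map {f : A →ₗ[k] A'} {g : B →ₗ[k] B'} (hf : IsEven f) (hg : IsEven g) :
    (lam k A B).toLinearMap ∘ₗ
        TensorProduct.map (Module.Dual.transpose (R := k) f) (Module.Dual.transpose (R := k) g) =
      Module.Dual.transpose (R := k) (TensorProduct.map f g) ∘ₗ (lam k A' B').toLinearMap := by
  refine tensor_ext_homog fun i j φ hφ ψ hψ ↦ tensor_ext_homog fun l m a ha b hb ↦ ?_
  have h : ψ ∘ₗ g ∈ deg k (Module.Dual k B) j := hg.transpose _ _ hψ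
  simp only [LinearMap.comp_apply, TensorProduct.map_tmul, LinearEquiv.coe_coe,
    Module.Dual.transpose_apply, lam_tmul_apply _ _ ha h, lam_tmul_apply _ _ (hf _ _ ha) hψ]

theorem lam_tau : (lam k A B).toLinearMap ∘ₗ tau k (Module.Dual k B) (Module.Dual k A) =
      Module.Dual.transpose (R := k) (tau k A B) ∘ₗ (lam k B A).toLinearMap := by
  refine tensor_ext_homog fun i j φ hφ ψ hψ ↦ tensor_ext_homog fun l m a ha b hb ↦ ?_
  simp only [LinearMap.comp_apply, tau_tmul hφ hψ, LinearEquiv.coe_coe, map_smul,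
    Module.Dual.transpose_apply, LinearMap.smul_apply, lam_tmul_apply _ _ ha hφ, tau_tmul ha hb,
    lam_tmul_apply _ _ hb hψ, smul_eq_mul]
  by_cases h1 : m = i
  · by_cases h2 : l = j
    · subst h1 h2; rw [sgn_comm k m l]; ring
    · rw [dual_apply_eq_zero hψ ha h2]; simp
  · rw [dual_apply_eq_zero hφ hb h1]; simp

theorem lam_assoc : (lam k (A ⊗[k] B) C).toLinearMap ∘ₗ
      TensorProduct.map (lam k A B).toLinearMap LinearMap.id =
    Module.Dual.transpose (R := k) (TensorProduct.assoc k A B C).toLinearMap ∘ₗ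
      (lam k A (B ⊗[k] C)).toLinearMap ∘ₗ
      TensorProduct.map LinearMap.id (lam k B C).toLinearMap ∘ₗ
      (TensorProduct.assoc k _ _ _).toLinearMap := by
  refine tensor_ext_homog_left fun i j l f hf g hg h hh ↦
    tensor_ext_homog_left fun p q r a ha b hb c hc ↦ ?_
  have h1 := lam_mem hg hh
  simp only [LinearMap.comp_apply, TensorProduct.map_tmul, LinearMap.id_apply,
    LinearEquiv.coe_coe, TensorProduct.assoc_tmul, Module.Dual.transpose_apply,
    lam_tmul_apply _ _ (tmul_mem ha hb) hh, lam_tmul_apply _ _ ha hg, lam_tmul_apply _ _ ha h1,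
    lam_tmul_apply _ _ hb hh, sgn_add_left, sgn_add_right]
  ring

/-- Together with `lam_map`, `lam_assoc` and `lam_tau`, this says that duality is compatible with
the symmetric monoidal structure of finite-dimensional superspaces. It dualizes the compatibility of
product and coproduct. -/
theorem lam_middleSwap : (lam k (A ⊗[k] B) (C ⊗[k] D)).toLinearMap ∘ₗ
      TensorProduct.map (lam k A B).toLinearMap (lam k C D).toLinearMap ∘ₗ
      middleSwap k (Module.Dual k A) (Module.Dual k C) (Module.Dual k B) (Module.Dual k D) =
    Module.Dual.transpose (R := k) (middleSwap k A B C D) ∘ₗ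
      (lam k (A ⊗[k] C) (B ⊗[k] D)).toLinearMap ∘ₗ
      TensorProduct.map (lam k A C).toLinearMap (lam k B D).toLinearMap := by
  refine tensor_ext_homog_four fun i j l m f hf g hg f' hf' g' hg' ↦
    tensor_ext_homog_four fun p q r n a ha b hb c hc d hd ↦ ?_
  have h1 := lam_mem hg hg'
  have h2 := lam_mem hf' hg'
  simp only [LinearMap.comp_apply, TensorProduct.map_tmul, LinearEquiv.coe_coe,
    Module.Dual.transpose_apply, middleSwap_tmul _ _ hg hf', middleSwap_tmul _ _ hb hc, map_smul,
    LinearMap.smul_apply, lam_tmul_apply _ _ (tmul_mem ha hb) h1,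
    lam_tmul_apply _ _ (tmul_mem ha hc) h2, lam_tmul_apply _ _ ha hf', lam_tmul_apply _ _ ha hg,
    lam_tmul_apply _ _ hb hg', lam_tmul_apply _ _ hc hg', smul_eq_mul, sgn_add_left,
    sgn_add_right]
  -- One side has a sign in the degrees of functionals, the other in those of vectors. They agree
  -- when the degrees match, and otherwise both sides vanish.
  by_cases e1 : r = j
  · by_cases e2 : q = l
    · subst e1 e2; rw [sgn_comm k r q]; ring
    · rw [dual_apply_eq_zero hf' hb e2]; simp
  · rw [dual_apply_eq_zero hg hc e1]; simp

theorem lam_tmul_of_even {f : Module.Dual k A} (hf : f ∈ deg k (Module.Dual k A) 0)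
    (g : Module.Dual k B) (a : A) (b : B) : lam k A B (f ⊗ₜ g) (a ⊗ₜ b) = f a * g b := by
  refine LinearMap.congr_fun (f := Module.Dual.eval k _ (a ⊗ₜ b) ∘ₗ (lam k A B).toLinearMap ∘ₗ
    TensorProduct.mk k _ _ f) (g := f a • Module.Dual.eval k B b)
    (linear_ext_homog fun i g hg ↦ ?_) g
  simp [lam, signTwist_tmul hf hg]

theorem lam_tmul_of_even' (f : Module.Dual k A) {g : Module.Dual k B}
    (hg : g ∈ deg k (Module.Dual k B) 0) (a : A) (b : B) :
    lam k A B (f ⊗ₜ g) (a ⊗ₜ b) = f a * g b := by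
  rw [← proj_add (k := k) a, TensorProduct.add_tmul, map_add, map_add,
    lam_tmul_apply _ _ (proj_mem _ _) hg, lam_tmul_apply _ _ (proj_mem _ _) hg]
  simp [add_mul]

/-- Against an even vector `λ` has no sign. With the vector `1`, this reduces the counit axioms of
the dual to the unit axioms. -/
theorem lam_apply_even_tmul {a : A} (ha : a ∈ deg k A 0)
    (t : Module.Dual k A ⊗[k] Module.Dual k B) (b : B) :
    lam k A B t (a ⊗ₜ b) = TensorProduct.lid k (Module.Dual k B)
      (LinearMap.rTensor _ (Module.Dual.eval k A a) t) b := by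
  refine LinearMap.congr_fun (f := (Module.Dual.eval k _ (a ⊗ₜ b)) ∘ₗ (lam k A B).toLinearMap)
    (g := (Module.Dual.eval k _ b) ∘ₗ (TensorProduct.lid k (Module.Dual k B)).toLinearMap ∘ₗ
      (LinearMap.rTensor _ (Module.Dual.eval k A a))) ?_ t
  refine tensor_ext_homog fun i j f hf g hg ↦ ?_
  simp [lam_tmul_apply _ _ ha hg]

theorem lam_apply_tmul_even {b : B} (hb : b ∈ deg k B 0)
    (t : Module.Dual k A ⊗[k] Module.Dual k B) (a : A) :
    lam k A B t (a ⊗ₜ b) = TensorProduct.rid k (Module.Dual k A)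
      (LinearMap.lTensor _ (Module.Dual.eval k B b) t) a := by
  refine LinearMap.congr_fun (f := (Module.Dual.eval k _ (a ⊗ₜ b)) ∘ₗ (lam k A B).toLinearMap)
    (g := (Module.Dual.eval k _ a) ∘ₗ (TensorProduct.rid k (Module.Dual k A)).toLinearMap ∘ₗ
      (LinearMap.lTensor _ (Module.Dual.eval k B b))) ?_ t
  refine tensor_ext_homog fun i j f hf g hg ↦ ?_
  rcases zmod2_cases j with rfl | rfl
  · simp [lam_tmul_of_even' f hg, mul_comm]
  · have h0 : g b = 0 := dual_apply_eq_zero hg hb (by decide)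
    have : (0 : k) = lam k A B (f ⊗ₜ g) (a ⊗ₜ b) := by
      rw [← proj_add (k := k) a, TensorProduct.add_tmul, map_add,
        lam_tmul_apply _ _ (proj_mem _ _) hg, lam_tmul_apply _ _ (proj_mem _ _) hg, h0]
      simp
    simp [h0, ← this]

end Lam

/-! ### The dual of a finite-dimensional Hopf superalgebra. -/

section Dual

variable {k : Type*} [Field k]
variable {V : Type*} [AddCommGroup V] [Module k V] [Superspace k V] [FiniteDimensional k V]

/-- The dual of a finite-dimensional Hopf superalgebra. -/
def dualOps (H : HopfOps k V) : HopfOps k (Module.Dual k V) where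
  mul := Module.Dual.transpose (R := k) H.comul ∘ₗ (lam k V V).toLinearMap
  unit := Module.Dual.transpose (R := k) H.counit ∘ₗ LinearMap.mul k k
  comul := (lam k V V).symm.toLinearMap ∘ₗ Module.Dual.transpose (R := k) H.mul
  counit := Module.Dual.eval k k 1 ∘ₗ Module.Dual.transpose (R := k) H.unit
  antipode := Module.Dual.transpose (R := k) H.antipode

variable {H : HopfOps k V}

/-- It eliminates `λ⁻¹`: identities for the dual coproduct are tested after applying the injective
map `λ`. -/
theorem lam_dualOps_comul :
    (lam k V V).toLinearMap ∘ₗ (dualOps H).comul = Module.Dual.transpose (R := k) H.mul := by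
  ext f : 1
  exact (lam k V V).apply_symm_apply _

theorem dualOps_mul_apply (t : Module.Dual k V ⊗[k] Module.Dual k V) (a : V) :
    (dualOps H).mul t a = lam k V V t (H.comul a) := rfl

theorem dualOps_unit : (dualOps H).unit 1 = H.counit := by
  ext a; simp [dualOps, Module.Dual.transpose_apply]

theorem dualOps_counit : (dualOps H).counit = Module.Dual.eval k V (H.unit 1) := rfl

theorem transpose_comp' {A B C : Type*} [AddCommGroup A] [Module k A] [AddCommGroup B] [Module k B]
    [AddCommGroup C] [Module k C] (f : A →ₗ[k] B) (g : B →ₗ[k] C) :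
    Module.Dual.transpose (R := k) f ∘ₗ Module.Dual.transpose (R := k) g =
      Module.Dual.transpose (R := k) (g ∘ₗ f) := rfl

theorem transpose_injective {A B : Type*} [AddCommGroup A] [Module k A] [AddCommGroup B]
    [Module k B] {f g : A →ₗ[k] B}
    (h : Module.Dual.transpose (R := k) f = Module.Dual.transpose (R := k) g) : f = g := by
  ext a
  rw [← sub_eq_zero, ← Module.forall_dual_apply_eq_zero_iff k]
  intro φ
  rw [map_sub, sub_eq_zero]
  exact LinearMap.congr_fun (LinearMap.congr_fun h φ) a

theorem isEven_transpose_unit_eval (hH : IsHopfSuperalgebra H) : IsEven (dualOps H).counit := by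
  rw [isEven_field_iff]
  intro f hf
  change f (H.unit 1) = 0
  exact dual_apply_eq_zero hf (hH.even_unit 0 1 (mem_deg_field_zero _)) (by decide)

omit [FiniteDimensional k V] in
theorem counit_mem_deg_zero (hH : IsHopfSuperalgebra H) :
    H.counit ∈ deg k (Module.Dual k V) 0 := by
  rw [mem_deg_dual]
  exact fun v hv ↦ isEven_field_iff.1 hH.even_counit v hv

/-- The transpose of coassociativity. Naturality of `λ` brings the transposed coproducts to the
outside, and `lam_assoc` compares the two bracketings. -/
theorem dualOps_mul_assoc (hH : IsHopfSuperalgebra H) :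
    (dualOps H).mul ∘ₗ TensorProduct.map (dualOps H).mul LinearMap.id =
      (dualOps H).mul ∘ₗ TensorProduct.map LinearMap.id (dualOps H).mul ∘ₗ
        (TensorProduct.assoc k _ _ _).toLinearMap := by
  have e : (TensorProduct.map (dualOps H).mul LinearMap.id : _ →ₗ[k] _ ⊗[k] Module.Dual k V) =
      TensorProduct.map (Module.Dual.transpose (R := k) H.comul)
        (Module.Dual.transpose (R := k) LinearMap.id) ∘ₗ
      TensorProduct.map (lam k V V).toLinearMap LinearMap.id := by
    rw [← TensorProduct.map_comp]; rfl
  have e' : (TensorProduct.map LinearMap.id (dualOps H).mul : _ →ₗ[k] Module.Dual k V ⊗[k] _) =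
      TensorProduct.map (Module.Dual.transpose (R := k) LinearMap.id)
        (Module.Dual.transpose (R := k) H.comul) ∘ₗ
      TensorProduct.map LinearMap.id (lam k V V).toLinearMap := by
    rw [← TensorProduct.map_comp]; rfl
  have hc := congrArg (Module.Dual.transpose (R := k)) hH.coassoc
  rw [e, e']
  change (Module.Dual.transpose (R := k) H.comul ∘ₗ (lam k V V).toLinearMap) ∘ₗ _ =
    (Module.Dual.transpose (R := k) H.comul ∘ₗ (lam k V V).toLinearMap) ∘ₗ _
  rw [LinearMap.comp_assoc, ← LinearMap.comp_assoc _ _ (lam k V V).toLinearMap,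
    lam_map hH.even_comul IsEven.id, LinearMap.comp_assoc, lam_assoc]
  rw [LinearMap.comp_assoc, LinearMap.comp_assoc,
    ← LinearMap.comp_assoc _ _ (lam k V V).toLinearMap, lam_map IsEven.id hH.even_comul]
  simp only [← LinearMap.comp_assoc]
  congr 3

theorem dualOps_coassoc (hH : IsHopfSuperalgebra H) :
    (TensorProduct.assoc k _ _ _).toLinearMap ∘ₗ
      TensorProduct.map (dualOps H).comul LinearMap.id ∘ₗ (dualOps H).comul =
      TensorProduct.map LinearMap.id (dualOps H).comul ∘ₗ (dualOps H).comul := by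
  have hE : Function.Injective ((lam k V (V ⊗[k] V)).toLinearMap ∘ₗ
      TensorProduct.map LinearMap.id (lam k V V).toLinearMap) := by
    rw [LinearMap.coe_comp]
    exact (lam k V (V ⊗[k] V)).injective.comp
      (TensorProduct.congr (LinearEquiv.refl k (Module.Dual k V)) (lam k V V)).injective
  have hcan : ∀ {f g : Module.Dual k V →ₗ[k] _}, ((lam k V (V ⊗[k] V)).toLinearMap ∘ₗ
      TensorProduct.map LinearMap.id (lam k V V).toLinearMap) ∘ₗ f =
      ((lam k V (V ⊗[k] V)).toLinearMap ∘ₗ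
      TensorProduct.map LinearMap.id (lam k V V).toLinearMap) ∘ₗ g → f = g := fun hfg ↦
    LinearMap.ext fun x ↦ hE (LinearMap.congr_fun hfg x)
  have ha : ((lam k V (V ⊗[k] V)).toLinearMap ∘ₗ
      TensorProduct.map LinearMap.id (lam k V V).toLinearMap) ∘ₗ
      (TensorProduct.assoc k _ _ _).toLinearMap =
      Module.Dual.transpose (R := k) (TensorProduct.assoc k V V V).symm.toLinearMap ∘ₗ
      (lam k (V ⊗[k] V) V).toLinearMap ∘ₗ
        TensorProduct.map (lam k V V).toLinearMap LinearMap.id := by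
    rw [lam_assoc, ← LinearMap.comp_assoc, transpose_comp', LinearEquiv.comp_symm]
    rfl
  refine hcan ?_
  rw [← LinearMap.comp_assoc, ha, LinearMap.comp_assoc, LinearMap.comp_assoc,
    ← LinearMap.comp_assoc _ _ (TensorProduct.map _ _), ← TensorProduct.map_comp,
    lam_dualOps_comul, LinearMap.comp_assoc,
    ← LinearMap.comp_assoc _ _ (TensorProduct.map _ _), ← TensorProduct.map_comp,
    lam_dualOps_comul, LinearMap.comp_id]
  have i1 := lam_map (A' := V) (B' := V) hH.even_mul (IsEven.id (A := V))
  have i2 := lam_map (A' := V) (B' := V) (IsEven.id (A := V)) hH.even_mul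
  rw [← LinearMap.comp_assoc _ _ (lam k (V ⊗[k] V) V).toLinearMap,
    ← LinearMap.comp_assoc _ _ (lam k V (V ⊗[k] V)).toLinearMap]
  have i3 : Module.Dual.transpose (R := k) (LinearMap.id : V →ₗ[k] V) = LinearMap.id := rfl
  rw [i3] at i1 i2
  rw [i1, i2, LinearMap.comp_assoc, LinearMap.comp_assoc, lam_dualOps_comul, transpose_comp',
    transpose_comp', transpose_comp']
  congr 1
  exact TensorProduct.ext (LinearMap.ext fun a ↦ TensorProduct.ext' fun b c ↦
    hH.mul_assoc a b c)

/-- This axiom is self-dual: after applying `λ`, both sides are transposes of the two sides of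
`comul_mul` for `H`, with `lam_middleSwap` carrying the signs. -/
theorem dualOps_comul_mul (hH : IsHopfSuperalgebra H) :
    (dualOps H).comul ∘ₗ (dualOps H).mul =
      TensorProduct.map (dualOps H).mul (dualOps H).mul ∘ₗ
        tensorComul (dualOps H).toBialgOps (dualOps H).toBialgOps := by
  have hl : ∀ {f g : Module.Dual k V ⊗[k] Module.Dual k V →ₗ[k] _},
      (lam k V V).toLinearMap ∘ₗ f = (lam k V V).toLinearMap ∘ₗ g → f = g := fun hfg ↦
    LinearMap.ext fun x ↦ (lam k V V).injective (LinearMap.congr_fun hfg x)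
  refine hl ?_
  have e2 : TensorProduct.map (dualOps H).mul (dualOps H).mul =
      TensorProduct.map (Module.Dual.transpose (R := k) H.comul)
        (Module.Dual.transpose (R := k) H.comul) ∘ₗ
      TensorProduct.map (lam k V V).toLinearMap (lam k V V).toLinearMap := by
    rw [← TensorProduct.map_comp]; rfl
  have e3 : TensorProduct.map (lam k V V).toLinearMap (lam k V V).toLinearMap ∘ₗ
      TensorProduct.map (dualOps H).comul (dualOps H).comul =
      TensorProduct.map (Module.Dual.transpose (R := k) H.mul)
        (Module.Dual.transpose (R := k) H.mul) := by
    rw [← TensorProduct.map_comp, lam_dualOps_comul]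
  rw [← LinearMap.comp_assoc, lam_dualOps_comul, e2]
  change _ = (lam k V V).toLinearMap ∘ₗ (_ ∘ₗ _) ∘ₗ middleSwap k _ _ _ _ ∘ₗ _
  rw [LinearMap.comp_assoc, ← LinearMap.comp_assoc _ _ (lam k V V).toLinearMap,
    lam_map hH.even_comul hH.even_comul, LinearMap.comp_assoc,
    ← LinearMap.comp_assoc _ (middleSwap k _ _ _ _),
    ← LinearMap.comp_assoc _ _ (lam k (V ⊗[k] V) (V ⊗[k] V)).toLinearMap,
    lam_middleSwap, LinearMap.comp_assoc, LinearMap.comp_assoc, e3,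
    lam_map hH.even_mul hH.even_mul]
  change Module.Dual.transpose (R := k) H.mul ∘ₗ Module.Dual.transpose (R := k) H.comul ∘ₗ _ = _
  simp only [← LinearMap.comp_assoc, transpose_comp']
  rw [hH.comul_mul]
  rfl

theorem dualOps_comul_one (hH : IsHopfSuperalgebra H) :
    (dualOps H).comul ((dualOps H).unit 1) = (dualOps H).unit 1 ⊗ₜ (dualOps H).unit 1 := by
  rw [dualOps_unit]
  have h : lam k V V ((dualOps H).comul H.counit) = H.counit ∘ₗ H.mul :=
    LinearMap.congr_fun lam_dualOps_comul _
  have h' : lam k V V (H.counit ⊗ₜ H.counit) = H.counit ∘ₗ H.mul :=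
    TensorProduct.ext' fun a b ↦ by
      rw [lam_tmul_of_even (counit_mem_deg_zero hH), LinearMap.comp_apply, hH.counit_mul]
  exact (lam k V V).injective (h.trans h'.symm)

/-- Transposition preserves convolution of even endomorphisms, so the antipode axioms pass to the
dual unchanged. -/
theorem dualOps_conv_transpose {f g : V →ₗ[k] V} (hf : IsEven f) (hg : IsEven g) :
    (dualOps H).mul ∘ₗ TensorProduct.map (Module.Dual.transpose (R := k) f)
        (Module.Dual.transpose (R := k) g) ∘ₗ (dualOps H).comul =
      Module.Dual.transpose (R := k) (H.mul ∘ₗ TensorProduct.map f g ∘ₗ H.comul) := by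
  change (Module.Dual.transpose (R := k) H.comul ∘ₗ (lam k V V).toLinearMap) ∘ₗ _ = _
  rw [LinearMap.comp_assoc, ← LinearMap.comp_assoc _ _ (lam k V V).toLinearMap, lam_map hf hg,
    LinearMap.comp_assoc, lam_dualOps_comul]
  rfl

theorem dualOps_unit_comp_counit : (dualOps H).unit ∘ₗ (dualOps H).counit =
    Module.Dual.transpose (R := k) (H.unit ∘ₗ H.counit) := by
  ext f a
  have : H.unit (H.counit a) = H.counit a • H.unit 1 := by rw [← map_smul]; simp
  simp [dualOps, Module.Dual.transpose_apply, this, mul_comm]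

theorem transpose_id {A : Type*} [AddCommGroup A] [Module k A] :
    Module.Dual.transpose (R := k) (LinearMap.id : A →ₗ[k] A) = LinearMap.id := rfl

theorem dualOps_antipode : (dualOps H).antipode = Module.Dual.transpose (R := k) H.antipode := rfl

theorem dualOps_antipode_left (hH : IsHopfSuperalgebra H) : (dualOps H).mul ∘ₗ
    TensorProduct.map (dualOps H).antipode LinearMap.id ∘ₗ (dualOps H).comul =
      (dualOps H).unit ∘ₗ (dualOps H).counit := by
  rw [dualOps_unit_comp_counit, ← hH.antipode_left, ← dualOps_conv_transpose hH.even_antipode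
    IsEven.id, transpose_id, dualOps_antipode]

theorem dualOps_antipode_right (hH : IsHopfSuperalgebra H) : (dualOps H).mul ∘ₗ
    TensorProduct.map LinearMap.id (dualOps H).antipode ∘ₗ (dualOps H).comul =
      (dualOps H).unit ∘ₗ (dualOps H).counit := by
  rw [dualOps_unit_comp_counit, ← hH.antipode_right, ← dualOps_conv_transpose IsEven.id
    hH.even_antipode, transpose_id, dualOps_antipode]

theorem IsHopfSuperalgebra.dual (hH : IsHopfSuperalgebra H) :
    IsHopfSuperalgebra (dualOps H) := by
  have h1 := hH.even_unit 0 1 (mem_deg_field_zero _)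
  exact
  { even_mul := hH.even_comul.transpose.comp isEven_lam
    even_unit := isEven_of_apply_one (by rw [dualOps_unit]; exact counit_mem_deg_zero hH)
    even_comul := isEven_lam.symm.comp hH.even_mul.transpose
    even_counit := isEven_transpose_unit_eval hH
    mul_assoc := fun a b c ↦ LinearMap.congr_fun (dualOps_mul_assoc hH) ((a ⊗ₜ b) ⊗ₜ c)
    one_mul := fun f ↦ by
      rw [dualOps_unit]
      ext a
      rw [dualOps_mul_apply]
      have : lam k V V (H.counit ⊗ₜ f) = f ∘ₗ (TensorProduct.lid k V).toLinearMap ∘ₗ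
          LinearMap.rTensor V H.counit := TensorProduct.ext' fun a b ↦ by
        simp [lam_tmul_of_even (counit_mem_deg_zero hH)]
      rw [this]
      exact congrArg f (hH.counit_comul a)
    mul_one := fun f ↦ by
      rw [dualOps_unit]
      ext a
      rw [dualOps_mul_apply]
      have : lam k V V (f ⊗ₜ H.counit) = f ∘ₗ (TensorProduct.rid k V).toLinearMap ∘ₗ
          LinearMap.lTensor V H.counit := TensorProduct.ext' fun a b ↦ by
        simp [lam_tmul_of_even' _ (counit_mem_deg_zero hH), mul_comm]
      rw [this]
      exact congrArg f (hH.comul_counit a)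
    coassoc := dualOps_coassoc hH
    counit_comul := fun f ↦ by
      ext a
      rw [dualOps_counit, ← lam_apply_even_tmul h1]
      exact (LinearMap.congr_fun (LinearMap.congr_fun lam_dualOps_comul f) _).trans
        (congrArg f (hH.one_mul a))
    comul_counit := fun f ↦ by
      ext a
      rw [dualOps_counit, ← lam_apply_tmul_even h1]
      exact (LinearMap.congr_fun (LinearMap.congr_fun lam_dualOps_comul f) _).trans
        (congrArg f (hH.mul_one a))
    comul_mul := dualOps_comul_mul hH
    comul_one := dualOps_comul_one hH
    counit_mul := fun f g ↦ by
      rw [dualOps_counit, Module.Dual.eval_apply, dualOps_mul_apply, hH.comul_one,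
        lam_apply_even_tmul h1]
      simp
    counit_one := by
      rw [dualOps_unit, dualOps_counit]; exact hH.counit_one
    even_antipode := hH.even_antipode.transpose
    antipode_left := dualOps_antipode_left hH
    antipode_right := dualOps_antipode_right hH }

/-- The antipode of a finite-dimensional Hopf superalgebra is an antimorphism of
supercoalgebras. -/
theorem IsHopfSuperalgebra.antipode_comul (hH : IsHopfSuperalgebra H) :
    H.comul ∘ₗ H.antipode = TensorProduct.map H.antipode H.antipode ∘ₗ tau k V V ∘ₗ H.comul := by
  refine transpose_injective ?_
  -- The statement is the transpose of antimultiplicativity of the antipode of the dual; finite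
  -- dimension enters through `λ`, whose surjectivity is used at the end to cancel it.
  have h := hH.dual.antipode_mul
  change Module.Dual.transpose (R := k) H.antipode ∘ₗ Module.Dual.transpose (R := k) H.comul ∘ₗ
    (lam k V V).toLinearMap = (Module.Dual.transpose (R := k) H.comul ∘ₗ
    (lam k V V).toLinearMap) ∘ₗ TensorProduct.map (Module.Dual.transpose (R := k) H.antipode)
      (Module.Dual.transpose (R := k) H.antipode) ∘ₗ tau k _ _ at h
  rw [LinearMap.comp_assoc, ← LinearMap.comp_assoc _ _ (lam k V V).toLinearMap,
    lam_map hH.even_antipode hH.even_antipode, LinearMap.comp_assoc, lam_tau] at h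
  simp only [← LinearMap.comp_assoc, transpose_comp'] at h
  rw [← LinearMap.comp_assoc _ _ (TensorProduct.map _ _),
    ← tau_map hH.even_antipode hH.even_antipode]
  refine LinearMap.ext fun φ ↦ ?_
  have := LinearMap.congr_fun h ((lam k V V).symm φ)
  simpa only [LinearMap.comp_apply, LinearEquiv.coe_coe, LinearEquiv.apply_symm_apply] using this

end Dual

open Supercoalgebra

/-! ### The bicrossed product defined by an exchange map. -/

section Bicrossed

variable {k : Type*} [Field k]
variable {V W : Type*} [AddCommGroup V] [Module k V] [AddCommGroup W] [Module k W]
variable [Superspace k V] [Superspace k W]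
variable {A : HopfOps k V} {X : HopfOps k W}

/-- The bicrossed product defined by the actions `a · x = (id ⊗ ε) R(a ⊗ x)` and
`a ^ x = (ε ⊗ id) R(a ⊗ x)`. -/
def twistedProduct (hA : IsHopfSuperalgebra A) (hX : IsHopfSuperalgebra X)
    (R : V ⊗[k] W →ₗ[k] W ⊗[k] V) : HopfOps k (W ⊗[k] V) :=
  bicrossed X A (fst W hA.coalg ∘ₗ R) (snd hX.coalg V ∘ₗ R)

variable {hA : IsHopfSuperalgebra A} {hX : IsHopfSuperalgebra X} {R : V ⊗[k] W →ₗ[k] W ⊗[k] V}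

namespace IsExchangeMap

variable (h : IsExchangeMap hA.toIsSuperbialgebra hX.toIsSuperbialgebra R)
include h

theorem twistedProduct_mul : (twistedProduct hA hX R).mul =
    TensorProduct.map X.mul A.mul ∘ₗ
    (TensorProduct.assoc k W W (V ⊗[k] V)).symm.toLinearMap ∘ₗ
    TensorProduct.map LinearMap.id ((TensorProduct.assoc k W V V).toLinearMap ∘ₗ
      TensorProduct.map R LinearMap.id ∘ₗ (TensorProduct.assoc k V W V).symm.toLinearMap) ∘ₗ
    (TensorProduct.assoc k W V (W ⊗[k] V)).toLinearMap := by
  have e := h.map_comp_tensorComul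
  rw [twistedProduct, bicrossed, e]
  rfl

/-- The product is composed of `R`, the two products and associators, all of them supercoalgebra
morphisms. Multiplicativity of `Δ` and `ε` is thereby obtained without a computation. -/
theorem isHom_twistedProduct_mul :
    IsHom ((hX.coalg.tensor hA.coalg).tensor (hX.coalg.tensor hA.coalg))
      (hX.coalg.tensor hA.coalg) (twistedProduct hA hX R).mul := by
  rw [h.twistedProduct_mul]
  refine (hX.isHom_mul.map hA.isHom_mul).comp ((isHom_assoc _ _ _).symm.comp
    ((IsHom.id.map ((isHom_assoc _ _ _).comp
      ((h.isHom.map IsHom.id).comp (isHom_assoc _ _ _).symm))).comp (isHom_assoc _ _ _)))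

theorem twistedProduct_mul_tmul (x y : W) (a b : V) :
    (twistedProduct hA hX R).mul ((x ⊗ₜ a) ⊗ₜ (y ⊗ₜ b)) =
      TensorProduct.map (X.mul ∘ₗ TensorProduct.mk k W W x)
        (A.mul ∘ₗ (TensorProduct.mk k V V).flip b) (R (a ⊗ₜ y)) := by
  rw [h.twistedProduct_mul]
  simp only [LinearMap.comp_apply, LinearEquiv.coe_coe, TensorProduct.assoc_tmul,
    TensorProduct.map_tmul, LinearMap.id_apply, TensorProduct.assoc_symm_tmul]
  induction R (a ⊗ₜ y) with
  | zero => simp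
  | add u v hu hv => simp only [TensorProduct.add_tmul, TensorProduct.tmul_add, map_add, hu, hv]
  | tmul z c => simp

/-- In either bracketing of `(x ⊗ a)(y ⊗ b)(z ⊗ c)`, expand `R(a ⊗ y)` and `R(b ⊗ z)`. The rules for
`R` on products leave the same single crossing, of the `V`-leg of the first past the `W`-leg of the
second. -/
theorem twistedProduct_mul_assoc (u v w : W ⊗[k] V) :
    (twistedProduct hA hX R).mul ((twistedProduct hA hX R).mul (u ⊗ₜ v) ⊗ₜ w) =
      (twistedProduct hA hX R).mul (u ⊗ₜ (twistedProduct hA hX R).mul (v ⊗ₜ w)) := by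
  induction u with
  | zero => simp
  | add u u' hu hu' => simp only [TensorProduct.add_tmul, map_add, hu, hu']
  | tmul x a =>
  induction v with
  | zero => simp
  | add u u' hu hu' => simp only [TensorProduct.add_tmul, TensorProduct.tmul_add, map_add, hu, hu']
  | tmul y b =>
  induction w with
  | zero => simp
  | add u u' hu hu' => simp only [TensorProduct.tmul_add, map_add, hu, hu']
  | tmul z c =>
  obtain ⟨S, hS⟩ := TensorProduct.exists_finset (R (a ⊗ₜ y))
  obtain ⟨T, hT⟩ := TensorProduct.exists_finset (R (b ⊗ₜ z))
  rw [h.twistedProduct_mul_tmul, h.twistedProduct_mul_tmul, hS, hT]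
  simp only [map_sum, TensorProduct.sum_tmul, TensorProduct.tmul_sum, TensorProduct.map_tmul,
    LinearMap.comp_apply, LinearMap.flip_apply, TensorProduct.mk_apply,
    h.twistedProduct_mul_tmul, h.apply_mul_left, h.apply_mul_right, hS, hT,
    TensorProduct.assoc_symm_tmul, TensorProduct.assoc_tmul, LinearMap.id_apply]
  rw [Finset.sum_comm]
  refine Finset.sum_congr rfl fun j _ ↦ Finset.sum_congr rfl fun i _ ↦ ?_
  induction R (i.2 ⊗ₜ j.1) with
  | zero => simp
  | add u v hu hv => simp only [TensorProduct.add_tmul, TensorProduct.tmul_add, map_add, hu, hv]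
  | tmul w d => simp [hX.mul_assoc, hA.mul_assoc]

omit h in
theorem twistedProduct_unit : (twistedProduct hA hX R).unit 1 = X.unit 1 ⊗ₜ A.unit 1 := by
  simp [twistedProduct, bicrossed]

theorem twistedProduct_one_mul (u : W ⊗[k] V) :
    (twistedProduct hA hX R).mul ((twistedProduct hA hX R).unit 1 ⊗ₜ u) = u := by
  rw [twistedProduct_unit]
  induction u with
  | zero => simp
  | add u v hu hv => simp only [TensorProduct.tmul_add, map_add, hu, hv]
  | tmul y b => simp [h.twistedProduct_mul_tmul, h.one_left, hX.one_mul, hA.one_mul]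

theorem twistedProduct_mul_one (u : W ⊗[k] V) :
    (twistedProduct hA hX R).mul (u ⊗ₜ (twistedProduct hA hX R).unit 1) = u := by
  rw [twistedProduct_unit]
  induction u with
  | zero => simp
  | add u v hu hv => simp only [TensorProduct.add_tmul, map_add, hu, hv]
  | tmul y b => simp [h.twistedProduct_mul_tmul, h.one_right, hX.mul_one, hA.mul_one]

/-- Both antipodes reverse coproducts, which absorbs the reversed legs in the explicit formula; the
sum over the legs is then `(α ⊗ β) Δ = R`. What is left is the product `S(a) S(x)` rewritten in the
order `X ⊗ A`. -/
theorem twistedProduct_antipode [FiniteDimensional k V] [FiniteDimensional k W] :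
    (twistedProduct hA hX R).antipode =
      R ∘ₗ TensorProduct.map A.antipode X.antipode ∘ₗ tau k W V := by
  have hSA := hA.even_antipode
  have hSX := hX.even_antipode
  have e1 : TensorProduct.map (TensorProduct.map A.antipode X.antipode)
        (TensorProduct.map A.antipode X.antipode) ∘ₗ middleSwap k V V W W =
      middleSwap k V V W W ∘ₗ TensorProduct.map (TensorProduct.map A.antipode A.antipode)
        (TensorProduct.map X.antipode X.antipode) := (middleSwap_map hSA hSX).symm
  have e2 : tau k (W ⊗[k] W) (V ⊗[k] V) ∘ₗ TensorProduct.map (tau k W W) (tau k V V) ∘ₗ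
        TensorProduct.map X.comul A.comul =
      TensorProduct.map (tau k V V ∘ₗ A.comul) (tau k W W ∘ₗ X.comul) ∘ₗ tau k W V := by
    rw [← TensorProduct.map_comp]
    exact tau_map (isEven_tau.comp hX.even_comul) (isEven_tau.comp hA.even_comul)
  have e3 : R ∘ₗ TensorProduct.map A.antipode X.antipode =
      TensorProduct.map (fst W hA.coalg ∘ₗ R) (snd hX.coalg V ∘ₗ R) ∘ₗ middleSwap k V V W W ∘ₗ
      TensorProduct.map (A.comul ∘ₗ A.antipode) (X.comul ∘ₗ X.antipode) := by
    conv_lhs => rw [← h.map_comp_tensorComul]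
    rw [TensorProduct.map_comp A.comul X.comul A.antipode X.antipode]
    rfl
  have e4 : TensorProduct.map (TensorProduct.map A.antipode A.antipode ∘ₗ tau k V V ∘ₗ A.comul)
      (TensorProduct.map X.antipode X.antipode ∘ₗ tau k W W ∘ₗ X.comul) = _ :=
    TensorProduct.map_comp _ _ _ _
  rw [← LinearMap.comp_assoc, e3, hA.antipode_comul, hX.antipode_comul, e4,
    LinearMap.comp_assoc, LinearMap.comp_assoc, LinearMap.comp_assoc, ← e2]
  change _ ∘ₗ _ ∘ₗ middleSwap k V V W W ∘ₗ _ = _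
  rw [← LinearMap.comp_assoc _ (middleSwap k V V W W) (TensorProduct.map _ _), e1]
  rfl

/-- The bicrossed product of Hopf superalgebras is a Hopf superalgebra. -/
theorem twistedProduct_isHopfSuperalgebra [FiniteDimensional k V] [FiniteDimensional k W] :
    IsHopfSuperalgebra (twistedProduct hA hX R) := by
  have hμ := isHom_twistedProduct_mul (hA := hA) (hX := hX) h
  set D := twistedProduct hA hX R with hD
  set C := hX.coalg.tensor hA.coalg with hC
  have hp : IsHom C hX.coalg (fst W hA.coalg) := isHom_fst _ _
  have hq : IsHom C hA.coalg (snd hX.coalg V) := isHom_snd _ _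
  let i : W →ₗ[k] W ⊗[k] V := (TensorProduct.mk k W V).flip (A.unit 1)
  let j : V →ₗ[k] W ⊗[k] V := TensorProduct.mk k W V (X.unit 1)
  have hi : ∀ x y, i (X.mul (x ⊗ₜ y)) = D.mul (i x ⊗ₜ i y) := fun x y ↦ by
    simp [i, hD, h.twistedProduct_mul_tmul, h.one_left, hA.one_mul]
  have hj : ∀ a b, j (A.mul (a ⊗ₜ b)) = D.mul (j a ⊗ₜ j b) := fun a b ↦ by
    simp [j, hD, h.twistedProduct_mul_tmul, h.one_right, hX.one_mul]
  -- Every `x ⊗ a` is the product `(x ⊗ 1)(1 ⊗ a)`, and the counit axioms make this a convolution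
  -- product of the two projections.
  have hid : LinearMap.id = C.conv D.mul (i ∘ₗ fst W hA.coalg) (j ∘ₗ snd hX.coalg V) := by
    rw [conv, ← Supercoalgebra.map_star, hC, Supercoalgebra.star_fst_snd, LinearMap.comp_id]
    refine TensorProduct.ext' fun x a ↦ ?_
    simp [i, j, hD, h.twistedProduct_mul_tmul, h.one_left, hX.mul_one, hA.one_mul]
  -- The factors are inverted and their order is reversed, so in `S * id` and `id * S` the inner
  -- pair cancels first and then the outer pair.
  have hSD : D.antipode = C.conv D.mul ((j ∘ₗ A.antipode) ∘ₗ snd hX.coalg V)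
      ((i ∘ₗ X.antipode) ∘ₗ fst W hA.coalg) := by
    rw [conv, ← Supercoalgebra.map_star, hC, Supercoalgebra.star_snd_fst, hD, h.twistedProduct_antipode, ← hD,
      ← LinearMap.comp_assoc, ← LinearMap.comp_assoc]
    congr 1
    refine TensorProduct.ext' fun a x ↦ ?_
    have : (X.mul ∘ₗ TensorProduct.mk k W W (X.unit 1)) = LinearMap.id :=
      LinearMap.ext fun x ↦ hX.one_mul x
    have h' : (A.mul ∘ₗ (TensorProduct.mk k V V).flip (A.unit 1)) = LinearMap.id :=
      LinearMap.ext fun x ↦ hA.mul_one x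
    simp [i, j, hD, h.twistedProduct_mul_tmul, this, h']
  have hassoc : ∀ u v w, D.mul (D.mul (u ⊗ₜ v) ⊗ₜ w) = D.mul (u ⊗ₜ D.mul (v ⊗ₜ w)) :=
    h.twistedProduct_mul_assoc
  have hl : ∀ u, D.mul (D.unit 1 ⊗ₜ u) = u := h.twistedProduct_one_mul
  have hr : ∀ u, D.mul (u ⊗ₜ D.unit 1) = u := h.twistedProduct_mul_one
  have hi1 : i (X.unit 1) = D.unit 1 := twistedProduct_unit.symm
  have hj1 : j (A.unit 1) = D.unit 1 := twistedProduct_unit.symm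
  have hiS := hX.conv_comp_antipode_left hp hi
  have hSi := hX.conv_comp_antipode_right hp hi
  have hjS := hA.conv_comp_antipode_left hq hj
  have hSj := hA.conv_comp_antipode_right hq hj
  rw [hi1] at hiS hSi
  rw [hj1] at hjS hSj
  have hleft : C.conv D.mul D.antipode LinearMap.id =
      LinearMap.toSpanSingleton k _ (D.unit 1) ∘ₗ C.counit := by
    rw [hSD, hid, conv_assoc _ hassoc, ← conv_assoc _ hassoc _ (i ∘ₗ _), hiS,
      conv_counit_left _ hl, hjS]
  have hright : C.conv D.mul LinearMap.id D.antipode =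
      LinearMap.toSpanSingleton k _ (D.unit 1) ∘ₗ C.counit := by
    rw [hSD, hid, conv_assoc _ hassoc, ← conv_assoc _ hassoc _ ((j ∘ₗ _) ∘ₗ _), hSj,
      conv_counit_left _ hl, hSi]
  rw [toSpanSingleton_unit] at hleft hright
  have h1X := hX.even_unit 0 1 (mem_deg_field_zero _)
  have h1A := hA.even_unit 0 1 (mem_deg_field_zero _)
  have h1 : X.unit 1 ⊗ₜ A.unit 1 ∈ deg k (W ⊗[k] V) 0 := by simpa using tmul_mem h1X h1A
  exact
  { even_mul := hμ.even
    even_unit := isEven_of_apply_one (by rw [hD, twistedProduct_unit]; exact h1)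
    even_comul := C.even_comul
    even_counit := C.even_counit
    mul_assoc := hassoc
    one_mul := hl
    mul_one := hr
    coassoc := C.coassoc
    counit_comul := C.counit_comul
    comul_counit := C.comul_counit
    comul_mul := hμ.comul
    comul_one := by
      rw [hD, twistedProduct_unit]
      change middleSwap k W W V V (TensorProduct.map X.comul A.comul _) = _
      rw [TensorProduct.map_tmul, hX.comul_one, hA.comul_one, middleSwap_tmul _ _ h1X h1A]
      simp
    counit_mul := fun u v ↦ by
      have := LinearMap.congr_fun hμ.counit (u ⊗ₜ v)
      rwa [tensor_counit_tmul] at this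
    counit_one := by
      rw [hD, twistedProduct_unit]
      change C.counit _ = 1
      rw [hC, tensor_counit_tmul]
      simp [hX.counit_one, hA.counit_one]
    even_antipode := by
      rw [hD, h.twistedProduct_antipode]
      exact h.isHom.even.comp ((hA.even_antipode.map hX.even_antipode).comp isEven_tau)
    antipode_left := hleft
    antipode_right := hright }

end IsExchangeMap

end Bicrossed

open Supercoalgebra

/-! ### Comparison of maps on tensors of a fixed total degree. -/

section EqOnDeg

variable {k : Type*} [Field k]
variable {A B C M : Type*} [AddCommGroup A] [Module k A] [AddCommGroup B] [Module k B]
  [AddCommGroup C] [Module k C] [AddCommGroup M] [Module k M]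
variable [Superspace k A] [Superspace k B] [Superspace k C]

/-- Signs such as `(-1)^(|a||f|)` involve the total degree of `Δ(a)`. As `Δ` is even, it is enough
to compare on pure tensors whose degrees add up to `|a|`. -/
theorem eq_on_deg_tensor {F G : A ⊗[k] B →ₗ[k] M} {n : ZMod 2}
    (h : ∀ i j, i + j = n → ∀ a ∈ deg k A i, ∀ b ∈ deg k B j, F (a ⊗ₜ b) = G (a ⊗ₜ b))
    {t : A ⊗[k] B} (ht : t ∈ deg k (A ⊗[k] B) n) : F t = G t := by
  refine Submodule.span_induction (p := fun t _ ↦ F t = G t) ?_ (by simp)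
    (fun x y _ _ hx hy ↦ by rw [map_add, map_add, hx, hy])
    (fun c x _ hx ↦ by rw [map_smul, map_smul, hx]) ht
  rintro _ ⟨i, j, hij, a, ha, b, hb, rfl⟩
  exact h i j hij a ha b hb

theorem eq_on_deg_tensor_right {F G : A ⊗[k] (B ⊗[k] C) →ₗ[k] M} {n : ZMod 2}
    (h : ∀ i j l, i + (j + l) = n → ∀ a ∈ deg k A i, ∀ b ∈ deg k B j, ∀ c ∈ deg k C l,
      F (a ⊗ₜ (b ⊗ₜ c)) = G (a ⊗ₜ (b ⊗ₜ c)))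
    {t : A ⊗[k] (B ⊗[k] C)} (ht : t ∈ deg k (A ⊗[k] (B ⊗[k] C)) n) : F t = G t := by
  refine eq_on_deg_tensor (fun i m him a ha t ht ↦ ?_) ht
  refine eq_on_deg_tensor (F := F ∘ₗ TensorProduct.mk k _ _ a)
    (G := G ∘ₗ TensorProduct.mk k _ _ a) (fun j l hjl b hb c hc ↦ ?_) ht
  exact h i j l (by rw [hjl, him]) a ha b hb c hc

end EqOnDeg

/-! ### The evaluation pairing of `H` with `(H^op)^*`. -/

section Pairing

variable {k : Type*} [Field k]
variable {V : Type*} [AddCommGroup V] [Module k V] [Superspace k V]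

/-- The evaluation pairing `a ⊗ f ↦ (-1)^(|a||f|) f(a)`. -/
def evalPairing (k V : Type*) [Field k] [AddCommGroup V] [Module k V] [Superspace k V] :
    V ⊗[k] Module.Dual k V →ₗ[k] k := contractLeft k V ∘ₗ tau k V (Module.Dual k V)

/-- Since `f(a) = 0` unless `|f| = |a|`, the sign depends on `a` alone, and `f` need not be
homogeneous. -/
theorem evalPairing_tmul {i : ZMod 2} {a : V} (ha : a ∈ deg k V i) (f : Module.Dual k V) :
    evalPairing k V (a ⊗ₜ f) = sgn k i i * f a := by
  refine LinearMap.congr_fun (f := evalPairing k V ∘ₗ TensorProduct.mk k _ _ a)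
    (g := sgn k i i • Module.Dual.eval k V a) (linear_ext_homog fun j f hf ↦ ?_) f
  by_cases h : i = j
  · subst h; simp [evalPairing, tau_tmul ha hf]
  · simp [evalPairing, tau_tmul ha hf, dual_apply_eq_zero hf ha h]

theorem isEven_evalPairing : IsEven (evalPairing k V) := by
  refine isEven_tensor fun i j a ha f hf ↦ ?_
  rw [evalPairing_tmul ha]
  by_cases h : i = j
  · subst h
    have : i + i = 0 := CharTwo.add_self_eq_zero i
    rw [this]
    exact mem_deg_field_zero _
  · rw [dual_apply_eq_zero hf ha h, mul_zero]; exact Submodule.zero_mem _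

theorem evalPairing_comp_map {S : V →ₗ[k] V} (hS : IsEven S) :
    evalPairing k V ∘ₗ TensorProduct.map S LinearMap.id =
      evalPairing k V ∘ₗ TensorProduct.map LinearMap.id (Module.Dual.transpose (R := k) S) := by
  refine tensor_ext_homog fun i j a ha f hf ↦ ?_
  simp [evalPairing_tmul ha, evalPairing_tmul (hS _ _ ha), Module.Dual.transpose_apply]

variable {H : HopfOps k V} {Sinv : V →ₗ[k] V} [FiniteDimensional k V]

theorem lam_apply_tmul {i j : ZMod 2} {a b : V} (ha : a ∈ deg k V i) (hb : b ∈ deg k V j)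
    (t : Module.Dual k V ⊗[k] Module.Dual k V) :
    lam k V V t (a ⊗ₜ b) = sgn k i j * TensorProduct.dualDistrib k V V t (a ⊗ₜ b) := by
  refine LinearMap.congr_fun (f := Module.Dual.eval k _ (a ⊗ₜ b) ∘ₗ (lam k V V).toLinearMap)
    (g := sgn k i j • (Module.Dual.eval k _ (a ⊗ₜ b) ∘ₗ TensorProduct.dualDistrib k V V))
    (tensor_ext_homog fun p q f hf g hg ↦ ?_) t
  by_cases h : j = q
  · subst h; simp [lam_tmul_apply _ _ ha hg, sgn_comm k j i]
  · simp [lam_tmul_apply _ _ ha hg, dual_apply_eq_zero hg hb h]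

/-- The sign of `λ` cancels the sign of `τ` in `μ τ`. With the unsigned pairing, the coproduct of
`X` is dual to the plain reversed product. -/
theorem dualDistrib_opDual_comul (f : Module.Dual k V) (a b : V) :
    TensorProduct.dualDistrib k V V ((opDual H Sinv).comul f) (a ⊗ₜ b) = f (H.mul (b ⊗ₜ a)) := by
  have h : lam k V V ((opDual H Sinv).comul f) = f ∘ₗ H.mul ∘ₗ tau k V V :=
    (lam k V V).apply_symm_apply _
  refine LinearMap.congr_fun (g := f ∘ₗ H.mul ∘ₗ (TensorProduct.comm k V V).toLinearMap)
    (tensor_ext_homog fun i j a ha b hb ↦ ?_) (a ⊗ₜ b)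
  have e := LinearMap.congr_fun h (a ⊗ₜ b)
  rw [lam_apply_tmul ha hb] at e
  have e' := congrArg (sgn k i j * ·) e
  simp only [← mul_assoc, sgn_mul_self, one_mul] at e'
  simp [e', tau_tmul ha hb, ← mul_assoc, sgn_mul_self]

omit [FiniteDimensional k V] in
theorem opDual_comul_apply {i j : ZMod 2} {a b : V} (ha : a ∈ deg k V i) (hb : b ∈ deg k V j)
    (t : Module.Dual k V ⊗[k] Module.Dual k V) :
    LinearMap.mul' k k (TensorProduct.map (evalPairing k V) (evalPairing k V)
      (middleSwap k V V (Module.Dual k V) (Module.Dual k V) ((a ⊗ₜ b) ⊗ₜ t))) =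
    sgn k i j * sgn k i i * sgn k j j * TensorProduct.dualDistrib k V V t (a ⊗ₜ b) := by
  refine LinearMap.congr_fun (f := (LinearMap.mul' k k ∘ₗ TensorProduct.map (evalPairing k V)
      (evalPairing k V)) ∘ₗ middleSwap k V V (Module.Dual k V) (Module.Dual k V) ∘ₗ
      TensorProduct.mk k _ _ (a ⊗ₜ b))
    (g := (sgn k i j * sgn k i i * sgn k j j) • (Module.Dual.eval k _ (a ⊗ₜ b) ∘ₗ
      TensorProduct.dualDistrib k V V))
    (tensor_ext_homog fun p q f hf g hg ↦ ?_) t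
  by_cases h : i = p
  · subst h
    simp [middleSwap_tmul _ _ hb hf, evalPairing_tmul ha, evalPairing_tmul hb, sgn_comm k j i]
    ring
  · simp [middleSwap_tmul _ _ hb hf, evalPairing_tmul ha, dual_apply_eq_zero hf ha h]

/-- The coproduct of `X` is dual to the opposite product, so `f(ab)` is, up to sign, `∑ f'(b)
f''(a)`. This is where the opposite makes the pairing skew. -/
theorem evalPairing_mul_left (hH : IsHopfSuperalgebra H) :
    evalPairing k V ∘ₗ TensorProduct.map H.mul LinearMap.id =
    LinearMap.mul' k k ∘ₗ TensorProduct.map (evalPairing k V) (evalPairing k V) ∘ₗ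
      middleSwap k V V _ _ ∘ₗ
      TensorProduct.map (tau k V V) (opDual H Sinv).comul := by
  refine tensor_ext_homog_left fun i j l a ha b hb f hf ↦ ?_
  simp only [LinearMap.comp_apply, TensorProduct.map_tmul, LinearMap.id_apply, tau_tmul ha hb,
    ← TensorProduct.smul_tmul', map_smul, opDual_comul_apply hb ha,
    evalPairing_tmul (hH.even_mul _ _ (tmul_mem ha hb)), dualDistrib_opDual_comul,
    sgn_add_left, sgn_add_right, smul_eq_mul, sgn_comm k j i]
  ring

theorem evalPairing_mul_right (hH : IsHopfSuperalgebra H) :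
    evalPairing k V ∘ₗ TensorProduct.map LinearMap.id (opDual H Sinv).mul =
    LinearMap.mul' k k ∘ₗ TensorProduct.map (evalPairing k V) (evalPairing k V) ∘ₗ
      middleSwap k V V _ _ ∘ₗ
      TensorProduct.map H.comul LinearMap.id := by
  refine tensor_ext_homog_right fun i j l a ha f hf g hg ↦ ?_
  have h1 : (opDual H Sinv).mul (f ⊗ₜ g) a = lam k V V (f ⊗ₜ g) (H.comul a) := rfl
  simp only [LinearMap.comp_apply, TensorProduct.map_tmul, LinearMap.id_apply,
    evalPairing_tmul ha, h1]
  refine eq_on_deg_tensor (F := sgn k i i • lam k V V (f ⊗ₜ g))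
    (G := (LinearMap.mul' k k ∘ₗ TensorProduct.map (evalPairing k V)
      (evalPairing k V)) ∘ₗ middleSwap k V V (Module.Dual k V) (Module.Dual k V) ∘ₗ
      (TensorProduct.mk k _ _).flip (f ⊗ₜ g)) (fun p q hpq b hb c hc ↦ ?_) (hH.even_comul _ _ ha)
  have h2 := opDual_comul_apply hb hc (f ⊗ₜ[k] g)
  simp only [LinearMap.comp_apply, LinearMap.flip_apply, TensorProduct.mk_apply,
    LinearMap.smul_apply, smul_eq_mul]
  rw [h2, lam_apply_tmul hb hc, ← hpq]
  simp only [sgn_add_left, sgn_add_right, sgn_comm k q p]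
  linear_combination (sgn k p p * sgn k q q * sgn k p q *
    TensorProduct.dualDistrib k V V (f ⊗ₜ g) (b ⊗ₜ c)) * sgn_mul_self (k := k) p q

theorem opDual_unit : (opDual H Sinv).unit 1 = H.counit := dualOps_unit (H := opOps H Sinv)

omit [FiniteDimensional k V] in
theorem evalPairing_one_left (hH : IsHopfSuperalgebra H) (f : Module.Dual k V) :
    evalPairing k V (H.unit 1 ⊗ₜ f) = f (H.unit 1) := by
  rw [evalPairing_tmul (hH.even_unit 0 1 (mem_deg_field_zero _))]; simp

omit [FiniteDimensional k V] in
theorem evalPairing_counit (hH : IsHopfSuperalgebra H) (a : V) :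
    evalPairing k V (a ⊗ₜ H.counit) = H.counit a := by
  refine LinearMap.congr_fun (f := evalPairing k V ∘ₗ (TensorProduct.mk k V _).flip H.counit)
    (linear_ext_homog fun i a ha ↦ ?_) a
  rcases zmod2_cases i with rfl | rfl
  · simp [evalPairing_tmul ha]
  · simp [evalPairing_tmul ha, isEven_field_iff.1 hH.even_counit a ha]

/-- By definition `opDual H Sinv` unfolds to the dual of `opOps H Sinv`. -/
theorem isHopfSuperalgebra_opDual (hH : IsHopfSuperalgebra H)
    (hS : H.antipode ∘ₗ Sinv = LinearMap.id) (hS' : Sinv ∘ₗ H.antipode = LinearMap.id) :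
    IsHopfSuperalgebra (opDual H Sinv) := (hH.op hS hS').dual

/-- By multiplicativity of the pairing in `X`, convolution of endomorphisms of `X` becomes
convolution of functionals on `H ⊗ X`. -/
theorem actL_evalPairing (hH : IsHopfSuperalgebra H)
    (hX : IsHopfSuperalgebra (opDual H Sinv))
    {f : Module.Dual k V →ₗ[k] Module.Dual k V} (hf : IsEven f)
    (g : Module.Dual k V →ₗ[k] Module.Dual k V) :
    (hH.coalg.tensor hX.coalg).actL (evalPairing k V ∘ₗ TensorProduct.map LinearMap.id f)
        (evalPairing k V ∘ₗ TensorProduct.map LinearMap.id g) =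
      evalPairing k V ∘ₗ TensorProduct.map LinearMap.id
        ((opDual H Sinv).mul ∘ₗ TensorProduct.map f g ∘ₗ (opDual H Sinv).comul) := by
  have e : TensorProduct.map (LinearMap.id : V →ₗ[k] V)
      ((opDual H Sinv).mul ∘ₗ TensorProduct.map f g ∘ₗ (opDual H Sinv).comul) =
      TensorProduct.map LinearMap.id (opDual H Sinv).mul ∘ₗ
        TensorProduct.map LinearMap.id (TensorProduct.map f g ∘ₗ (opDual H Sinv).comul) := by
    rw [← TensorProduct.map_comp, LinearMap.id_comp]
  rw [IsSkewPairing.mul'_comp_map_eq_actL, ← Supercoalgebra.map_star,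
    tensor_star _ _ _ _ IsEven.id hf, star_id, e, ← LinearMap.comp_assoc _ _ (evalPairing k V),
    evalPairing_mul_right hH]
  simp only [LinearMap.comp_assoc]
  rw [← TensorProduct.map_comp, LinearMap.comp_id, LinearMap.id_comp]
  rfl

theorem evalPairing_unit_comp_counit (hH : IsHopfSuperalgebra H)
    (hX : IsHopfSuperalgebra (opDual H Sinv)) :
    evalPairing k V ∘ₗ TensorProduct.map LinearMap.id
      ((opDual H Sinv).unit ∘ₗ (opDual H Sinv).counit) = (hH.coalg.tensor hX.coalg).counit := by
  refine TensorProduct.ext' fun a f ↦ ?_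
  have : (opDual H Sinv).unit ((opDual H Sinv).counit f) =
      (opDual H Sinv).counit f • H.counit := by
    rw [← opDual_unit (Sinv := Sinv), ← map_smul, smul_eq_mul, mul_one]
  simp [this, evalPairing_counit hH, mul_comm]

/-- The antipode is the convolution inverse of the identity of `X`, so `s ∘ (id ⊗ S_X)` is inverse
to `s`. As `S_X` is the transpose of `S⁻¹`, it may be moved to the factor `H`. -/
theorem isInv_evalPairing (hH : IsHopfSuperalgebra H) (hX : IsHopfSuperalgebra (opDual H Sinv))
    (hSinv : IsEven Sinv) : (hH.coalg.tensor hX.coalg).IsInv (evalPairing k V)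
      (evalPairing k V ∘ₗ TensorProduct.map Sinv LinearMap.id) := by
  have ht : evalPairing k V ∘ₗ TensorProduct.map Sinv LinearMap.id =
      evalPairing k V ∘ₗ TensorProduct.map LinearMap.id (opDual H Sinv).antipode :=
    evalPairing_comp_map hSinv
  have h1 := actL_evalPairing hH hX IsEven.id (opDual H Sinv).antipode
  have h2 := actL_evalPairing hH hX hX.even_antipode LinearMap.id
  rw [TensorProduct.map_id, LinearMap.comp_id, hX.antipode_right,
    evalPairing_unit_comp_counit hH hX] at h1
  rw [TensorProduct.map_id, LinearMap.comp_id, hX.antipode_left,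
    evalPairing_unit_comp_counit hH hX] at h2
  rw [ht]
  exact ⟨h1, h2⟩

/-- The evaluation pairing of a Hopf superalgebra with the dual of its opposite is a skew
pairing. -/
theorem isSkewPairing_evalPairing (hH : IsHopfSuperalgebra H)
    (hX : IsHopfSuperalgebra (opDual H Sinv)) (hSinv : IsEven Sinv) :
    IsSkewPairing hH.toIsSuperbialgebra hX.toIsSuperbialgebra (evalPairing k V)
      (evalPairing k V ∘ₗ TensorProduct.map Sinv LinearMap.id) where
  even := isEven_evalPairing
  even_inv := isEven_evalPairing.comp (hSinv.map IsEven.id)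
  isInv := isInv_evalPairing hH hX hSinv
  mul_left := evalPairing_mul_left hH
  mul_right := evalPairing_mul_right hH
  one_left := evalPairing_one_left hH
  one_right a := by rw [opDual_unit]; exact evalPairing_counit hH a

end Pairing

open Supercoalgebra

/-! ### The actions `α` and `β` as components of the exchange map. -/

section CoadjointActions

variable {k : Type*} [Field k]
variable {V W : Type*} [AddCommGroup V] [Module k V] [Superspace k V]
  [AddCommGroup W] [Module k W] [Superspace k W]

namespace Supercoalgebra

/-- The counit hidden in `snd` collapses `Δ(a)`, so only the coproduct of `x` survives. In the
companion lemma for `fst`, it is `Δ(x)` that collapses. -/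
theorem actR_snd_tmul (C : Supercoalgebra k V) (D : Supercoalgebra k W) (t : V ⊗[k] W →ₗ[k] k)
    (a : V) (x : W) : (C.tensor D).actR (snd C W) t (a ⊗ₜ x) =
      TensorProduct.rid k W (TensorProduct.map LinearMap.id t (TensorProduct.assoc k W V W
        (TensorProduct.map (tau k V W) LinearMap.id
          ((TensorProduct.assoc k V W W).symm (a ⊗ₜ D.comul x))))) := by
  have e : (TensorProduct.rid k W).toLinearMap ∘ₗ TensorProduct.map (snd C W) t ∘ₗ
      middleSwap k V V W W = ((TensorProduct.rid k W).toLinearMap ∘ₗ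
        TensorProduct.map LinearMap.id t ∘ₗ (TensorProduct.assoc k W V W).toLinearMap ∘ₗ
        TensorProduct.map (tau k V W) LinearMap.id ∘ₗ
        (TensorProduct.assoc k V W W).symm.toLinearMap) ∘ₗ
        TensorProduct.map ((TensorProduct.lid k V).toLinearMap ∘ₗ LinearMap.rTensor V C.counit)
          LinearMap.id := by
    refine tensor_ext_homog_four fun i j l m b hb c hc y hy z hz ↦ ?_
    simp [middleSwap_tmul _ _ hc hy, tau_tmul hc hy, ← TensorProduct.smul_tmul', smul_smul,
      mul_comm]
  refine (LinearMap.congr_fun e (C.comul a ⊗ₜ D.comul x)).trans ?_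
  simp [C.counit_comul]

theorem actR_fst_tmul (C : Supercoalgebra k V) (D : Supercoalgebra k W) (t : V ⊗[k] W →ₗ[k] k)
    (a : V) (x : W) : (C.tensor D).actR (fst V D) t (a ⊗ₜ x) =
      TensorProduct.rid k V (TensorProduct.map LinearMap.id t (TensorProduct.assoc k V V W
        (C.comul a ⊗ₜ x))) := by
  have e : (TensorProduct.rid k V).toLinearMap ∘ₗ TensorProduct.map (fst V D) t ∘ₗ
      middleSwap k V V W W = ((TensorProduct.rid k V).toLinearMap ∘ₗ
        TensorProduct.map LinearMap.id t ∘ₗ (TensorProduct.assoc k V V W).toLinearMap) ∘ₗ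
        TensorProduct.map LinearMap.id
          ((TensorProduct.lid k W).toLinearMap ∘ₗ LinearMap.rTensor W D.counit) := by
    refine tensor_ext_homog_four fun i j l m b hb c hc y hy z hz ↦ ?_
    rcases zmod2_cases l with rfl | rfl
    · simp [middleSwap_tmul _ _ hc hy, smul_smul, mul_comm]
    · simp [middleSwap_tmul _ _ hc hy, isEven_field_iff.1 D.even_counit y hy]
  refine (LinearMap.congr_fun e (C.comul a ⊗ₜ D.comul x)).trans ?_
  simp [D.counit_comul]

end Supercoalgebra

theorem fst_comp_exchangeMap {A : BialgOps k V} {X : BialgOps k W}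
    (hA : IsSuperbialgebra A) (hX : IsSuperbialgebra X) (s t : V ⊗[k] W →ₗ[k] k) :
    fst W hA.coalg ∘ₗ exchangeMap hA hX s t =
      (hA.coalg.tensor hX.coalg).conj s t (snd hA.coalg W) := by
  rw [exchangeMap, comp_conj, fst_comp_tau]

theorem snd_comp_exchangeMap {A : BialgOps k V} {X : BialgOps k W}
    (hA : IsSuperbialgebra A) (hX : IsSuperbialgebra X) (s t : V ⊗[k] W →ₗ[k] k) :
    snd hX.coalg V ∘ₗ exchangeMap hA hX s t =
      (hA.coalg.tensor hX.coalg).conj s t (fst V hX.coalg) := by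
  rw [exchangeMap, comp_conj, snd_comp_tau]

variable [FiniteDimensional k V] {H : HopfOps k V} {Sinv : V →ₗ[k] V}

/-- The right factor `t` accounts for left multiplication by `S⁻¹(a)` inside `f`. The left factor
`s` will add right multiplication by `a'`. -/
theorem actR_snd_evalPairing_apply (hH : IsHopfSuperalgebra H)
    (hX : IsHopfSuperalgebra (opDual H Sinv)) (hSinv : IsEven Sinv) {i l : ZMod 2} {a x : V}
    (ha : a ∈ deg k V i) (hx : x ∈ deg k V l) (f : Module.Dual k V) :
    (hH.coalg.tensor hX.coalg).actR (snd hH.coalg _)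
      (evalPairing k V ∘ₗ TensorProduct.map Sinv LinearMap.id) (a ⊗ₜ f) x =
      sgn k i l * sgn k i i * f (H.mul (Sinv a ⊗ₜ x)) := by
  rw [actR_snd_tmul, ← dualDistrib_opDual_comul (H := H) (Sinv := Sinv)]
  refine LinearMap.congr_fun (f := Module.Dual.eval k V x ∘ₗ
    (TensorProduct.rid k (Module.Dual k V)).toLinearMap ∘ₗ
    TensorProduct.map LinearMap.id (evalPairing k V ∘ₗ TensorProduct.map Sinv LinearMap.id) ∘ₗ
    (TensorProduct.assoc k _ V _).toLinearMap ∘ₗ TensorProduct.map (tau k V _) LinearMap.id ∘ₗ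
    (TensorProduct.assoc k V _ _).symm.toLinearMap ∘ₗ TensorProduct.mk k _ _ a)
    (g := (sgn k i l * sgn k i i) • (Module.Dual.eval k _ (x ⊗ₜ Sinv a) ∘ₗ
      TensorProduct.dualDistrib k V V))
    (tensor_ext_homog fun p q g hg h hh ↦ ?_) ((opDual H Sinv).comul f)
  by_cases e : l = p
  · subst e
    simp [tau_tmul ha hg, evalPairing_tmul (hSinv _ _ ha), ← TensorProduct.smul_tmul']
    ring
  · simp [tau_tmul ha hg, evalPairing_tmul (hSinv _ _ ha), ← TensorProduct.smul_tmul',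
      dual_apply_eq_zero hg hx e]

/-- In the conjugate, `s(a', f')` and the value of `f''` at `S⁻¹(a'') x` combine by the definition
of the coproduct of `X` to `f(S⁻¹(a'') x a')`. It remains to compare signs. -/
theorem coadjLeft_eq_conj (hH : IsHopfSuperalgebra H)
    (hX : IsHopfSuperalgebra (opDual H Sinv)) (hSinv : IsEven Sinv) :
    coadjLeft H Sinv = (hH.coalg.tensor hX.coalg).conj (evalPairing k V)
      (evalPairing k V ∘ₗ TensorProduct.map Sinv LinearMap.id) (snd hH.coalg _) := by
  refine tensor_ext_homog fun i j a ha f hf ↦ linear_ext_homog fun l x hx ↦ ?_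
  set G := (hH.coalg.tensor hX.coalg).actR (snd hH.coalg (Module.Dual k V))
      (evalPairing k V ∘ₗ TensorProduct.map Sinv LinearMap.id) with hG
  have key : ∀ {p q : ZMod 2} {b c : V}, b ∈ deg k V p → c ∈ deg k V q →
      TensorProduct.lid k (Module.Dual k V) (TensorProduct.map (evalPairing k V) G
        (middleSwap k V V _ _ ((b ⊗ₜ c) ⊗ₜ (opDual H Sinv).comul f))) x =
      sgn k q p * sgn k p p * sgn k q l * sgn k q q *
        f (H.mul (H.mul (Sinv c ⊗ₜ x) ⊗ₜ b)) := by
    intro p q b c hb hc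
    rw [← dualDistrib_opDual_comul (H := H) (Sinv := Sinv)]
    refine LinearMap.congr_fun (f := Module.Dual.eval k V x ∘ₗ
      (TensorProduct.lid k (Module.Dual k V)).toLinearMap ∘ₗ TensorProduct.map (evalPairing k V) G ∘ₗ
      middleSwap k V V (Module.Dual k V) (Module.Dual k V) ∘ₗ TensorProduct.mk k _ _ (b ⊗ₜ c))
      (g := (sgn k q p * sgn k p p * sgn k q l * sgn k q q) •
        (Module.Dual.eval k _ (b ⊗ₜ H.mul (Sinv c ⊗ₜ x)) ∘ₗ TensorProduct.dualDistrib k V V))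
      (tensor_ext_homog fun r s g hg h hh ↦ ?_) ((opDual H Sinv).comul f)
    have hGx := actR_snd_evalPairing_apply hH hX hSinv hc hx h
    rw [← hG] at hGx
    by_cases e : p = r
    · subst e
      simp [middleSwap_tmul _ _ hc hg, evalPairing_tmul hb, hGx]
      ring
    · simp [middleSwap_tmul _ _ hc hg, evalPairing_tmul hb, dual_apply_eq_zero hg hb e]
  have hl : coadjLeft H Sinv (a ⊗ₜ f) x = sgn k i j * f (H.mul (LinearMap.rTensor V
      (H.mul ∘ₗ LinearMap.rTensor V Sinv) (tau k V (V ⊗[k] V)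
        (TensorProduct.assoc k V V V (H.comul a ⊗ₜ x))))) := by
    simp only [coadjLeft, TensorProduct.curry_apply, LinearMap.comp_apply, LinearMap.rTensor_tmul,
      tau_tmul ha hf, LinearEquiv.coe_coe, TensorProduct.assoc_tmul, LinearMap.lTensor_tmul,
      ← TensorProduct.smul_tmul', contractLeft_apply, map_smul, smul_eq_mul]
  rw [hl]
  refine eq_on_deg_tensor (F := sgn k i j • (f ∘ₗ H.mul ∘ₗ LinearMap.rTensor V
      (H.mul ∘ₗ LinearMap.rTensor V Sinv) ∘ₗ tau k V (V ⊗[k] V) ∘ₗ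
        (TensorProduct.assoc k V V V).toLinearMap ∘ₗ (TensorProduct.mk k _ _).flip x))
    (G := Module.Dual.eval k V x ∘ₗ (TensorProduct.lid k (Module.Dual k V)).toLinearMap ∘ₗ
      TensorProduct.map (evalPairing k V) G ∘ₗ
      middleSwap k V V (Module.Dual k V) (Module.Dual k V) ∘ₗ
      (TensorProduct.mk k _ _).flip ((opDual H Sinv).comul f))
    (fun p q hpq b hb c hc ↦ ?_) (hH.even_comul _ _ ha)
  refine Eq.trans ?_ (key hb hc).symm
  have hm : H.mul (H.mul (Sinv c ⊗ₜ x) ⊗ₜ b) ∈ deg k V (q + l + p) :=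
    hH.even_mul _ _ (tmul_mem (hH.even_mul _ _ (tmul_mem (hSinv _ _ hc) hx)) hb)
  simp only [LinearMap.smul_apply, LinearMap.comp_apply, LinearMap.flip_apply,
    TensorProduct.mk_apply, LinearEquiv.coe_coe, TensorProduct.assoc_tmul,
    tau_tmul hb (tmul_mem hc hx), map_smul, LinearMap.rTensor_tmul, smul_eq_mul]
  -- Unless `|f| = |a'| + |a''| + |x|`, both sides vanish. If it holds, expanding all signs shows
  -- that they differ only by squares for the pairs `(a', a'')` and `(a', x)`.
  by_cases e : q + l + p = j
  · rw [← e, ← hpq]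
    simp only [sgn_add_left, sgn_add_right, sgn_comm k q p]
    linear_combination (sgn k p q * sgn k p p * sgn k q l * sgn k q q *
        f (H.mul (H.mul (Sinv c ⊗ₜ x) ⊗ₜ b))) * (sgn k p l * sgn k p l * sgn_mul_self (k := k) p q +
        sgn_mul_self (k := k) p l)
  · rw [dual_apply_eq_zero hf hm e]; simp

theorem coadjRight_eq_conj (hH : IsHopfSuperalgebra H)
    (hX : IsHopfSuperalgebra (opDual H Sinv)) (hSinv : IsEven Sinv) :
    coadjRight H Sinv = (hH.coalg.tensor hX.coalg).conj (evalPairing k V)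
      (evalPairing k V ∘ₗ TensorProduct.map Sinv LinearMap.id) (fst V hX.coalg) := by
  refine tensor_ext_homog fun i j a ha f hf ↦ ?_
  set t := evalPairing k V ∘ₗ TensorProduct.map Sinv LinearMap.id with ht
  let G₀ : (V ⊗[k] V) ⊗[k] Module.Dual k V →ₗ[k] V := (TensorProduct.rid k V).toLinearMap ∘ₗ
    TensorProduct.map LinearMap.id t ∘ₗ (TensorProduct.assoc k V V _).toLinearMap
  let L : (V ⊗[k] (V ⊗[k] V)) ⊗[k] (Module.Dual k V ⊗[k] Module.Dual k V) →ₗ[k] V :=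
    (TensorProduct.lid k V).toLinearMap ∘ₗ TensorProduct.map (evalPairing k V) G₀ ∘ₗ
      middleSwap k V (V ⊗[k] V) (Module.Dual k V) (Module.Dual k V)
  have hG : (hH.coalg.tensor hX.coalg).actR (fst V hX.coalg) t =
      G₀ ∘ₗ TensorProduct.map H.comul LinearMap.id :=
    TensorProduct.ext' fun a f ↦ actR_fst_tmul _ _ _ _ _
  -- The two coproducts hidden in the conjugate are merged into the iterated coproduct `(id ⊗ Δ)
  -- Δ(a)`, the form in which `coadjRight` uses it; `L` is what remains once that tensor is given.
  have hL : (hH.coalg.tensor hX.coalg).conj (evalPairing k V) t (fst V hX.coalg) (a ⊗ₜ f) =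
      L (LinearMap.lTensor V H.comul (H.comul a) ⊗ₜ (opDual H Sinv).comul f) := by
    have e1 : TensorProduct.map (evalPairing k V) (G₀ ∘ₗ TensorProduct.map H.comul LinearMap.id) ∘ₗ
        middleSwap k V V (Module.Dual k V) (Module.Dual k V) =
        TensorProduct.map (evalPairing k V) G₀ ∘ₗ
        middleSwap k V (V ⊗[k] V) (Module.Dual k V) (Module.Dual k V) ∘ₗ
        TensorProduct.map (TensorProduct.map LinearMap.id H.comul)
          (TensorProduct.map LinearMap.id LinearMap.id) := by
      rw [middleSwap_map hH.even_comul IsEven.id, ← LinearMap.comp_assoc, ← TensorProduct.map_comp,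
        TensorProduct.map_id, LinearMap.comp_id]
    rw [conj, hG]
    refine congrArg (TensorProduct.lid k V) ((LinearMap.congr_fun e1 _).trans ?_)
    simp only [LinearMap.comp_apply, TensorProduct.map_tmul, TensorProduct.map_id,
      LinearMap.id_apply]
    rfl
  have key : ∀ {p u v : ZMod 2} {b d e : V}, b ∈ deg k V p → d ∈ deg k V u → e ∈ deg k V v →
      L ((b ⊗ₜ (d ⊗ₜ e)) ⊗ₜ (opDual H Sinv).comul f) =
        (sgn k (u + v) p * sgn k p p * sgn k v v * f (H.mul (Sinv e ⊗ₜ b))) • d := by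
    intro p u v b d e hb hd he
    rw [← dualDistrib_opDual_comul (H := H) (Sinv := Sinv)]
    refine LinearMap.congr_fun (f := L ∘ₗ TensorProduct.mk k _ _ (b ⊗ₜ (d ⊗ₜ e)))
      (g := LinearMap.toSpanSingleton k V d ∘ₗ ((sgn k (u + v) p * sgn k p p * sgn k v v) •
        (Module.Dual.eval k _ (b ⊗ₜ Sinv e) ∘ₗ TensorProduct.dualDistrib k V V)))
      (tensor_ext_homog fun r s g hg h hh ↦ ?_) ((opDual H Sinv).comul f)
    by_cases e' : p = r
    · subst e'
      simp [L, G₀, ht, middleSwap_tmul _ _ (tmul_mem hd he) hg, evalPairing_tmul hb,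
        evalPairing_tmul (hSinv _ _ he), smul_smul]
      congr 1
      ring
    · simp [L, G₀, ht, middleSwap_tmul _ _ (tmul_mem hd he) hg, evalPairing_tmul hb,
        dual_apply_eq_zero hg hb e']
  rw [hL]
  have hr : coadjRight H Sinv (a ⊗ₜ f) = sgn k i j • TensorProduct.lid k V
      (LinearMap.rTensor V (contractLeft k V) ((TensorProduct.assoc k _ V V).symm (f ⊗ₜ
        (LinearMap.rTensor V (H.mul ∘ₗ LinearMap.rTensor V Sinv)
          ((TensorProduct.assoc k V V V).symm (tau k (V ⊗[k] V) V
            ((TensorProduct.assoc k V V V).symm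
              (LinearMap.lTensor V H.comul (H.comul a))))))))) := by
    simp only [coadjRight, LinearMap.comp_apply, tau_tmul ha hf, map_smul, LinearEquiv.coe_coe,
      LinearMap.lTensor_tmul]
  rw [hr]
  refine eq_on_deg_tensor_right (F := sgn k i j • ((TensorProduct.lid k V).toLinearMap ∘ₗ
      LinearMap.rTensor V (contractLeft k V) ∘ₗ (TensorProduct.assoc k _ V V).symm.toLinearMap ∘ₗ
      TensorProduct.mk k _ _ f ∘ₗ LinearMap.rTensor V (H.mul ∘ₗ LinearMap.rTensor V Sinv) ∘ₗ
      (TensorProduct.assoc k V V V).symm.toLinearMap ∘ₗ tau k (V ⊗[k] V) V ∘ₗ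
      (TensorProduct.assoc k V V V).symm.toLinearMap))
    (G := L ∘ₗ (TensorProduct.mk k _ _).flip ((opDual H Sinv).comul f))
    (fun p u v hpuv b hb d hd e he ↦ ?_)
    ((IsEven.id.map hH.even_comul) _ _ (hH.even_comul _ _ ha))
  refine Eq.trans ?_ (key hb hd he).symm
  have hm : H.mul (Sinv e ⊗ₜ b) ∈ deg k V (v + p) :=
    hH.even_mul _ _ (tmul_mem (hSinv _ _ he) hb)
  simp only [LinearMap.smul_apply, LinearMap.comp_apply, TensorProduct.mk_apply,
    LinearEquiv.coe_coe, TensorProduct.assoc_symm_tmul, tau_tmul (tmul_mem hb hd) he, map_smul,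
    LinearMap.rTensor_tmul, contractLeft_apply, TensorProduct.lid_tmul,
    smul_smul]
  congr 1
  -- Only terms with `|f| = |a'| + |a'''|` contribute. The signs then differ by squares for the
  -- pairs `(a', a''')` and `(a'', a''')`.
  by_cases e' : v + p = j
  · rw [← e', ← hpuv]
    simp only [sgn_add_left, sgn_add_right, sgn_comm k v p, sgn_comm k u p]
    linear_combination (sgn k p u * sgn k p p * sgn k v v * sgn k p v *
      f (H.mul (Sinv e ⊗ₜ b))) * (sgn k u v * sgn k u v * sgn_mul_self (k := k) p v +
        sgn_mul_self (k := k) u v)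
  · rw [dual_apply_eq_zero hf hm e']; simp

theorem coadjLeft_eq_fst_comp_exchangeMap (hH : IsHopfSuperalgebra H)
    (hX : IsHopfSuperalgebra (opDual H Sinv)) (hSinv : IsEven Sinv) :
    coadjLeft H Sinv = fst _ hH.coalg ∘ₗ exchangeMap hH.toIsSuperbialgebra hX.toIsSuperbialgebra
      (evalPairing k V) (evalPairing k V ∘ₗ TensorProduct.map Sinv LinearMap.id) :=
  (coadjLeft_eq_conj hH hX hSinv).trans (fst_comp_exchangeMap _ _ _ _).symm

theorem coadjRight_eq_snd_comp_exchangeMap (hH : IsHopfSuperalgebra H)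
    (hX : IsHopfSuperalgebra (opDual H Sinv)) (hSinv : IsEven Sinv) :
    coadjRight H Sinv = snd hX.coalg V ∘ₗ exchangeMap hH.toIsSuperbialgebra hX.toIsSuperbialgebra
      (evalPairing k V) (evalPairing k V ∘ₗ TensorProduct.map Sinv LinearMap.id) :=
  (coadjRight_eq_conj hH hX hSinv).trans (snd_comp_exchangeMap _ _ _ _).symm

end CoadjointActions

end SuperHopf

end

/-! ### The quantum double theorem, with the evaluation pairing as the skew pairing. -/

theorem mainTheorem2 {k : Type*} [Field k] [CharZero k]
    {V : Type*} [AddCommGroup V] [Module k V] [FiniteDimensional k V] [SuperHopf.Superspace k V]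
    (H : SuperHopf.HopfOps k V) (hH : SuperHopf.IsHopfSuperalgebra H)
    (Sinv : V →ₗ[k] V) (hS : H.antipode ∘ₗ Sinv = LinearMap.id)
    (hS' : Sinv ∘ₗ H.antipode = LinearMap.id) :
    SuperHopf.IsHopfSuperalgebra (SuperHopf.opDual H Sinv) ∧
    SuperHopf.IsMatchedPair (SuperHopf.opDual H Sinv).toBialgOps H.toBialgOps
      (SuperHopf.coadjLeft H Sinv) (SuperHopf.coadjRight H Sinv) ∧
    SuperHopf.IsHopfSuperalgebra (SuperHopf.quantumDouble H Sinv) := by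
  have hX := SuperHopf.isHopfSuperalgebra_opDual hH hS hS'
  have hSinv : SuperHopf.IsEven Sinv := (hH.op hS hS').even_antipode
  have hP := SuperHopf.isSkewPairing_evalPairing hH hX hSinv
  have hα := SuperHopf.coadjLeft_eq_fst_comp_exchangeMap hH hX hSinv
  have hβ := SuperHopf.coadjRight_eq_snd_comp_exchangeMap hH hX hSinv
  refine ⟨hX, ?_, ?_⟩
  · rw [hα, hβ]
    exact hP.isExchangeMap.isMatchedPair hP.star_snd_fst_exchangeMap
  · rw [SuperHopf.quantumDouble, hα, hβ]
    exact SuperHopf.IsExchangeMap.twistedProduct_isHopfSuperalgebra (hA := hH) (hX := hX)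
      hP.isExchangeMap
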